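/- Let $\mathfrak g$ be a topological Lie algebra over $\mathbf R$ (topological additive group, continuous dilations, jointly continuous bracket; a Lie algebra without topology is given the discrete topology, so that all multilinear forms are continuous), and let $\mathfrak g'$ be its continuous dual, with $(g\gamma)(h)=\gamma([h,g])$. Let $C^k(\mathfrak g)$ be the space of continuous $k$-linear forms on $\mathfrak g$ with the Leibniz coboundary $$(d\alpha)(g_1,\dots,g_{k+1})=\sum_{1\le i<j\le k+1}(-1)^{j+1}\alpha(g_1,\dots,[g_i,g_j],\dots,\hat g_j,\dots,g_{k+1}),$$ and let $HL^*(\mathfrak g)$ be its cohomology. Let $\Omega^k(\mathfrak g)\subseteq C^k(\mathfrak g)$ be the alternating forms and $\Omega^m(\mathfrak g;\mathfrak g')$ the alternating $m$-linear maps $\beta:\mathfrak g^m\to\mathfrak g'$ for which $(h,g_1,\dots,g_m)\mapsto\beta(g_1,\dots,g_m)(h)$ is continuous, with the Chevalley–Eilenberg coboundary. Let $i:\Omega^{m}(\mathfrak g;\mathfrak g')\to C^{m+1}(\mathfrak g)$, $(i\beta)(g_0,\dots,g_m)=(-1)^m\beta(g_1,\dots,g_m)(g_0)$, and $\mathrm{Var}:\Omega^{m+1}(\mathfrak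 g)\to\Omega^m(\mathfrak g;\mathfrak g')$, $\mathrm{Var}(\alpha)(g_1,\dots,g_m)(g_0)=(-1)^m\alpha(g_0,\dots,g_m)$; both commute with the coboundaries. For $n\ge 0$ put $$C^n_{RG}(\mathfrak g)=C^{n+2}(\mathfrak g)/i[\Omega^{n+1}(\mathfrak g;\mathfrak g')],\qquad CR^n(\mathfrak g)=\Omega^{n+1}(\mathfrak g;\mathfrak g')/\mathrm{Var}[\Omega^{n+2}(\mathfrak g)],$$ with the induced coboundaries, and let $H^n_{RG}(\mathfrak g)$, $HR^n(\mathfrak g)$ be the cohomology in degrees $n\ge0$. Filter $C^*_{RG}(\mathfrak g)$ by letting $F^s$ ($s\ge0$) consist of the classes of the forms that are alternating in their last $s+1$ arguments (in all arguments if there are fewer than $s+1$). **Theorem.** The spectral sequence $E_r^{s,n}$ ($r\ge 0$; $s,n\ge0$; $d_r$ of bidegree $(r,1-r)$; total degree $s+n$) of the complex $C_{RG}^*(\mathfrak g)$ filtered by the $F^s$ exists and converges to $H^*_{RG}(\mathfrak g)$: the induced filtration of $H^m_{RG}(\mathfrak g)$ is finite, exhaustive and separated, and $E_r^{s,m-s}\cong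 F^sH^m_{RG}/F^{s+1}H^m_{RG}$ canonically for $0\le s\le m$ and all large $r$. Moreover: 1. $E_2^{s,0}=0$ for all $s\ge0$. 2. Suppose that $\mathfrak g$ is either discrete (an abstract Lie algebra of any dimension) or pro-finite-dimensional, that is, every neighbourhood of $0$ contains a closed subspace of finite codimension, and every family of closed affine subspaces with the finite intersection property has a common point (for instance $\mathfrak g$ finite-dimensional, or the Lie algebra $W_1$ of formal vector fields). Then for all $n\ge1$ and $s\ge0$ $$E_2^{s,n}\cong HL^n(\mathfrak g)\,\hat\otimes\,HR^s(\mathfrak g).$$ The isomorphism sends $[\alpha]\otimes[\gamma]$ to the class of an element of $F^s$ that is congruent modulo $F^{s+1}$ to the class of the product form $\alpha(g_1,\dots,g_n)\,(i\gamma)(h_0,\dots,h_{s+1})$. Here, for vector spaces $E,F$ with linear topologies, $E\hat\otimes F=\varprojlim E/U\otimes F/W$ over the open subspaces $U\subseteq E$, $W\subseteq F$. Cochains carry the linear topology of convergence on linearly compact subspaces $K\subseteq\mathfrak g$ (the cochains that vanish when all arguments lie in $K$ form a basic open subspace), where $K$ is linearly compact if every family of closed affine subspaces of $K$ with the finite intersection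 property has a common point; $HL^n$ and $HR^s$ carry the subquotient topologies. If $\mathfrak g$ is pro-finite-dimensional these topologies are discrete and $\hat\otimes=\otimes$; if $\mathfrak g$ is discrete they are the topologies of pointwise convergence. -/

import Mathlib

/-- A topological Lie algebra over `ℝ`: the additive group is topological, every dilation is
continuous and the bracket is jointly continuous.  Any real Lie algebra with the discrete topology
is an example; every multilinear form on it is then continuous. -/
class IsTopologicalLieAlgebra (g : Type*) [LieRing g] [LieAlgebra ℝ g] [TopologicalSpace g] : Prop
    extends IsTopologicalAddGroup g, ContinuousConstSMul ℝ g where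
  continuous_bracket : Continuous fun p : g × g => ⁅p.1, p.2⁆

universe u

namespace Leibniz

/-! ### Generalities on graded modules with a differential, and on filtrations -/

section Filtered

variable {C : ℕ → Type u} [∀ m, AddCommGroup (C m)] [∀ m, Module ℝ (C m)]
  (d : ∀ m, C m →ₗ[ℝ] C (m + 1))

/-- The image in degree `m` of a graded submodule `N` under the differential
(it is zero in degree `0`). -/
def dImage (N : ∀ m, Submodule ℝ (C m)) : ∀ m, Submodule ℝ (C m)
  | 0 => ⊥
  | m + 1 => (N m).map (d m)

/-- Cocycles of degree `m`. -/
abbrev Cocycles (m : ℕ) : Submodule ℝ (C m) := LinearMap.ker (d m)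

/-- The cohomology `ker d / im d` in degree `m`. -/
abbrev Cohomology (m : ℕ) : Type u :=
  Cocycles d m ⧸ (dImage d (fun _ => ⊤) m).submoduleOf (Cocycles d m)

/-- The class of a cocycle. -/
abbrev Cohomology.mk (m : ℕ) : Cocycles d m →ₗ[ℝ] Cohomology d m :=
  ((dImage d (fun _ => ⊤) m).submoduleOf (Cocycles d m)).mkQ

variable (F : ℕ → ∀ m, Submodule ℝ (C m))

/-- `Z_r^s` in total degree `m`: the `x ∈ F^s` with `d x ∈ F^{s+r}`. -/
def pageCycles (r s m : ℕ) : Submodule ℝ (C m) :=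
  F s m ⊓ (F (s + r) (m + 1)).comap (d m)

/-- The elements of `Z_r^s` that vanish on the `r`-th page, in total degree `m`:
`Z_r^s ∩ F^{s+1} + F^s ∩ d F^{s-r+1}`.  Here `F^p` is everything for `p ≤ 0`, which agrees with
the truncated subtraction because only filtrations with `F^0` everything are considered. -/
def pageBoundaries (r s m : ℕ) : Submodule ℝ (C m) :=
  (pageCycles d F r s m ⊓ F (s + 1) m) ⊔ (F s m ⊓ dImage d (F (s + 1 - r)) m)

/-- The page `E_r^s` in total degree `m` of the spectral sequence of a filtered complex. -/
abbrev Page (r s m : ℕ) : Type u :=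
  pageCycles d F r s m ⧸ (pageBoundaries d F r s m).submoduleOf (pageCycles d F r s m)

/-- The class on the `r`-th page of an element of `Z_r^s`. -/
abbrev Page.mk (r s m : ℕ) : pageCycles d F r s m →ₗ[ℝ] Page d F r s m :=
  ((pageBoundaries d F r s m).submoduleOf (pageCycles d F r s m)).mkQ

/-- The filtration of the cohomology: classes that have a representative in `F^s`. -/
def cohomologyFiltration (s m : ℕ) : Submodule ℝ (Cohomology d m) :=
  ((F s m).submoduleOf (Cocycles d m)).map (Cohomology.mk d m)

open CategoryTheory in
/-- First quadrant cohomological spectral sequences of real vector spaces, starting with the page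
`E_0`; the differential of `E_r` has bidegree `(r, 1 - r)`. -/
abbrev SpecSeq : Type (u + 1) := CohomologicalSpectralSequenceNat (ModuleCat.{u} ℝ) 0

/-- The `(s, n)` entry `E_r^{s,n}`, as a real vector space. -/
abbrev SpecSeq.entry (E : SpecSeq.{u}) (r s n : ℕ) : ModuleCat.{u} ℝ :=
  (E.page (r : ℤ) (Int.natCast_nonneg r)).X (s, n)

/-- `E` is the spectral sequence of the filtered complex `(C, d, F)`, through the identifications
`φ` of its entries `E_r^{s,n}` with the pages of the filtered complex in total degree `m = s + n`:
the differential of `E_r` sends the class of `x` to the class of `d x`, and the isomorphism of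
the homology of `E_r` with `E_{r+1}` sends the class of `x ∈ Z_{r+1}^s ⊆ Z_r^s` to the class
of `x`. -/
structure IsSpecSeqOf (E : SpecSeq.{u})
    (φ : ∀ r s n m : ℕ, s + n = m → (Page d F r s m ≃ₗ[ℝ] E.entry r s n)) : Prop where
  d_mk : ∀ (r s n n' m : ℕ) (h : s + n = m) (h' : s + r + n' = m + 1)
    (x : C m) (hx : x ∈ pageCycles d F r s m),
    ∃ hy : d m x ∈ pageCycles d F r (s + r) (m + 1),
      ((E.page (r : ℤ) (Int.natCast_nonneg r)).d (s, n) (s + r, n')).hom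
          (φ r s n m h (Page.mk d F r s m ⟨x, hx⟩)) =
        φ r (s + r) n' (m + 1) h' (Page.mk d F r (s + r) (m + 1) ⟨d m x, hy⟩)
  iso_mk : ∀ (r s n m : ℕ) (h : s + n = m) (x : C m) (hx : x ∈ pageCycles d F r s m)
    (hx' : x ∈ pageCycles d F (r + 1) s m)
    (z : (E.page (r : ℤ) (Int.natCast_nonneg r)).cycles (s, n)),
    ((E.page (r : ℤ) (Int.natCast_nonneg r)).iCycles (s, n)).hom z =
        φ r s n m h (Page.mk d F r s m ⟨x, hx⟩) →
      (E.iso (r : ℤ) ((r + 1 : ℕ) : ℤ) (s, n) (by push_cast; rfl) (Int.natCast_nonneg r)).hom.hom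
          (((E.page (r : ℤ) (Int.natCast_nonneg r)).homologyπ (s, n)).hom z) =
        φ (r + 1) s n m h (Page.mk d F (r + 1) s m ⟨x, hx'⟩)

/-- Convergence of the spectral sequence of a filtered complex to its cohomology: in each degree
`m` the filtration of the cohomology is finite, starting with everything and reaching zero, and
for all large `r` the entry `E_r^{s,m-s}` is the quotient `F^s H^m / F^{s+1} H^m`, the class of a
cocycle in `F^s` corresponding to the class of its cohomology class. -/
def ConvergesToCohomology : Prop :=
  ∀ m : ℕ, cohomologyFiltration d F 0 m = ⊤ ∧
    Antitone (fun s => cohomologyFiltration d F s m) ∧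
    cohomologyFiltration d F (m + 1) m = ⊥ ∧
    ∃ r₀ : ℕ, ∀ r ≥ r₀, ∀ s ≤ m,
      ∃ e : Page d F r s m ≃ₗ[ℝ]
          (cohomologyFiltration d F s m ⧸
            (cohomologyFiltration d F (s + 1) m).submoduleOf (cohomologyFiltration d F s m)),
        ∀ (x : C m) (_ : x ∈ F s m) (hd : x ∈ Cocycles d m) (hr : x ∈ pageCycles d F r s m)
          (hc : Cohomology.mk d m ⟨x, hd⟩ ∈ cohomologyFiltration d F s m),
          e (Page.mk d F r s m ⟨x, hr⟩) = Submodule.Quotient.mk ⟨Cohomology.mk d m ⟨x, hd⟩, hc⟩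

end Filtered

/-! ### Linear topologies and the completed tensor product -/

section Completed

/-- The completed tensor product of two real vector spaces with linear topologies, given by their
sets `𝒰` and `𝒲` of open subspaces: the limit of the spaces `E/U ⊗ F/W` over all open subspaces
`U` of `E` and `W` of `F`, realised as the space of compatible families. -/
def CompletedTensor {E F : Type u} [AddCommGroup E] [Module ℝ E] [AddCommGroup F] [Module ℝ F]
    (𝒰 : Set (Submodule ℝ E)) (𝒲 : Set (Submodule ℝ F)) :
    Submodule ℝ (∀ (U : 𝒰) (W : 𝒲), TensorProduct ℝ (E ⧸ U.1) (F ⧸ W.1)) where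
  carrier := {t | ∀ (U U' : 𝒰) (W W' : 𝒲) (hU : U.1 ≤ U'.1) (hW : W.1 ≤ W'.1),
    TensorProduct.map (Submodule.factor hU) (Submodule.factor hW) (t U W) = t U' W'}
  add_mem' ha hb U U' W W' hU hW := by simp [ha U U' W W' hU hW, hb U U' W W' hU hW]
  zero_mem' U U' W W' hU hW := by simp
  smul_mem' c t ht U U' W W' hU hW := by simp [ht U U' W W' hU hW]

/-- The image in the completed tensor product of the pure tensor `x ⊗ y`. -/
def CompletedTensor.tmul {E F : Type u} [AddCommGroup E] [Module ℝ E] [AddCommGroup F]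
    [Module ℝ F] (𝒰 : Set (Submodule ℝ E)) (𝒲 : Set (Submodule ℝ F)) (x : E) (y : F) :
    CompletedTensor 𝒰 𝒲 :=
  ⟨fun U W => TensorProduct.tmul ℝ (U.1.mkQ x) (W.1.mkQ y), fun U U' W W' hU hW => by
    simp⟩

/-- Linear compactness: a family of closed affine subspaces with the finite intersection property
has a common point. -/
def IsLinearlyCompact (M : Type u) [AddCommGroup M] [Module ℝ M] [TopologicalSpace M] : Prop :=
  ∀ 𝒜 : Set (Set M),
    (∀ A ∈ 𝒜, ∃ (N : Submodule ℝ M) (x : M), IsClosed (N : Set M) ∧ A = {y | y - x ∈ N}) →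
    (∀ t : Finset (Set M), (t : Set (Set M)) ⊆ 𝒜 → (⋂₀ (t : Set (Set M))).Nonempty) →
    (⋂₀ 𝒜).Nonempty

/-- Pro-finite-dimensional topological vector spaces: every neighbourhood of zero contains a
closed subspace of finite codimension, and the space is linearly compact (which expresses
completeness).  Finite-dimensional spaces with their usual topology, and `ℝ⟦x⟧` with its
`x`-adic topology or with the topology of coefficientwise convergence, are examples. -/
def IsProFiniteDimensional (M : Type u) [AddCommGroup M] [Module ℝ M] [TopologicalSpace M] :
    Prop :=
  (∀ V ∈ nhds (0 : M), ∃ N : Submodule ℝ M,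
    IsClosed (N : Set M) ∧ FiniteDimensional ℝ (M ⧸ N) ∧ (N : Set M) ⊆ V) ∧
  IsLinearlyCompact M

end Completed

/-! ### Leibniz cochains -/

section Merge

variable {g : Type u} [LieRing g]

/-- For `i < j`, the arguments `v₀, …, [vᵢ, vⱼ], …, v̂ⱼ, …, v_k` (with `[vᵢ, vⱼ]` in position `i`
and `vⱼ` left out). -/
def merge {k : ℕ} (v : Fin (k + 1) → g) (i : Fin k) (j : Fin (k + 1)) : Fin k → g :=
  Function.update (j.removeNth v) i ⁅v i.castSucc, v j⁆

theorem merge_update_right {k : ℕ} (v : Fin (k + 1) → g) (i : Fin k) (j : Fin (k + 1)) (x : g)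
    (h : i.castSucc < j) :
    merge (Function.update v j x) i j = Function.update (merge v i j) i ⁅v i.castSucc, x⁆ := by
  ext p
  simp only [merge, Function.update_idem, Fin.removeNth_update, Function.update_self]
  rw [Function.update_of_ne h.ne]

theorem merge_update_left {k : ℕ} (v : Fin (k + 1) → g) (i : Fin k) (j : Fin (k + 1)) (x : g)
    (h : i.castSucc < j) :
    merge (Function.update v i.castSucc x) i j = Function.update (merge v i j) i ⁅x, v j⁆ := by
  ext p
  have h2 : j.succAbove i = i.castSucc := Fin.succAbove_of_castSucc_lt _ _ h
  have : j.removeNth (Function.update v i.castSucc x) = Function.update (j.removeNth v) i x := by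
    rw [← h2, Fin.removeNth_update_succAbove]
  simp only [merge, this, Function.update_idem, Function.update_self]
  rw [Function.update_of_ne h.ne']

theorem merge_update_other {k : ℕ} (v : Fin (k + 1) → g) (i p : Fin k) (j : Fin (k + 1)) (x : g)
    (h : i.castSucc < j) (hp : p ≠ i) :
    merge (Function.update v (j.succAbove p) x) i j = Function.update (merge v i j) p x := by
  have h2 : j.succAbove i = i.castSucc := Fin.succAbove_of_castSucc_lt _ _ h
  have h3 : i.castSucc ≠ j.succAbove p := by
    rw [← h2]; exact fun h => hp (Fin.succAbove_right_injective h).symm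
  have h4 : j ≠ j.succAbove p := (Fin.succAbove_ne j p).symm
  rw [merge, merge, Fin.removeNth_update_succAbove, Function.update_of_ne h3,
    Function.update_of_ne h4, Function.update_comm hp]

theorem merge_cons_zero {m : ℕ} (h : g) (v : Fin (m + 1) → g) (j : Fin (m + 1)) :
    merge (Fin.cons h v : Fin (m + 2) → g) 0 j.succ =
      (Fin.cons ⁅h, v j⁆ (j.removeNth v) : Fin (m + 1) → g) := by
  ext p
  refine Fin.cases ?_ (fun q => ?_) p
  · simp [merge]
  · simp [merge, Fin.removeNth]

theorem merge_cons_succ {m : ℕ} (h : g) (v : Fin (m + 1) → g) (i : Fin m) (j : Fin (m + 1)) :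
    merge (Fin.cons h v : Fin (m + 2) → g) i.succ j.succ =
      (Fin.cons h (merge v i j) : Fin (m + 1) → g) := by
  ext p
  refine Fin.cases ?_ (fun q => ?_) p
  · rw [merge, Function.update_of_ne (Fin.succ_ne_zero i).symm]
    simp [Fin.removeNth]
  · by_cases hq : q = i
    · subst hq; simp [merge]
    · simp [merge, Fin.removeNth, hq]

theorem continuous_merge [LieAlgebra ℝ g] [TopologicalSpace g] [IsTopologicalLieAlgebra g] {k : ℕ}
    (i : Fin k) (j : Fin (k + 1)) : Continuous fun v : Fin (k + 1) → g => merge v i j := by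
  have h1 : Continuous fun v : Fin (k + 1) → g => j.removeNth v :=
    continuous_pi fun p => continuous_apply (j.succAbove p)
  refine h1.update i ?_
  exact IsTopologicalLieAlgebra.continuous_bracket.comp
    ((continuous_apply i.castSucc).prodMk (continuous_apply j))

end Merge

section Cochains

variable (g : Type u) [LieRing g] [LieAlgebra ℝ g] [TopologicalSpace g]

/-- `C^k(g)`: continuous multilinear forms in `k` variables. -/
abbrev Cochain (k : ℕ) : Type u := ContinuousMultilinearMap ℝ (fun _ : Fin k => g) ℝ

variable {g}

/-- The term `v ↦ f(v₀, …, [vᵢ, vⱼ], …, v̂ⱼ, …, v_k)` of the coboundary. -/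
def mergeTerm [IsTopologicalLieAlgebra g] {k : ℕ} (f : Cochain g k) (i : Fin k) (j : Fin (k + 1))
    (h : i.castSucc < j) : Cochain g (k + 1) where
  toFun v := f (merge v i j)
  map_update_add' := by
    intro hd v l x y
    obtain rfl : hd = instDecidableEqFin _ := Subsingleton.elim _ _
    rcases Fin.eq_self_or_eq_succAbove j l with rfl | ⟨p, rfl⟩
    · simp only [merge_update_right _ _ _ _ h, lie_add, f.map_update_add]
    · by_cases hp : p = i
      · subst hp
        rw [Fin.succAbove_of_castSucc_lt _ _ h]
        simp only [merge_update_left _ _ _ _ h, add_lie, f.map_update_add]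
      · simp only [merge_update_other _ _ _ _ _ h hp, f.map_update_add]
  map_update_smul' := by
    intro hd v l c x
    obtain rfl : hd = instDecidableEqFin _ := Subsingleton.elim _ _
    rcases Fin.eq_self_or_eq_succAbove j l with rfl | ⟨p, rfl⟩
    · simp only [merge_update_right _ _ _ _ h, lie_smul, f.map_update_smul]
    · by_cases hp : p = i
      · subst hp
        rw [Fin.succAbove_of_castSucc_lt _ _ h]
        simp only [merge_update_left _ _ _ _ h, smul_lie, f.map_update_smul]
      · simp only [merge_update_other _ _ _ _ _ h hp, f.map_update_smul]
  cont := f.cont.comp (continuous_merge i j)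

/-- The Leibniz coboundary `C^k(g) → C^{k+1}(g)`,
`(d f)(g₁, …, g_{k+1}) = ∑_{1 ≤ i < j ≤ k+1} (-1)^{j+1} f(g₁, …, [gᵢ, gⱼ], …, ĝⱼ, …, g_{k+1})`.
The indices in the code start at `0`, so that the sign is `(-1)^j`. -/
def leibnizD [IsTopologicalLieAlgebra g] (k : ℕ) : Cochain g k →ₗ[ℝ] Cochain g (k + 1) where
  toFun f := ∑ j : Fin (k + 1), ∑ i : Fin k,
    if h : i.castSucc < j then (-1 : ℝ) ^ (j : ℕ) • mergeTerm f i j h else 0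
  map_add' f f' := by
    simp only [← Finset.sum_add_distrib]
    refine Finset.sum_congr rfl fun j _ => Finset.sum_congr rfl fun i _ => ?_
    split_ifs
    · rw [← smul_add]; rfl
    · simp
  map_smul' c f := by
    simp only [Finset.smul_sum, RingHom.id_apply]
    refine Finset.sum_congr rfl fun j _ => Finset.sum_congr rfl fun i _ => ?_
    split_ifs
    · rw [smul_comm]; rfl
    · simp

theorem leibnizD_apply [IsTopologicalLieAlgebra g] {k : ℕ} (f : Cochain g k)
    (v : Fin (k + 1) → g) :
    leibnizD k f v = ∑ j : Fin (k + 1), ∑ i : Fin k,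
      if i.castSucc < j then (-1 : ℝ) ^ (j : ℕ) * f (merge v i j) else 0 := by
  simp only [leibnizD, LinearMap.coe_mk, AddHom.coe_mk, sum_apply]
  refine Finset.sum_congr rfl fun j _ => Finset.sum_congr rfl fun i _ => ?_
  split_ifs
  · rfl
  · rfl

/-- The multilinear forms that are alternating (skew-symmetric) in their last `m` arguments;
in all their arguments if there are fewer than `m`. -/
def skewLast (g : Type u) [LieRing g] [LieAlgebra ℝ g] [TopologicalSpace g] (m k : ℕ) :
    Submodule ℝ (Cochain g k) where
  carrier := {f | ∀ (v : Fin k → g) (a b : Fin k), a ≠ b → k ≤ a + m → k ≤ b + m →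
    v a = v b → f v = 0}
  add_mem' hf hf' v a b hab ha hb h := by
    simp [hf v a b hab ha hb h, hf' v a b hab ha hb h]
  zero_mem' := by simp
  smul_mem' c f hf v a b hab ha hb h := by simp [hf v a b hab ha hb h]

theorem polarize {k : ℕ} (f : Cochain g k) (a b : Fin k) (hab : a ≠ b)
    (hf : ∀ v : Fin k → g, v a = v b → f v = 0) (v : Fin k → g) (x y : g) :
    f (Function.update (Function.update v a x) b y) +
      f (Function.update (Function.update v a y) b x) = 0 := by
  have h1 : ∀ z : g, f (Function.update (Function.update v a z) b z) = 0 := fun z =>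
    hf _ (by simp [Function.update_of_ne hab])
  have h := h1 (x + y)
  have h2 : ∀ z : g, f (Function.update (Function.update v a (x + y)) b z) =
      f (Function.update (Function.update v a x) b z) +
        f (Function.update (Function.update v a y) b z) := by
    intro z
    rw [Function.update_comm hab, f.map_update_add, Function.update_comm hab.symm,
      Function.update_comm hab.symm]
  rw [f.map_update_add, h2, h2, h1, h1] at h
  linarith

theorem skew_of_adjacent {k : ℕ} (f : Cochain g k) (m : ℕ)
    (hf : ∀ (v : Fin k → g) (a b : Fin k), (b : ℕ) = a + 1 → k ≤ a + m → v a = v b → f v = 0) :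
    f ∈ skewLast g m k := by
  have key : ∀ (n : ℕ) (v : Fin k → g) (a b : Fin k), (b : ℕ) = a + n + 1 → k ≤ a + m →
      v a = v b → f v = 0 := by
    intro n
    induction n with
    | zero => intro v a b hb; exact hf v a b hb
    | succ n ih =>
      intro v a b hb ha hv
      let c : Fin k := ⟨a + n + 1, by omega⟩
      have hcb : c ≠ b := by intro h; have := congrArg Fin.val h; simp [c] at this; omega
      have hac : a ≠ c := by intro h; have := congrArg Fin.val h; simp [c] at this; omega
      have hab : a ≠ b := by intro h; have := congrArg Fin.val h; omega
      have h1 := polarize f c b hcb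
        (fun w hw => hf w c b (by simp [c]; omega) (by simp [c]; omega) hw) v (v c) (v b)
      have h2 : f (Function.update (Function.update v c (v b)) b (v c)) = 0 := by
        refine ih _ a c rfl ha ?_
        rw [Function.update_of_ne hab, Function.update_of_ne hac, Function.update_of_ne hcb,
          Function.update_self, hv]
      simpa [h2] using h1
  intro v a b hab ha hb h
  rcases lt_or_gt_of_ne hab with h' | h'
  · exact key (b - a - 1) v a b (by have := Fin.lt_def.1 h'; omega) ha h
  · exact key (a - b - 1) v b a (by have := Fin.lt_def.1 h'; omega) hb h.symm

theorem leibnizD_adjacent [IsTopologicalLieAlgebra g] (m k : ℕ) (f : Cochain g k)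
    (hf : f ∈ skewLast g m k) (v : Fin (k + 1) → g) (a b : Fin (k + 1)) (hab : (b : ℕ) = a + 1)
    (ha : k + 1 ≤ a + m ∨ ((a : ℕ) ≤ 1 ∧ k ≤ a + m)) (hv : v a = v b) : leibnizD k f v = 0 := by
  have ha' : k ≤ a + m := by omega
  rw [leibnizD_apply]
  have hne : a ≠ b := by intro h; have := congrArg Fin.val h; omega
  rw [Finset.sum_eq_add a b hne]
  · -- the terms in which one of the two equal arguments is removed
    rw [← Finset.sum_add_distrib]
    refine Finset.sum_eq_zero fun i _ => ?_
    have hrem : a.removeNth v = b.removeNth v := by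
      ext p
      simp only [Fin.removeNth]
      by_cases h1 : (p : ℕ) < a
      · rw [Fin.succAbove_of_castSucc_lt _ _ (by simpa [Fin.lt_def] using h1),
          Fin.succAbove_of_castSucc_lt _ _ (by simp [Fin.lt_def]; omega)]
      · by_cases h2 : (p : ℕ) = a
        · rw [Fin.succAbove_of_le_castSucc _ _ (by simp [Fin.le_def]; omega),
            Fin.succAbove_of_castSucc_lt _ _ (by simp [Fin.lt_def]; omega)]
          have e1 : p.succ = b := by ext; simp; omega
          have e2 : p.castSucc = a := by ext; simp; omega
          rw [e1, e2, hv]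
        · rw [Fin.succAbove_of_le_castSucc _ _ (by simp [Fin.le_def]; omega),
            Fin.succAbove_of_le_castSucc _ _ (by simp [Fin.le_def]; omega)]
    by_cases h1 : i.castSucc < a
    · have h2 : i.castSucc < b := by simp [Fin.lt_def] at h1 ⊢; omega
      rw [if_pos h1, if_pos h2, merge, merge, hrem, hv, hab, pow_succ]
      ring
    · rw [if_neg h1]
      by_cases h2 : i.castSucc < b
      · have e2 : i.castSucc = a := by ext; simp [Fin.lt_def] at h1 h2 ⊢; omega
        rw [if_pos h2, merge, e2, hv, lie_self, f.map_coord_zero i (by simp)]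
        simp
      · rw [if_neg h2]; simp
  · rintro j - ⟨hja, hjb⟩
    rcases lt_or_ge j a with hj | hj
    · have hj' := Fin.lt_def.1 hj
      refine Finset.sum_eq_zero fun i _ => ?_
      split_ifs with hi
      · have hi' := Fin.lt_def.1 hi
        simp only [Fin.val_castSucc] at hi'
        have ha1 : k + 1 ≤ a + m := by omega
        let p : Fin k := ⟨(a : ℕ) - 1, by omega⟩
        let q : Fin k := ⟨a, by omega⟩
        rw [hf _ p q (by simp [p, q, Fin.ext_iff]; omega) (by simp only [p]; omega)
          (by simp only [q]; omega), mul_zero]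
        have hpi : p ≠ i := by simp [p, Fin.ext_iff]; omega
        have hqi : q ≠ i := by simp [q, Fin.ext_iff]; omega
        rw [merge, Function.update_of_ne hpi, Function.update_of_ne hqi]
        simp only [Fin.removeNth]
        rw [Fin.succAbove_of_le_castSucc _ _ (by rw [Fin.le_def]; simp only [p, Fin.val_castSucc]; omega),
          Fin.succAbove_of_le_castSucc _ _
            (by rw [Fin.le_def]; simp only [q, Fin.val_castSucc]; omega)]
        have e1 : p.succ = a := by ext; simp [p]; omega
        have e2 : q.succ = b := by ext; simp [q]; omega
        rw [e1, e2, hv]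
      · rfl
    · have hj' := Fin.le_def.1 hj
      have hja' : (j : ℕ) ≠ a := fun h => hja (Fin.ext h)
      have hjb' : (j : ℕ) ≠ b := fun h => hjb (Fin.ext h)
      have hjk := j.2
      let p : Fin k := ⟨a, by omega⟩
      let q : Fin k := ⟨b, by omega⟩
      have hpj : p.castSucc < j := by rw [Fin.lt_def]; simp only [p, Fin.val_castSucc]; omega
      have hqj : q.castSucc < j := by rw [Fin.lt_def]; simp only [q, Fin.val_castSucc]; omega
      have hpq : p ≠ q := by simp [p, q, Fin.ext_iff]; omega
      have ep : p.castSucc = a := rfl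
      have eq : q.castSucc = b := rfl
      have hp : k ≤ (p : ℕ) + m := by simp [p]; omega
      have hq : k ≤ (q : ℕ) + m := by simp [q]; omega
      have rp : j.removeNth v p = v a := by
        simp only [Fin.removeNth]; rw [Fin.succAbove_of_castSucc_lt _ _ hpj, ep]
      have rq : j.removeNth v q = v a := by
        simp only [Fin.removeNth]; rw [Fin.succAbove_of_castSucc_lt _ _ hqj, eq, hv]
      rw [Finset.sum_eq_add p q hpq]
      · rw [if_pos hpj, if_pos hqj, ← mul_add, merge, merge, ep, eq, ← hv]
        have h := polarize f p q hpq (fun w hw => hf w p q hpq hp hq hw) (j.removeNth v)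
          ⁅v a, v j⁆ (v a)
        have u1 : Function.update (Function.update (j.removeNth v) p ⁅v a, v j⁆) q (v a) =
            Function.update (j.removeNth v) p ⁅v a, v j⁆ := by
          rw [Function.update_comm hpq]
          nth_rewrite 1 [← rq]
          rw [Function.update_eq_self]
        have u2 : Function.update (Function.update (j.removeNth v) p (v a)) q ⁅v a, v j⁆ =
            Function.update (j.removeNth v) q ⁅v a, v j⁆ := by
          nth_rewrite 1 [← rp]
          rw [Function.update_eq_self]
        rw [u1, u2] at h
        rw [h, mul_zero]
      · rintro i - ⟨hip, hiq⟩
        split_ifs with hi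
        · rw [hf _ p q hpq hp hq, mul_zero]
          rw [merge, Function.update_of_ne hip.symm, Function.update_of_ne hiq.symm, rp, rq]
        · rfl
      · simp
      · simp
  · simp
  · simp

theorem leibnizD_skewLast [IsTopologicalLieAlgebra g] (m k : ℕ) (f : Cochain g k)
    (hf : f ∈ skewLast g m k) : leibnizD k f ∈ skewLast g m (k + 1) :=
  skew_of_adjacent _ m fun v a b hab ha hv => leibnizD_adjacent m k f hf v a b hab (Or.inl ha) hv

end Cochains

/-! ### Lie algebra cochains -/

section LieCochains

variable (g : Type u) [LieRing g] [LieAlgebra ℝ g] [TopologicalSpace g]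

/-- `Ω^q(g)`: continuous alternating forms in `q` variables. -/
abbrev AltCochain (q : ℕ) : Type u := g [⋀^Fin q]→L[ℝ] ℝ

/-- `Ω^m(g; g')`: alternating maps `β` in `m` variables with values in the continuous dual `g'`,
continuous in the sense that `(h, g₁, …, g_m) ↦ β(g₁, …, g_m)(h)` is continuous. -/
def CoadCochain (m : ℕ) : Submodule ℝ (g [⋀^Fin m]→ₗ[ℝ] (g →L[ℝ] ℝ)) where
  carrier := {β | Continuous fun v : Fin (m + 1) → g => β (Fin.tail v) (v 0)}
  add_mem' ha hb := Continuous.add ha hb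
  zero_mem' := continuous_const
  smul_mem' c _ hβ := Continuous.const_smul hβ c

/-- `Ω^m(g; g')` is an additive group; its addition is the inherited one. -/
instance (m : ℕ) : AddCommGroup (CoadCochain g m) := Module.addCommMonoidToAddCommGroup ℝ

variable {g}

/-- The map `i : Ω^m(g; g') → C^{m+1}(g)`,
`(i β)(g₀, g₁, …, g_m) = (-1)^m β(g₁, …, g_m)(g₀)`. -/
def incl (m : ℕ) : CoadCochain g m →ₗ[ℝ] Cochain g (m + 1) where
  toFun β :=
    { toFun := fun v => (-1 : ℝ) ^ m * β.1 (Fin.tail v) (v 0)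
      map_update_add' := by
        intro hd v l x y
        obtain rfl : hd = instDecidableEqFin _ := Subsingleton.elim _ _
        refine Fin.cases ?_ (fun p => ?_) l
        · simp [mul_add]
        · simp [mul_add, Function.update_of_ne (Fin.succ_ne_zero p).symm]
      map_update_smul' := by
        intro hd v l c x
        obtain rfl : hd = instDecidableEqFin _ := Subsingleton.elim _ _
        refine Fin.cases ?_ (fun p => ?_) l
        · simp [mul_left_comm]
        · simp [mul_left_comm, Function.update_of_ne (Fin.succ_ne_zero p).symm]
      cont := continuous_const.mul β.2 }
  map_add' β β' := by
    ext v
    exact mul_add _ (β.1 (Fin.tail v) (v 0)) (β'.1 (Fin.tail v) (v 0))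
  map_smul' c β := by
    ext v
    exact mul_left_comm _ c (β.1 (Fin.tail v) (v 0))

theorem incl_apply (m : ℕ) (β : CoadCochain g m) (v : Fin (m + 1) → g) :
    incl m β v = (-1 : ℝ) ^ m * β.1 (Fin.tail v) (v 0) := rfl

theorem incl_cons (m : ℕ) (β : CoadCochain g m) (v : Fin m → g) (h : g) :
    incl m β (Fin.cons h v) = (-1 : ℝ) ^ m * β.1 v h := by
  simp [incl_apply]

theorem eq_incl_cons (m : ℕ) (β : CoadCochain g m) (v : Fin m → g) (h : g) :
    β.1 v h = (-1 : ℝ) ^ m * incl m β (Fin.cons h v) := by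
  rw [incl_cons, ← mul_assoc, ← mul_pow]; simp

theorem incl_injective (m : ℕ) : Function.Injective (incl (g := g) m) := by
  intro β β' h
  ext v x
  rw [eq_incl_cons, eq_incl_cons, h]

theorem incl_mem_skewLast (m : ℕ) (β : CoadCochain g m) : incl m β ∈ skewLast g m (m + 1) := by
  intro v a b hab ha hb hv
  obtain ⟨a, rfl⟩ := Fin.exists_succ_eq.2 (show a ≠ 0 by rintro rfl; simp at ha)
  obtain ⟨b, rfl⟩ := Fin.exists_succ_eq.2 (show b ≠ 0 by rintro rfl; simp at hb)
  rw [incl_apply, β.1.map_eq_zero_of_eq (i := a) (j := b) (Fin.tail v) hv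
    (fun h => hab (by rw [h]))]
  simp

theorem continuous_cons {g : Type u} [TopologicalSpace g] {m : ℕ} (v : Fin m → g) :
    Continuous fun h : g => (Fin.cons h v : Fin (m + 1) → g) := by
  refine continuous_pi fun p => ?_
  refine Fin.cases ?_ (fun q => ?_) p
  · exact continuous_id
  · exact continuous_const

/-- The cochain `β` with `i β = f`, for `f` alternating in all arguments but the first. -/
def ofSkew (m : ℕ) (f : Cochain g (m + 1)) (hf : f ∈ skewLast g m (m + 1)) : CoadCochain g m :=
  ⟨{ toFun := fun v =>
      { toFun := fun h => (-1 : ℝ) ^ m * f (Fin.cons h v)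
        map_add' := fun x y => by rw [← mul_add, f.cons_add]
        map_smul' := fun c x => by
          rw [f.cons_smul]; simp [mul_left_comm]
        cont := continuous_const.mul (f.cont.comp (continuous_cons v)) }
     map_update_add' := by
        intro hd v l x y
        obtain rfl : hd = instDecidableEqFin _ := Subsingleton.elim _ _
        ext h
        simp [Fin.cons_update, mul_add]
     map_update_smul' := by
        intro hd v l c x
        obtain rfl : hd = instDecidableEqFin _ := Subsingleton.elim _ _
        ext h
        simp [Fin.cons_update, mul_left_comm]
     map_eq_zero_of_eq' := by
        intro v a b hv hab
        ext h
        have := hf (Fin.cons h v) a.succ b.succ (by simpa using hab)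
          (by rw [Fin.val_succ]; omega) (by rw [Fin.val_succ]; omega) (by simpa using hv)
        simp [this] },
    by
      have : (fun v : Fin (m + 1) → g => (-1 : ℝ) ^ m * f (Fin.cons (v 0) (Fin.tail v))) =
          fun v => (-1 : ℝ) ^ m * f v := by
        ext v; rw [Fin.cons_self_tail]
      show Continuous (fun v : Fin (m + 1) → g => (-1 : ℝ) ^ m * f (Fin.cons (v 0) (Fin.tail v)))
      rw [this]
      exact continuous_const.mul f.cont⟩

theorem ofSkew_apply (m : ℕ) (f : Cochain g (m + 1)) (hf : f ∈ skewLast g m (m + 1))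
    (v : Fin m → g) (h : g) : (ofSkew m f hf).1 v h = (-1 : ℝ) ^ m * f (Fin.cons h v) := rfl

theorem incl_ofSkew (m : ℕ) (f : Cochain g (m + 1)) (hf : f ∈ skewLast g m (m + 1)) :
    incl m (ofSkew m f hf) = f := by
  ext v
  rw [incl_apply, ofSkew_apply, ← mul_assoc, ← mul_pow, Fin.cons_self_tail]; simp

theorem alt_mem_skewLast (m n : ℕ) (α : AltCochain g n) :
    α.toContinuousMultilinearMap ∈ skewLast g m n :=
  fun v _ _ hab _ _ hv => α.map_eq_zero_of_eq v hv hab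

/-- `Var : Ω^{m+1}(g) → Ω^m(g; g')`,
`(Var α)(g₁, …, g_m)(g₀) = (-1)^m α(g₀, g₁, …, g_m)`. -/
def var (m : ℕ) : AltCochain g (m + 1) →ₗ[ℝ] CoadCochain g m where
  toFun α := ofSkew m α.toContinuousMultilinearMap (alt_mem_skewLast _ _ α)
  map_add' α α' := by
    apply incl_injective; rw [map_add]; simp only [incl_ofSkew]; rfl
  map_smul' c α := by
    apply incl_injective; rw [map_smul]; simp only [incl_ofSkew]; rfl

theorem var_apply (m : ℕ) (α : AltCochain g (m + 1)) (v : Fin m → g) (h : g) :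
    (var m α).1 v h = (-1 : ℝ) ^ m * α (Fin.cons h v) := rfl

variable [IsTopologicalLieAlgebra g]

/-- The coadjoint action on the continuous dual: `(x γ)(h) = γ([h, x])`. -/
def coad (x : g) (γ : g →L[ℝ] ℝ) : g →L[ℝ] ℝ where
  toFun h := γ ⁅h, x⁆
  map_add' := by simp
  map_smul' := by simp
  cont := γ.cont.comp
    (IsTopologicalLieAlgebra.continuous_bracket.comp (continuous_id.prodMk continuous_const))

/-- The value of the Chevalley–Eilenberg coboundary with coefficients in the coadjoint
representation,
`(d β)(g₁, …, g_{m+1}) = ∑_j (-1)^{j+1} gⱼ · β(g₁, …, ĝⱼ, …, g_{m+1})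
  + ∑_{i < j} (-1)^{j+1} β(g₁, …, [gᵢ, gⱼ], …, ĝⱼ, …, g_{m+1})`;
the indices in the code start at `0`, so that the sign is `(-1)^j`. -/
def ceValue {m : ℕ} (β : CoadCochain g m) (v : Fin (m + 1) → g) : g →L[ℝ] ℝ :=
  ∑ j : Fin (m + 1), (-1 : ℝ) ^ (j : ℕ) • coad (v j) (β.1 (j.removeNth v)) +
    ∑ j : Fin (m + 1), ∑ i : Fin m,
      if i.castSucc < j then (-1 : ℝ) ^ (j : ℕ) • β.1 (merge v i j) else 0

theorem leibnizD_incl {m : ℕ} (β : CoadCochain g m) (v : Fin (m + 1) → g) (h : g) :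
    leibnizD (m + 1) (incl m β) (Fin.cons h v) = (-1 : ℝ) ^ (m + 1) * ceValue β v h := by
  rw [leibnizD_apply, Fin.sum_univ_succ]
  have h0 : ∀ i : Fin (m + 1), ¬ (i.castSucc < (0 : Fin (m + 2))) := fun i => Fin.not_lt_zero _
  simp only [h0, if_false, Finset.sum_const_zero, zero_add]
  simp only [Fin.sum_univ_succ (n := m) (f := fun i : Fin (m + 1) => ite _ _ _)]
  simp only [merge_cons_zero, merge_cons_succ, incl_cons, ceValue, add_apply, sum_apply,
    Finset.sum_add_distrib, mul_add, Finset.mul_sum]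
  congr 1
  · refine Finset.sum_congr rfl fun j _ => ?_
    simp [coad, pow_succ]
    ring
  · refine Finset.sum_congr rfl fun j _ => Finset.sum_congr rfl fun i _ => ?_
    by_cases hij : i.castSucc < j
    · simp [hij, pow_succ]; ring
    · simp [hij]

theorem leibnizD_incl_mem {m : ℕ} (β : CoadCochain g m) :
    leibnizD (m + 1) (incl m β) ∈ skewLast g (m + 1) (m + 1 + 1) :=
  skew_of_adjacent _ _ fun v a b hab ha hv =>
    leibnizD_adjacent m (m + 1) _ (incl_mem_skewLast m β) v a b hab (by omega) hv

theorem ceValue_eq {m : ℕ} (β : CoadCochain g m) (v : Fin (m + 1) → g) :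
    ceValue β v = (ofSkew (m + 1) _ (leibnizD_incl_mem β)).1 v := by
  ext h
  rw [ofSkew_apply, leibnizD_incl, ← mul_assoc, ← mul_pow]
  simp

/-- The Chevalley–Eilenberg coboundary `Ω^m(g; g') → Ω^{m+1}(g; g')`. -/
def coadD (m : ℕ) : CoadCochain g m →ₗ[ℝ] CoadCochain g (m + 1) where
  toFun β :=
    ⟨{ toFun := fun v => ceValue β v
       map_update_add' := fun v l x y => by
         simp only [ceValue_eq]; exact MultilinearMap.map_update_add' _ v l x y
       map_update_smul' := fun v l c x => by
         simp only [ceValue_eq]; exact MultilinearMap.map_update_smul' _ v l c x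
       map_eq_zero_of_eq' := fun v a b hv hab => by
         rw [ceValue_eq]
         exact (ofSkew (m + 1) _ (leibnizD_incl_mem β)).1.map_eq_zero_of_eq v hv hab },
      by
        have h := (ofSkew (m + 1) _ (leibnizD_incl_mem β)).2
        have e : (fun v : Fin (m + 1 + 1) → g => ceValue β (Fin.tail v) (v 0)) =
            fun v => (ofSkew (m + 1) _ (leibnizD_incl_mem β)).1 (Fin.tail v) (v 0) := by
          ext v; rw [ceValue_eq]
        show Continuous fun v : Fin (m + 1 + 1) → g => ceValue β (Fin.tail v) (v 0)
        rw [e]; exact h⟩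
  map_add' β β' := by
    ext v h
    show ceValue (β + β') v h = ceValue β v h + ceValue β' v h
    simp only [ceValue_eq, ofSkew_apply, map_add, add_apply]
    ring
  map_smul' c β := by
    ext v h
    show ceValue (c • β) v h = c * ceValue β v h
    simp only [ceValue_eq, ofSkew_apply, map_smul, smul_apply, smul_eq_mul]
    ring

/-- `i` is compatible with the coboundaries. -/
theorem leibnizD_comp_incl {m : ℕ} (β : CoadCochain g m) :
    leibnizD (m + 1) (incl m β) = incl (m + 1) (coadD m β) := by
  have : coadD m β = ofSkew (m + 1) _ (leibnizD_incl_mem β) := by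
    ext v h
    show ceValue β v h = _
    rw [ceValue_eq]
  rw [this, incl_ofSkew]

/-- The Lie algebra coboundary `Ω^q(g) → Ω^{q+1}(g)`: the restriction of the Leibniz coboundary
to alternating forms. -/
def altD (q : ℕ) (α : AltCochain g q) : AltCochain g (q + 1) :=
  { leibnizD q α.toContinuousMultilinearMap with
    map_eq_zero_of_eq' := fun v a b hv hab =>
      leibnizD_skewLast (q + 1) q _ (alt_mem_skewLast (q + 1) q α) v a b hab
        (by omega) (by omega) hv }

/-- `Var` is compatible with the coboundaries. -/
theorem coadD_comp_var {m : ℕ} (α : AltCochain g (m + 1)) :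
    coadD m (var m α) = var (m + 1) (altD (m + 1) α) := by
  apply incl_injective
  rw [← leibnizD_comp_incl]
  simp only [var, LinearMap.coe_mk, AddHom.coe_mk, incl_ofSkew]
  rfl

end LieCochains

/-! ### The quotient complexes and their cohomology -/

section Quotients

variable (g : Type u) [LieRing g] [LieAlgebra ℝ g] [TopologicalSpace g] [IsTopologicalLieAlgebra g]

/-- Leibniz cohomology `HL^n(g)` with trivial coefficients. -/
abbrev HL (n : ℕ) : Type u := Cohomology (leibnizD (g := g)) n

/-- `C_RG^n(g) = C^{n+2}(g) / i[Ω^{n+1}(g; g')]`. -/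
def CRG (n : ℕ) : Type u := Cochain g (n + 2) ⧸ LinearMap.range (incl (g := g) (n + 1))

instance (n : ℕ) : AddCommGroup (CRG g n) :=
  inferInstanceAs (AddCommGroup (Cochain g (n + 2) ⧸ LinearMap.range (incl (g := g) (n + 1))))

instance (n : ℕ) : Module ℝ (CRG g n) :=
  inferInstanceAs (Module ℝ (Cochain g (n + 2) ⧸ LinearMap.range (incl (g := g) (n + 1))))

/-- The class of a cochain in `C_RG^n(g)`. -/
def CRG.mk (n : ℕ) : Cochain g (n + 2) →ₗ[ℝ] CRG g n :=
  (LinearMap.range (incl (g := g) (n + 1))).mkQ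

/-- The coboundary of `C_RG^*(g)`, induced by the Leibniz coboundary. -/
def rgD (n : ℕ) : CRG g n →ₗ[ℝ] CRG g (n + 1) :=
  Submodule.mapQ _ _ (leibnizD (n + 2)) (by
    rintro _ ⟨β, rfl⟩
    exact ⟨coadD (n + 1) β, (leibnizD_comp_incl β).symm⟩)

/-- The filtration of `C_RG^*(g)`: `F^s` in degree `n` consists of the classes of the forms on
`n + 2` arguments that are alternating in the last `s + 1` arguments. -/
def rgFiltration (s n : ℕ) : Submodule ℝ (CRG g n) :=
  (skewLast g (s + 1) (n + 2)).map (CRG.mk g n)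

/-- `CR^n(g) = Ω^{n+1}(g; g') / Var[Ω^{n+2}(g)]`. -/
def CR (n : ℕ) : Type u := CoadCochain g (n + 1) ⧸ LinearMap.range (var (g := g) (n + 1))

instance (n : ℕ) : AddCommGroup (CR g n) :=
  inferInstanceAs (AddCommGroup (CoadCochain g (n + 1) ⧸ LinearMap.range (var (g := g) (n + 1))))

instance (n : ℕ) : Module ℝ (CR g n) :=
  inferInstanceAs (Module ℝ (CoadCochain g (n + 1) ⧸ LinearMap.range (var (g := g) (n + 1))))

/-- The class of a cochain in `CR^n(g)`. -/
def CR.mk (n : ℕ) : CoadCochain g (n + 1) →ₗ[ℝ] CR g n :=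
  (LinearMap.range (var (g := g) (n + 1))).mkQ

/-- The coboundary of `CR^*(g)`, induced by that of `Ω^*(g; g')`. -/
def crD (n : ℕ) : CR g n →ₗ[ℝ] CR g (n + 1) :=
  Submodule.mapQ _ _ (coadD (n + 1)) (by
    rintro _ ⟨α, rfl⟩
    exact ⟨altD (n + 2) α, (coadD_comp_var α).symm⟩)

/-- `HR^n(g)`, the cohomology of `coker Var`. -/
abbrev HR (n : ℕ) : Type u := Cohomology (crD g) n

/-- The open subspaces of `HL^n(g)`.  Cochains carry the linear topology of convergence on linearly
compact subspaces `K` of `g`, for which a subspace is open when it contains all cochains vanishing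
on some `K × ⋯ × K`, and cohomology carries the subquotient topology. -/
def hlOpen (n : ℕ) : Set (Submodule ℝ (HL g n)) :=
  {N | ∃ K : Submodule ℝ g, IsLinearlyCompact K ∧
    ∀ z : Cocycles (leibnizD (g := g)) n, (∀ v : Fin n → g, (∀ p, v p ∈ K) → z.1 v = 0) →
      Cohomology.mk (leibnizD (g := g)) n z ∈ N}

/-- The open subspaces of `HR^n(g)`, for the subquotient topology of the topology of `Ω^{n+1}(g; g')`
of convergence on linearly compact subspaces of `g`. -/
def hrOpen (n : ℕ) : Set (Submodule ℝ (HR g n)) :=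
  {N | ∃ K : Submodule ℝ g, IsLinearlyCompact K ∧
    ∀ (z : Cocycles (crD g) n) (β : CoadCochain g (n + 1)), z.1 = CR.mk g n β →
      (∀ v : Fin (n + 1) → g, (∀ p, v p ∈ K) → ∀ h ∈ K, β.1 v h = 0) →
        Cohomology.mk (crD g) n z ∈ N}

variable {g}

/-- The cross product of cochains,
`(α × β)(g₁, …, g_a, h₁, …, h_b) = α(g₁, …, g_a) β(h₁, …, h_b)`. -/
def cross {a b k : ℕ} (α : Cochain g a) (β : Cochain g b) (hk : a + b = k) : Cochain g k where
  toFun v := α (fun p => v (Fin.cast hk (Fin.castAdd b p))) *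
    β (fun p => v (Fin.cast hk (Fin.natAdd a p)))
  map_update_add' := by
    subst hk
    intro hd v l x y
    obtain rfl : hd = instDecidableEqFin _ := Subsingleton.elim _ _
    refine Fin.addCases (fun p => ?_) (fun p => ?_) l
    · have h1 : ∀ z, (fun q => Function.update v (Fin.castAdd b p) z (Fin.castAdd b q)) =
          Function.update (fun q => v (Fin.castAdd b q)) p z := fun z =>
        Function.update_comp_eq_of_injective v (Fin.castAdd_injective a b) p z
      have h2 : ∀ z, (fun q => Function.update v (Fin.castAdd b p) z (Fin.natAdd a q)) =
          fun q => v (Fin.natAdd a q) := fun z => by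
        ext q; rw [Function.update_of_ne]; simp [Fin.ext_iff]; omega
      simp only [Fin.cast_eq_self, h1, h2, α.map_update_add, add_mul]
    · have h1 : ∀ z, (fun q => Function.update v (Fin.natAdd a p) z (Fin.natAdd a q)) =
          Function.update (fun q => v (Fin.natAdd a q)) p z := fun z =>
        Function.update_comp_eq_of_injective v (Fin.natAdd_injective b a) p z
      have h2 : ∀ z, (fun q => Function.update v (Fin.natAdd a p) z (Fin.castAdd b q)) =
          fun q => v (Fin.castAdd b q) := fun z => by
        ext q; rw [Function.update_of_ne]; simp [Fin.ext_iff]; omega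
      simp only [Fin.cast_eq_self, h1, h2, β.map_update_add, mul_add]
  map_update_smul' := by
    subst hk
    intro hd v l c x
    obtain rfl : hd = instDecidableEqFin _ := Subsingleton.elim _ _
    refine Fin.addCases (fun p => ?_) (fun p => ?_) l
    · have h1 : ∀ z, (fun q => Function.update v (Fin.castAdd b p) z (Fin.castAdd b q)) =
          Function.update (fun q => v (Fin.castAdd b q)) p z := fun z =>
        Function.update_comp_eq_of_injective v (Fin.castAdd_injective a b) p z
      have h2 : ∀ z, (fun q => Function.update v (Fin.castAdd b p) z (Fin.natAdd a q)) =
          fun q => v (Fin.natAdd a q) := fun z => by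
        ext q; rw [Function.update_of_ne]; simp [Fin.ext_iff]; omega
      simp only [Fin.cast_eq_self, h1, h2, α.map_update_smul, smul_mul_assoc]
    · have h1 : ∀ z, (fun q => Function.update v (Fin.natAdd a p) z (Fin.natAdd a q)) =
          Function.update (fun q => v (Fin.natAdd a q)) p z := fun z =>
        Function.update_comp_eq_of_injective v (Fin.natAdd_injective b a) p z
      have h2 : ∀ z, (fun q => Function.update v (Fin.natAdd a p) z (Fin.castAdd b q)) =
          fun q => v (Fin.castAdd b q) := fun z => by
        ext q; rw [Function.update_of_ne]; simp [Fin.ext_iff]; omega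
      simp only [Fin.cast_eq_self, h1, h2, β.map_update_smul, mul_smul_comm]
  cont := (α.cont.comp (continuous_pi fun p => continuous_apply _)).mul
    (β.cont.comp (continuous_pi fun p => continuous_apply _))

end Quotients

end Leibniz

open Leibniz

/-! The spectral sequence needs only that `F^0` is everything, that the `F^s` are decreasing
subcomplexes and that `F^s` vanishes in degrees below `s`. The homology of the page `Z_r^s` modulo
boundaries is then the next page, and in total degree `m` nothing changes once `r ≥ m + 2`. The row
`n = 0` vanishes because `F^s` is zero already in degree `s`: a form in `s + 2` arguments that is
alternating in the last `s + 1` lies in the image of `i`.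

For the second page the arguments of a form `f` are split into two blocks `x`, `y`. Then `d f (x,
y)` is the coboundary of `f(·, y)` at `x`, plus up to sign the alternating sum of the Lie
derivatives of `f(·, ŷ_l)` along `y_l` and the coboundary of `f(x, ·)` at `y` (`leibnizD_glue`). For
`f` in `F^s` the last two contributions are alternating in `s + 2` arguments `y`, so that modulo the
next filtration step `d` acts on `x` alone; this produces `HL^n`. Lie derivatives of cocycles are
coboundaries by Cartan's formula, so that the next differential acts on `y` alone; this produces
`HR^s`.

Concretely, let the slices of `f` in the first block be Leibniz cocycles and those in the second
block represent elements of `HR^s`. Adding an element of `F^{s+1}` moves the coboundary of `f` to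
`F^{s+2}` (`leibnizD_corr`), so that `f` has a class `biClass` on the second page. All classes arise
in this way: an operator obtained from a linear splitting of the Leibniz complex is applied to the
first block (`biClass_surjective`). Contraction of the first block with a functional that vanishes
on coboundaries maps such classes to `HR^s` (`toHR_contract_eq_zero`).

If `g` is pro-finite-dimensional, continuity forces every form to be a finite sum of products and
the topologies on `HL` and `HR` are discrete. Injectivity of `HL ⊗ HR → E_2` follows by contraction,
surjectivity by projecting the factors to cocycles (`exists_tensor_equiv`).

If `g` is discrete, cochains are the full algebraic dual of the span of the evaluations. This
duality passes to `HR` (`IsDualPair.inducedForms`, `IsDualPair.exists_sub_mem`), so that the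
completed tensor product consists of the linear maps to `HR` from the forms on `HL` induced by
evaluations (`exists_completed_equiv_hom`). Contraction identifies the second page with the same
space (`HLSplitting.toHom_surjective`, `HLSplitting.toHom_eq_zero_iff`). -/

namespace Leibniz

/-! ### The spectral sequence of a filtered complex -/

section FilteredComplex

variable {C : ℕ → Type u} [∀ m, AddCommGroup (C m)] [∀ m, Module ℝ (C m)]

/-- First quadrant filtrations of cochain complexes. -/
structure IsFirstQuadrant (d : ∀ m, C m →ₗ[ℝ] C (m + 1)) (F : ℕ → ∀ m, Submodule ℝ (C m)) :
    Prop where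
  d_d : ∀ m x, d (m + 1) (d m x) = 0
  zero : ∀ m, F 0 m = ⊤
  anti : ∀ s t m, s ≤ t → F t m ≤ F s m
  d_mem : ∀ s m x, x ∈ F s m → d m x ∈ F s (m + 1)
  bot : ∀ s m, m < s → F s m = ⊥

variable {d : ∀ m, C m →ₗ[ℝ] C (m + 1)} {F : ℕ → ∀ m, Submodule ℝ (C m)}

theorem Page.mk_surjective (r s m : ℕ) : Function.Surjective (Page.mk d F r s m) :=
  Submodule.mkQ_surjective _

theorem Page.mk_eq_zero {r s m : ℕ} {x : C m} (hx : x ∈ pageCycles d F r s m) :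
    Page.mk d F r s m ⟨x, hx⟩ = 0 ↔ x ∈ pageBoundaries d F r s m :=
  Submodule.Quotient.mk_eq_zero _

theorem Page.mk_eq {r s m : ℕ} {x y : C m} (hx : x ∈ pageCycles d F r s m)
    (hy : y ∈ pageCycles d F r s m) :
    Page.mk d F r s m ⟨x, hx⟩ = Page.mk d F r s m ⟨y, hy⟩ ↔ x - y ∈ pageBoundaries d F r s m := by
  rw [← sub_eq_zero, ← map_sub]
  exact Page.mk_eq_zero (sub_mem hx hy)

theorem IsFirstQuadrant.dImage_d (h : IsFirstQuadrant d F) {N : ∀ m, Submodule ℝ (C m)} {m : ℕ}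
    {x : C m} (hx : x ∈ dImage d N m) : d m x = 0 := by
  cases m with
  | zero => rw [show x = 0 from hx, map_zero]
  | succ m => obtain ⟨y, -, rfl⟩ := hx; exact h.d_d m y

theorem dImage_mono {N N' : ∀ m, Submodule ℝ (C m)} (hN : ∀ m, N m ≤ N' m) (m : ℕ) :
    dImage d N m ≤ dImage d N' m := by
  cases m with
  | zero => exact le_rfl
  | succ m => exact Submodule.map_mono (hN m)

/-- Since `d w = 0`, the difference `x - w` is automatically in `Z_r^s`; only its filtration step
matters. -/
theorem IsFirstQuadrant.mem_pageBoundaries (h : IsFirstQuadrant d F) {r s m : ℕ} {x : C m}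
    (hx : x ∈ pageCycles d F r s m) : x ∈ pageBoundaries d F r s m ↔
      ∃ w ∈ F s m ⊓ dImage d (F (s + 1 - r)) m, x - w ∈ F (s + 1) m := by
  constructor
  · intro h'
    obtain ⟨u, hu, w, hw, rfl⟩ := Submodule.mem_sup.1 h'
    exact ⟨w, hw, by simpa using hu.2⟩
  · rintro ⟨w, hw, hxw⟩
    rw [← sub_add_cancel x w]
    refine Submodule.add_mem_sup ⟨⟨sub_mem hx.1 hw.1, ?_⟩, hxw⟩ hw
    show d m (x - w) ∈ F (s + r) (m + 1)
    rw [map_sub, h.dImage_d hw.2, sub_zero]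
    exact hx.2

theorem IsFirstQuadrant.pageCycles_succ_le (h : IsFirstQuadrant d F) (r s m : ℕ) :
    pageCycles d F (r + 1) s m ≤ pageCycles d F r s m :=
  fun _ hx => ⟨hx.1, h.anti _ _ _ (by omega) hx.2⟩

theorem IsFirstQuadrant.d_mem_pageCycles (h : IsFirstQuadrant d F) {r s m : ℕ} {x : C m}
    (hx : x ∈ pageCycles d F r s m) : d m x ∈ pageCycles d F r (s + r) (m + 1) :=
  ⟨hx.2, by show d (m + 1) (d m x) ∈ F (s + r + r) (m + 1 + 1); rw [h.d_d]; exact zero_mem _⟩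

/-- The part in `dImage` is killed by `d`. The part `u` in `F^{s+1}` is itself an admissible
primitive of `d u`, as `s + r + 1 - r = s + 1`. -/
theorem IsFirstQuadrant.d_mem_pageBoundaries (h : IsFirstQuadrant d F) {r s m : ℕ} {x : C m}
    (hx : x ∈ pageBoundaries d F r s m) : d m x ∈ pageBoundaries d F r (s + r) (m + 1) := by
  obtain ⟨u, hu, w, hw, rfl⟩ := Submodule.mem_sup.1 hx
  rw [map_add, h.dImage_d hw.2, add_zero]
  refine Submodule.mem_sup_right ⟨hu.1.2, u, h.anti _ _ _ (by omega) hu.2, rfl⟩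

/-- The differential of the pages. -/
def pageD (h : IsFirstQuadrant d F) {r s s' m m' : ℕ} (hs : s + r = s') (hm : m + 1 = m') :
    Page d F r s m →ₗ[ℝ] Page d F r s' m' := by
  subst hs hm
  exact Submodule.mapQ _ _ ((d m).restrict fun x hx => h.d_mem_pageCycles hx)
    fun x hx => h.d_mem_pageBoundaries hx

/-- Transport of pages along an equality of total degrees. -/
def pageCast {r s m m' : ℕ} (hm : m = m') : Page d F r s m ≃ₗ[ℝ] Page d F r s m' := by
  subst hm; exact LinearEquiv.refl _ _

/-- Transport of pages along an equality of page numbers. -/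
def pageCast' {r r' s m : ℕ} (hr : r = r') : Page d F r s m ≃ₗ[ℝ] Page d F r' s m := by
  subst hr; exact LinearEquiv.refl _ _

theorem pageD_mk (h : IsFirstQuadrant d F) {r s s' m m' : ℕ} (hs : s + r = s') (hm : m + 1 = m')
    {x : C m} (hx : x ∈ pageCycles d F r s m) :
    ∃ hy : d m x ∈ pageCycles d F r s' (m + 1), pageD h hs hm (Page.mk d F r s m ⟨x, hx⟩) =
      pageCast hm (Page.mk d F r s' (m + 1) ⟨d m x, hy⟩) := by
  subst hs hm; exact ⟨h.d_mem_pageCycles hx, rfl⟩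

theorem pageD_pageD (h : IsFirstQuadrant d F) {r s s' s'' m m' m'' : ℕ} (hs : s + r = s')
    (hm : m + 1 = m') (hs' : s' + r = s'') (hm' : m' + 1 = m'') (x : Page d F r s m) :
    pageD h hs' hm' (pageD h hs hm x) = 0 := by
  subst hs hm hs' hm'
  obtain ⟨⟨x, hx⟩, rfl⟩ := Page.mk_surjective r s m x
  refine (Page.mk_eq_zero (x := d (m + 1) (d m x)) (h.d_mem_pageCycles (h.d_mem_pageCycles hx))).2 ?_
  rw [h.d_d]; exact zero_mem _

theorem pageD_mk_eq_zero (h : IsFirstQuadrant d F) {r s s' m m' : ℕ} (hs : s + r = s')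
    (hm : m + 1 = m') {x : C m} (hx : x ∈ pageCycles d F r s m) :
    pageD h hs hm (Page.mk d F r s m ⟨x, hx⟩) = 0 ↔
      d m x ∈ pageBoundaries d F r (s + r) (m + 1) := by
  subst hs hm; exact Page.mk_eq_zero (h.d_mem_pageCycles hx)

/-- Cycles of a page lift to cycles of the next page. -/
theorem IsFirstQuadrant.exists_lift (h : IsFirstQuadrant d F) {r s m : ℕ} {x : C m}
    (hx : x ∈ pageCycles d F r s m) (hd : d m x ∈ pageBoundaries d F r (s + r) (m + 1)) :
    ∃ x' ∈ pageCycles d F (r + 1) s m, x - x' ∈ pageBoundaries d F r s m := by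
  -- The primitive `y` lies in `F^{s+1}`, so that subtracting it is invisible on page `r` but moves
  -- `d x` to `F^{s+r+1}`.
  obtain ⟨w, ⟨hw, y, hy, rfl⟩, hdw⟩ := (h.mem_pageBoundaries (h.d_mem_pageCycles hx)).1 hd
  rw [show s + r + 1 - r = s + 1 by omega] at hy
  have hys := h.anti _ _ _ (show s ≤ s + 1 by omega) hy
  refine ⟨x - y, ⟨sub_mem hx.1 hys, ?_⟩, Submodule.mem_sup_left ⟨⟨?_, ?_⟩, ?_⟩⟩
  · show d m (x - y) ∈ F (s + (r + 1)) (m + 1)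
    rw [map_sub]; exact hdw
  · simpa using hys
  · show d m (x - (x - y)) ∈ F (s + r) (m + 1)
    rw [sub_sub_cancel]; exact hw
  · simpa using hy

/-- Boundaries of the next page, in the presence of an incoming differential. -/
theorem IsFirstQuadrant.mem_pageBoundaries_succ (h : IsFirstQuadrant d F) {r s m : ℕ}
    {x : C (m + 1)} (hx : x ∈ pageCycles d F (r + 1) (s + r) (m + 1)) :
    x ∈ pageBoundaries d F (r + 1) (s + r) (m + 1) ↔
      ∃ y ∈ pageCycles d F r s m, x - d m y ∈ pageBoundaries d F r (s + r) (m + 1) := by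
  rw [h.mem_pageBoundaries hx]
  constructor
  · rintro ⟨_, ⟨hw, y, hy, rfl⟩, hxw⟩
    rw [show s + r + 1 - (r + 1) = s by omega] at hy
    refine ⟨y, ⟨hy, hw⟩, (h.mem_pageBoundaries ?_).2 ⟨0, zero_mem _, by simpa using hxw⟩⟩
    exact sub_mem (h.pageCycles_succ_le _ _ _ hx) (h.d_mem_pageCycles ⟨hy, hw⟩)
  · rintro ⟨y, hy, hxy⟩
    have hz := sub_mem (h.pageCycles_succ_le _ _ _ hx) (h.d_mem_pageCycles hy)
    obtain ⟨w, hw, hxw⟩ := (h.mem_pageBoundaries hz).1 hxy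
    -- The primitive of `w` lies in `F^{s+1}`, that of `d y` in `F^s`; the next page allows
    -- primitives in `F^s`, hence both.
    refine ⟨d m y + w, ⟨add_mem hy.2 hw.1, add_mem ⟨y, ?_, rfl⟩ ?_⟩, by rwa [← sub_sub]⟩
    · exact h.anti _ _ _ (by omega) hy.1
    · exact dImage_mono (fun m => h.anti _ _ _ (by omega)) _ hw.2

/-- Boundaries of the next page, in the absence of an incoming differential. -/
theorem IsFirstQuadrant.mem_pageBoundaries_succ_of_not (h : IsFirstQuadrant d F) {r s m : ℕ}
    (hr : s < r ∨ (r = 0 ∧ m = s)) {x : C m} (hx : x ∈ pageCycles d F (r + 1) s m) :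
    x ∈ pageBoundaries d F (r + 1) s m ↔ x ∈ pageBoundaries d F r s m := by
  rw [h.mem_pageBoundaries hx, h.mem_pageBoundaries (h.pageCycles_succ_le _ _ _ hx)]
  -- If `s < r`, both indices truncate to `0`. If `r = 0` and `m = s`, both filtration steps vanish
  -- in degree `m - 1 < s`.
  have : dImage d (F (s + 1 - (r + 1))) m = dImage d (F (s + 1 - r)) m := by
    rcases hr with hr | ⟨rfl, rfl⟩
    · rw [show s + 1 - (r + 1) = s + 1 - r by omega]
    · cases m with
      | zero => rfl
      | succ m => rw [dImage, dImage, h.bot _ _ (by omega), h.bot _ _ (by omega)]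
  rw [this]

/-! ### The pages as complexes, and their homology -/

open CategoryTheory

/-- Homology is the cokernel of the map from the previous term to the cycles, and `iCycles` is
injective; so vanishing can be tested on elements of the term itself. -/
theorem homologyπ_eq_zero_iff {ι : Type*} {c : ComplexShape ι}
    (K : HomologicalComplex (ModuleCat.{u} ℝ) c) (i : ι) (z : K.cycles i) :
    (K.homologyπ i).hom z = 0 ↔ ∃ w, (K.iCycles i).hom z = (K.d (c.prev i) i).hom w := by
  have hex : (ShortComplex.mk _ _ (K.toCycles_comp_homologyπ (c.prev i) i)).Exact :=
    ShortComplex.exact_of_g_is_cokernel _ (K.homologyIsCokernel (c.prev i) i rfl)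
  rw [ShortComplex.moduleCat_exact_iff] at hex
  have hi : ∀ w, (K.iCycles i).hom ((K.toCycles (c.prev i) i).hom w) =
      (K.d (c.prev i) i).hom w := fun w => by
    rw [← K.toCycles_i]; rfl
  constructor
  · intro h
    obtain ⟨w, rfl⟩ := hex z h
    exact ⟨w, hi w⟩
  · rintro ⟨w, hw⟩
    have hinj : Function.Injective (K.iCycles i) := (ModuleCat.mono_iff_injective _).1 inferInstance
    have : z = (K.toCycles (c.prev i) i).hom w := hinj (hw.trans (hi w).symm)
    rw [this]
    exact LinearMap.congr_fun (congrArg ModuleCat.Hom.hom (K.toCycles_comp_homologyπ _ i)) w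

theorem rel_iff {r : ℤ} (hr : 0 ≤ r) (a b : ℕ × ℕ) :
    (ComplexShape.spectralSequenceNat (r, 1 - r)).Rel a b ↔
      a.1 + r.toNat = b.1 ∧ a.1 + a.2 + 1 = b.1 + b.2 := by
  rw [ComplexShape.spectralSequenceNat_rel_iff]
  dsimp only
  omega

/-- The pages of the spectral sequence of a filtered complex. -/
noncomputable def pageComplex (h : IsFirstQuadrant d F) (r : ℤ) (hr : 0 ≤ r) :
    HomologicalComplex (ModuleCat.{u} ℝ) (ComplexShape.spectralSequenceNat (r, 1 - r)) where
  X a := ModuleCat.of ℝ (Page d F r.toNat a.1 (a.1 + a.2))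
  d a b := open Classical in
    if hab : (ComplexShape.spectralSequenceNat (r, 1 - r)).Rel a b then
      ModuleCat.ofHom (pageD h ((rel_iff hr a b).1 hab).1 ((rel_iff hr a b).1 hab).2)
    else 0
  shape a b hab := dif_neg hab
  d_comp_d' a b c hab hbc := by
    rw [dif_pos hab, dif_pos hbc]
    ext x
    exact pageD_pageD h _ _ _ _ _

theorem pageComplex_d (h : IsFirstQuadrant d F) {r : ℤ} (hr : 0 ≤ r) {a b : ℕ × ℕ}
    (h1 : a.1 + r.toNat = b.1) (h2 : a.1 + a.2 + 1 = b.1 + b.2) :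
    ((pageComplex h r hr).d a b).hom = pageD h h1 h2 := by
  have : (pageComplex h r hr).d a b = ModuleCat.ofHom (pageD h h1 h2) :=
    dif_pos ((rel_iff hr a b).2 ⟨h1, h2⟩)
  rw [this]; rfl

/-- If the target would lie outside the first quadrant, the differential is zero by definition; then
also `d x = 0`, because `F^{s+r}` vanishes in that degree. -/
theorem pageComplex_d_mk_eq_zero (h : IsFirstQuadrant d F) {r : ℤ} (hr : 0 ≤ r) (a : ℕ × ℕ)
    {x : C (a.1 + a.2)} (hx : x ∈ pageCycles d F r.toNat a.1 (a.1 + a.2)) :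
    ((pageComplex h r hr).d a ((ComplexShape.spectralSequenceNat (r, 1 - r)).next a)).hom
      (Page.mk d F _ _ _ ⟨x, hx⟩) = 0 ↔
        d _ x ∈ pageBoundaries d F r.toNat (a.1 + r.toNat) (a.1 + a.2 + 1) := by
  by_cases hn : r.toNat ≤ a.2 + 1
  · have h1 : a.1 + r.toNat = ((a.1 + r.toNat, a.2 + 1 - r.toNat) : ℕ × ℕ).1 := rfl
    have h2 : a.1 + a.2 + 1 = ((a.1 + r.toNat, a.2 + 1 - r.toNat) : ℕ × ℕ).1 +
        ((a.1 + r.toNat, a.2 + 1 - r.toNat) : ℕ × ℕ).2 := by dsimp only; omega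
    rw [ComplexShape.next_eq' _ ((rel_iff hr a _).2 ⟨h1, h2⟩), pageComplex_d h hr h1 h2]
    exact pageD_mk_eq_zero h h1 h2 hx
  · have hd : d _ x = 0 := by
      have := hx.2
      rw [h.bot _ _ (by omega)] at this
      exact this
    rw [(pageComplex h r hr).shape]
    · rw [hd]
      exact ⟨fun _ => zero_mem _, fun _ => rfl⟩
    · intro hrel
      have := (rel_iff hr _ _).1 hrel
      omega

/-- The incoming differential starts at `(s - r, n + r - 1)`. If this is outside the quadrant,
elements of `Z_{r+1}^s` are boundaries for page `r + 1` exactly when they are for page `r`. -/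
theorem exists_pageComplex_d_iff (h : IsFirstQuadrant d F) {r : ℤ} (hr : 0 ≤ r) (a : ℕ × ℕ)
    {x : C (a.1 + a.2)} (hx : x ∈ pageCycles d F (r.toNat + 1) a.1 (a.1 + a.2)) :
    (∃ w, Page.mk d F _ _ _ ⟨x, h.pageCycles_succ_le _ _ _ hx⟩ =
      ((pageComplex h r hr).d ((ComplexShape.spectralSequenceNat (r, 1 - r)).prev a) a).hom w) ↔
        x ∈ pageBoundaries d F (r.toNat + 1) a.1 (a.1 + a.2) := by
  by_cases hn : r.toNat ≤ a.1 ∧ 0 < a.2 + r.toNat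
  · obtain ⟨s, n⟩ := a
    obtain ⟨ρ, hρ⟩ : ∃ ρ, ρ = r.toNat := ⟨_, rfl⟩
    have hn' : ρ ≤ s ∧ 0 < n + ρ := hρ ▸ hn
    have h1 : ((s - ρ, n + ρ - 1) : ℕ × ℕ).1 + r.toNat = s := by dsimp only; omega
    have h2 : ((s - ρ, n + ρ - 1) : ℕ × ℕ).1 + ((s - ρ, n + ρ - 1) : ℕ × ℕ).2 + 1 = s + n := by
      dsimp only; omega
    rw [ComplexShape.prev_eq' _ ((rel_iff hr _ (s, n)).2 ⟨h1, h2⟩),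
      pageComplex_d h hr (b := (s, n)) h1 h2]
    dsimp only at x hx h1 h2 ⊢
    -- The indices are generalised so that the equations between them can be substituted.
    have key : ∀ (ρ s s' m m' : ℕ) (h1 : s + ρ = s') (h2 : m + 1 = m') (x : C m')
        (hx : x ∈ pageCycles d F (ρ + 1) s' m'),
        (∃ w, Page.mk d F _ _ _ ⟨x, h.pageCycles_succ_le _ _ _ hx⟩ = pageD h h1 h2 w) ↔
          x ∈ pageBoundaries d F (ρ + 1) s' m' := by
      intro ρ s s' m m' h1 h2 x hx
      subst h1 h2
      rw [h.mem_pageBoundaries_succ hx]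
      constructor
      · rintro ⟨w, hw⟩
        obtain ⟨⟨y, hy⟩, rfl⟩ := Page.mk_surjective _ _ _ w
        exact ⟨y, hy, (Page.mk_eq _ (h.d_mem_pageCycles hy)).1 hw⟩
      · rintro ⟨y, hy, hxy⟩
        exact ⟨Page.mk d F _ _ _ ⟨y, hy⟩, (Page.mk_eq _ (h.d_mem_pageCycles hy)).2 hxy⟩
    exact key _ _ _ _ _ h1 h2 x hx
  · rw [(pageComplex h r hr).shape]
    · rw [h.mem_pageBoundaries_succ_of_not (by omega) hx,
        ← Page.mk_eq_zero (h.pageCycles_succ_le _ _ _ hx)]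
      exact ⟨fun ⟨_, hw⟩ => hw, fun hw => ⟨0, hw⟩⟩
    · intro hrel
      have := (rel_iff hr _ _).1 hrel
      omega

/-- Elements of `Z_{r+1}^s` as cycles of the `r`-th page. -/
noncomputable def liftPageCycles (h : IsFirstQuadrant d F) (r : ℤ) (hr : 0 ≤ r) (a : ℕ × ℕ) :
    ModuleCat.of ℝ (pageCycles d F (r.toNat + 1) a.1 (a.1 + a.2)) ⟶
      (pageComplex h r hr).cycles a :=
  (pageComplex h r hr).liftCycles
    (ModuleCat.ofHom ((Page.mk d F r.toNat a.1 (a.1 + a.2)).comp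
      (Submodule.inclusion (h.pageCycles_succ_le _ _ _)))) _ rfl (by
    ext ⟨x, hx⟩
    refine (pageComplex_d_mk_eq_zero h hr a (h.pageCycles_succ_le _ _ _ hx)).2 ?_
    refine Submodule.mem_sup_left ⟨h.d_mem_pageCycles (h.pageCycles_succ_le _ _ _ hx), hx.2⟩)

theorem iCycles_liftPageCycles (h : IsFirstQuadrant d F) (r : ℤ) (hr : 0 ≤ r) (a : ℕ × ℕ)
    (x : pageCycles d F (r.toNat + 1) a.1 (a.1 + a.2)) :
    ((pageComplex h r hr).iCycles a).hom ((liftPageCycles h r hr a).hom x) =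
      Page.mk d F r.toNat a.1 (a.1 + a.2) ⟨x.1, h.pageCycles_succ_le _ _ _ x.2⟩ := by
  have e : liftPageCycles h r hr a ≫ (pageComplex h r hr).iCycles a =
      ModuleCat.ofHom ((Page.mk d F r.toNat a.1 (a.1 + a.2)).comp
        (Submodule.inclusion (h.pageCycles_succ_le _ _ _))) :=
    (pageComplex h r hr).liftCycles_i _ _ _ _
  exact LinearMap.congr_fun (congrArg ModuleCat.Hom.hom e) x

theorem iCycles_injective (h : IsFirstQuadrant d F) (r : ℤ) (hr : 0 ≤ r) (a : ℕ × ℕ) :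
    Function.Injective ((pageComplex h r hr).iCycles a).hom :=
  (ModuleCat.mono_iff_injective _).1 inferInstance

/-- The homology of a page is the next page. -/
noncomputable def homologyPageEquiv (h : IsFirstQuadrant d F) (r : ℤ) (hr : 0 ≤ r) (a : ℕ × ℕ) :
    Page d F (r.toNat + 1) a.1 (a.1 + a.2) ≃ₗ[ℝ] (pageComplex h r hr).homology a :=
  (Submodule.quotEquivOfEq _ (LinearMap.ker
    (((pageComplex h r hr).homologyπ a).hom.comp (liftPageCycles h r hr a).hom)) (by
      ext ⟨x, hx⟩
      refine Iff.symm (Iff.trans (homologyπ_eq_zero_iff _ _ _) ?_)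
      rw [iCycles_liftPageCycles]
      exact exists_pageComplex_d_iff h hr a hx)).trans
  (LinearMap.quotKerEquivOfSurjective _ (by
    intro z
    obtain ⟨z, rfl⟩ := (ModuleCat.epi_iff_surjective ((pageComplex h r hr).homologyπ a)).1
      inferInstance z
    obtain ⟨⟨x, hx⟩, hxz⟩ := Page.mk_surjective _ _ _ (((pageComplex h r hr).iCycles a).hom z)
    have h0 := LinearMap.congr_fun (congrArg ModuleCat.Hom.hom ((pageComplex h r hr).iCycles_d a
      ((ComplexShape.spectralSequenceNat (r, 1 - r)).next a))) z
    have h1 : d _ x ∈ pageBoundaries d F r.toNat (a.1 + r.toNat) (a.1 + a.2 + 1) := by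
      rw [← pageComplex_d_mk_eq_zero h hr a hx, hxz]; exact h0
    -- The chosen representative `x` need not lie in `Z_{r+1}^s`; it is moved there without changing
    -- its class on page `r`.
    obtain ⟨x', hx', hxx'⟩ := h.exists_lift hx h1
    refine ⟨⟨x', hx'⟩, ?_⟩
    show ((pageComplex h r hr).homologyπ a).hom ((liftPageCycles h r hr a).hom ⟨x', hx'⟩) = _
    congr 1
    refine iCycles_injective h r hr a ?_
    rw [iCycles_liftPageCycles, ← hxz]
    exact ((Page.mk_eq hx (h.pageCycles_succ_le _ _ _ hx')).2 hxx').symm))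

theorem homologyPageEquiv_mk (h : IsFirstQuadrant d F) (r : ℤ) (hr : 0 ≤ r) (a : ℕ × ℕ)
    (x : pageCycles d F (r.toNat + 1) a.1 (a.1 + a.2)) :
    homologyPageEquiv h r hr a (Page.mk d F _ _ _ x) =
      ((pageComplex h r hr).homologyπ a).hom ((liftPageCycles h r hr a).hom x) := rfl

/-- The spectral sequence of a filtered complex. -/
noncomputable def specSeq (h : IsFirstQuadrant d F) : SpecSeq.{u} where
  page r hr := pageComplex h r hr
  iso r r' a hrr' hr := ((homologyPageEquiv h r hr a).symm.trans
    (pageCast' (show r.toNat + 1 = r'.toNat by omega))).toModuleIso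

/-- The entries of the spectral sequence of a filtered complex. -/
def pageEntry (h : IsFirstQuadrant d F) (r s n m : ℕ) (hm : s + n = m) :
    Page d F r s m ≃ₗ[ℝ] (specSeq h).entry r s n :=
  pageCast hm.symm

theorem isSpecSeqOf_specSeq (h : IsFirstQuadrant d F) :
    IsSpecSeqOf d F (specSeq h) (pageEntry h) where
  d_mk r s n n' m hm hm' x hx := by
    subst hm
    refine ⟨h.d_mem_pageCycles hx, ?_⟩
    have e := pageComplex_d h (Int.natCast_nonneg r) (a := (s, n)) (b := (s + r, n')) rfl hm'.symm
    refine (LinearMap.congr_fun e _).trans ?_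
    obtain ⟨hy, h2⟩ := pageD_mk h (rfl : s + r = s + r) hm'.symm hx
    exact h2
  iso_mk r s n m hm x hx hx' z hz := by
    subst hm
    have hz' : z = (liftPageCycles h r (Int.natCast_nonneg r) (s, n)).hom ⟨x, hx'⟩ :=
      iCycles_injective h _ _ _ (hz.trans (iCycles_liftPageCycles h r _ (s, n) ⟨x, hx'⟩).symm)
    rw [hz']
    have h1 := homologyPageEquiv_mk h r (Int.natCast_nonneg r) (s, n) ⟨x, hx'⟩
    show pageCast' (r' := r + 1) rfl ((homologyPageEquiv h r (Int.natCast_nonneg r) (s, n)).symm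
      (((pageComplex h r _).homologyπ (s, n)).hom
        ((liftPageCycles h r _ (s, n)).hom ⟨x, hx'⟩))) = _
    rw [← h1, LinearEquiv.symm_apply_apply]
    rfl

theorem pageEntry_subsingleton (h : IsFirstQuadrant d F) {r s n : ℕ} (h0 : F s (s + n) = ⊥) :
    Subsingleton ((specSeq h).entry r s n) := by
  refine (pageEntry h r s n _ rfl).symm.toEquiv.subsingleton_congr.2 ⟨fun x y => ?_⟩
  obtain ⟨⟨x, hx⟩, rfl⟩ := Page.mk_surjective _ _ _ x
  obtain ⟨⟨y, hy⟩, rfl⟩ := Page.mk_surjective _ _ _ y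
  have hx' := hx.1
  have hy' := hy.1
  rw [h0] at hx' hy'
  congr 2
  exact hx'.trans hy'.symm

/-- The spectral sequence of a first quadrant filtration converges. -/
theorem IsFirstQuadrant.convergesToCohomology (h : IsFirstQuadrant d F) :
    ConvergesToCohomology d F := by
  have hanti : ∀ m, Antitone fun s => cohomologyFiltration d F s m := fun m s t hst =>
    Submodule.map_mono (Submodule.comap_mono (h.anti _ _ _ hst))
  intro m
  refine ⟨?_, hanti m, ?_, m + 2, fun r hr s hs => ?_⟩
  · refine eq_top_iff.2 fun z _ => ?_
    obtain ⟨z, rfl⟩ := Submodule.mkQ_surjective _ z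
    exact ⟨z, by show z.1 ∈ F 0 m; rw [h.zero]; trivial, rfl⟩
  · refine eq_bot_iff.2 ?_
    rintro _ ⟨⟨z, hz⟩, hzs, rfl⟩
    have hz0 : z ∈ F (m + 1) m := hzs
    rw [h.bot _ _ (by omega)] at hz0
    obtain rfl : z = 0 := hz0
    exact map_zero (Cohomology.mk d m)
  -- As `r ≥ m + 2`, `F^{s+r}` vanishes in degree `m + 1`, so that `Z_r^s` consists of cocycles.
  -- Likewise `s + 1 - r = 0`, so that all coboundaries in `F^s` are divided out.
  have hcyc : ∀ x, x ∈ pageCycles d F r s m → x ∈ Cocycles d m := fun x hx => by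
    have := hx.2
    rw [h.bot _ _ (by omega)] at this
    exact this
  have hmem : ∀ x (hx : x ∈ pageCycles d F r s m),
      Cohomology.mk d m ⟨x, hcyc x hx⟩ ∈ cohomologyFiltration d F s m :=
    fun x hx => ⟨⟨x, hcyc x hx⟩, hx.1, rfl⟩
  let θ : pageCycles d F r s m →ₗ[ℝ] cohomologyFiltration d F s m :=
    { toFun := fun x => ⟨Cohomology.mk d m ⟨x.1, hcyc x.1 x.2⟩, hmem x.1 x.2⟩
      map_add' := fun _ _ => rfl
      map_smul' := fun _ _ => rfl }
  let ψ : pageCycles d F r s m →ₗ[ℝ] (cohomologyFiltration d F s m ⧸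
      (cohomologyFiltration d F (s + 1) m).submoduleOf (cohomologyFiltration d F s m)) :=
    (Submodule.mkQ _).comp θ
  have hker : (pageBoundaries d F r s m).submoduleOf (pageCycles d F r s m) = LinearMap.ker ψ := by
    ext ⟨x, hx⟩
    refine (h.mem_pageBoundaries hx).trans (Iff.symm ((Submodule.Quotient.mk_eq_zero _).trans ?_))
    change Cohomology.mk d m ⟨x, hcyc x hx⟩ ∈ cohomologyFiltration d F (s + 1) m ↔ _
    rw [show s + 1 - r = 0 by omega]
    have hz : (F 0) = fun m => ⊤ := funext h.zero
    rw [hz]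
    constructor
    · rintro ⟨⟨y, hy⟩, hys, hxy⟩
      have hxy' := (Submodule.Quotient.eq _).1 hxy
      change y - x ∈ dImage d (fun _ => ⊤) m at hxy'
      refine ⟨x - y, ⟨sub_mem hx.1 (h.anti _ _ _ (by omega) hys), ?_⟩, by
        have hys' : y ∈ F (s + 1) m := hys
        simpa using hys'⟩
      simpa using neg_mem hxy'
    · rintro ⟨w, hw, hxw⟩
      refine ⟨⟨x - w, sub_mem (hcyc x hx) (h.dImage_d hw.2)⟩, hxw, ?_⟩
      refine (Submodule.Quotient.eq _).2 ?_
      change x - w - x ∈ dImage d (fun _ => ⊤) m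
      simpa using neg_mem hw.2
  have hsurj : Function.Surjective ψ := by
    intro z
    obtain ⟨⟨_, ⟨⟨x, hx⟩, hxs, rfl⟩⟩, rfl⟩ := Submodule.mkQ_surjective _ z
    have hd : d m x = 0 := hx
    exact ⟨⟨x, hxs, by show d m x ∈ F (s + r) (m + 1); rw [hd]; exact zero_mem _⟩, rfl⟩
  exact ⟨(Submodule.quotEquivOfEq _ _ hker).trans (ψ.quotKerEquivOfSurjective hsurj),
    fun x _ _ _ _ => rfl⟩

end FilteredComplex

/-! ### Splitting the arguments of a form into two blocks -/

section Glue

variable {g : Type u}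

/-- The first block of indices of a decomposition `k = a + b`. -/
def inl {a b k : ℕ} (hk : a + b = k) (p : Fin a) : Fin k := Fin.cast hk (Fin.castAdd b p)

/-- The second block of indices of a decomposition `k = a + b`. -/
def inr {a b k : ℕ} (hk : a + b = k) (p : Fin b) : Fin k := Fin.cast hk (Fin.natAdd a p)

@[simp] theorem val_inl {a b k : ℕ} (hk : a + b = k) (p : Fin a) : (inl hk p : ℕ) = p := rfl

@[simp] theorem val_inr {a b k : ℕ} (hk : a + b = k) (p : Fin b) : (inr hk p : ℕ) = a + p := rfl

theorem inl_or_inr {a b k : ℕ} (hk : a + b = k) (i : Fin k) :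
    (∃ p, i = inl hk p) ∨ ∃ p, i = inr hk p := by
  by_cases h : (i : ℕ) < a
  · exact Or.inl ⟨⟨i, h⟩, Fin.ext rfl⟩
  · exact Or.inr ⟨⟨i - a, by omega⟩, Fin.ext (by simp; omega)⟩

theorem inl_injective {a b k : ℕ} (hk : a + b = k) : Function.Injective (inl hk) :=
  fun p q h => Fin.ext (by simpa using congrArg Fin.val h)

theorem inr_injective {a b k : ℕ} (hk : a + b = k) : Function.Injective (inr hk) :=
  fun p q h => Fin.ext (by simpa using congrArg Fin.val h)

theorem inl_ne_inr {a b k : ℕ} (hk : a + b = k) (p : Fin a) (q : Fin b) : inl hk p ≠ inr hk q :=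
  fun h => by have := congrArg Fin.val h; simp at this; omega

theorem sum_inl_inr {M : Type*} [AddCommMonoid M] {a b k : ℕ} (hk : a + b = k) (F : Fin k → M) :
    ∑ i, F i = ∑ p, F (inl hk p) + ∑ p, F (inr hk p) := by
  subst hk; exact Fin.sum_univ_add F

/-- Concatenation of two blocks of arguments. -/
def glue {a b k : ℕ} (hk : a + b = k) (x : Fin a → g) (y : Fin b → g) : Fin k → g :=
  fun i => Fin.append x y (Fin.cast hk.symm i)

@[simp] theorem glue_inl {a b k : ℕ} (hk : a + b = k) (x : Fin a → g) (y : Fin b → g) (p : Fin a) :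
    glue hk x y (inl hk p) = x p := by
  subst hk; exact Fin.append_left x y p

@[simp] theorem glue_inr {a b k : ℕ} (hk : a + b = k) (x : Fin a → g) (y : Fin b → g) (p : Fin b) :
    glue hk x y (inr hk p) = y p := by
  subst hk; exact Fin.append_right x y p

theorem glue_parts {a b k : ℕ} (hk : a + b = k) (v : Fin k → g) :
    glue hk (fun p => v (inl hk p)) (fun p => v (inr hk p)) = v := by
  ext i; rcases inl_or_inr hk i with ⟨p, rfl⟩ | ⟨p, rfl⟩ <;> simp

theorem eq_glue {a b k : ℕ} (hk : a + b = k) {v : Fin k → g} {x : Fin a → g} {y : Fin b → g}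
    (h1 : ∀ p, v (inl hk p) = x p) (h2 : ∀ p, v (inr hk p) = y p) : v = glue hk x y := by
  ext i; rcases inl_or_inr hk i with ⟨p, rfl⟩ | ⟨p, rfl⟩ <;> simp [h1, h2]

theorem glue_update_left {a b k : ℕ} (hk : a + b = k) (x : Fin a → g) (y : Fin b → g) (p : Fin a)
    (z : g) : glue hk (Function.update x p z) y = Function.update (glue hk x y) (inl hk p) z := by
  refine (eq_glue hk (fun q => ?_) fun q => ?_).symm
  · by_cases h : q = p
    · subst h; simp
    · rw [Function.update_of_ne h, Function.update_of_ne ((inl_injective hk).ne h), glue_inl]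
  · rw [Function.update_of_ne (inl_ne_inr hk p q).symm, glue_inr]

theorem glue_update_right {a b k : ℕ} (hk : a + b = k) (x : Fin a → g) (y : Fin b → g) (p : Fin b)
    (z : g) : glue hk x (Function.update y p z) = Function.update (glue hk x y) (inr hk p) z := by
  refine (eq_glue hk (fun q => ?_) fun q => ?_).symm
  · rw [Function.update_of_ne (inl_ne_inr hk q p), glue_inl]
  · by_cases h : q = p
    · subst h; simp
    · rw [Function.update_of_ne h, Function.update_of_ne ((inr_injective hk).ne h), glue_inr]

theorem continuous_glue [TopologicalSpace g] {a b k : ℕ} (hk : a + b = k) :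
    Continuous fun p : (Fin a → g) × (Fin b → g) => glue hk p.1 p.2 := by
  refine continuous_pi fun i => ?_
  rcases inl_or_inr hk i with ⟨p, rfl⟩ | ⟨p, rfl⟩
  · simp only [glue_inl]; exact (continuous_apply p).comp continuous_fst
  · simp only [glue_inr]; exact (continuous_apply p).comp continuous_snd

theorem merge_apply [LieRing g] {k : ℕ} (v : Fin (k + 1) → g) (i : Fin k) (j : Fin (k + 1))
    (p : Fin k) :
    merge v i j p = if p = i then ⁅v i.castSucc, v j⁆ else v (j.succAbove p) := by
  by_cases h : p = i
  · subst h; simp [merge]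
  · simp [merge, h, Fin.removeNth]

/-- `∑_l (-1)^l G(y_l, y₀, …, ŷ_l, …)` vanishes when two adjacent arguments agree, if `G` does. -/
theorem sum_removeNth_eq_zero {q : ℕ} (G : g → (Fin q → g) → ℝ)
    (hG : ∀ z y (p p' : Fin q), p ≠ p' → y p = y p' → G z y = 0) (y : Fin (q + 1) → g)
    (i j : Fin (q + 1)) (hij : (j : ℕ) = i + 1) (hy : y i = y j) :
    ∑ l : Fin (q + 1), (-1 : ℝ) ^ (l : ℕ) * G (y l) (l.removeNth y) = 0 := by
  have hne : i ≠ j := fun h => by subst h; omega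
  rw [Finset.sum_eq_add i j hne]
  · have hrem : i.removeNth y = j.removeNth y := by
      ext p
      simp only [Fin.removeNth]
      rcases lt_trichotomy (p : ℕ) i with h | h | h
      · rw [Fin.succAbove_of_castSucc_lt _ _ (by simpa [Fin.lt_def] using h),
          Fin.succAbove_of_castSucc_lt _ _ (by simp [Fin.lt_def]; omega)]
      · rw [Fin.succAbove_of_le_castSucc _ _ (by simp [Fin.le_def]; omega),
          Fin.succAbove_of_castSucc_lt _ _ (by simp [Fin.lt_def]; omega)]
        have e1 : p.succ = j := by ext; simp; omega
        have e2 : p.castSucc = i := by ext; simp; omega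
        rw [e1, e2, hy]
      · rw [Fin.succAbove_of_le_castSucc _ _ (by simp [Fin.le_def]; omega),
          Fin.succAbove_of_le_castSucc _ _ (by simp [Fin.le_def]; omega)]
    rw [hrem, hy, hij, pow_succ]; ring
  · rintro l - ⟨hli, hlj⟩
    obtain ⟨p, hp⟩ := Fin.exists_succAbove_eq hli.symm
    obtain ⟨p', hp'⟩ := Fin.exists_succAbove_eq hlj.symm
    rw [hG _ _ p p' (fun h => hne (by rw [← hp, ← hp', h])), mul_zero]
    simp only [Fin.removeNth, hp, hp', hy]
  · simp
  · simp

section MergeGlue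

variable [LieRing g]

/-- The bracket goes to a position before the removed argument, so that only three of the four
combinations of blocks are needed: this one and the next two. -/
theorem merge_glue_inl_inl {n b N : ℕ} (hN : n + b = N) (hk : n + 1 + b = N + 1)
    (x : Fin (n + 1) → g) (y : Fin b → g) (i : Fin n) (j : Fin (n + 1)) :
    merge (glue hk x y) (inl hN i) (inl hk j) = glue hN (merge x i j) y := by
  have e : (inl hN i).castSucc = inl hk i.castSucc := rfl
  refine eq_glue hN (fun p => ?_) fun p => ?_
  · rw [merge_apply, merge_apply, e, glue_inl, glue_inl]
    simp only [(inl_injective hN).eq_iff]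
    congr 1
    have : (inl hk j).succAbove (inl hN p) = inl hk (j.succAbove p) := by
      ext; simp only [Fin.succAbove, Fin.lt_def, Fin.val_castSucc, val_inl]; split_ifs <;> simp
    rw [this, glue_inl]
  · rw [merge_apply, if_neg (inl_ne_inr hN i p).symm]
    have : (inl hk j).succAbove (inr hN p) = inr hk p := by
      rw [Fin.succAbove_of_le_castSucc _ _ (by simp [Fin.le_def]; omega)]
      ext; simp; omega
    rw [this, glue_inr]

theorem merge_glue_inr_inr {a q N : ℕ} (hN : a + q = N) (hk : a + (q + 1) = N + 1)
    (x : Fin a → g) (y : Fin (q + 1) → g) (i : Fin q) (j : Fin (q + 1)) :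
    merge (glue hk x y) (inr hN i) (inr hk j) = glue hN x (merge y i j) := by
  have e : (inr hN i).castSucc = inr hk i.castSucc := rfl
  refine eq_glue hN (fun p => ?_) fun p => ?_
  · rw [merge_apply, if_neg (inl_ne_inr hN p i)]
    have : (inr hk j).succAbove (inl hN p) = inl hk p := by
      rw [Fin.succAbove_of_castSucc_lt _ _ (by simp [Fin.lt_def]; omega)]
      rfl
    rw [this, glue_inl]
  · rw [merge_apply, merge_apply, e, glue_inr, glue_inr]
    simp only [(inr_injective hN).eq_iff]
    congr 1
    have : (inr hk j).succAbove (inr hN p) = inr hk (j.succAbove p) := by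
      ext; simp only [Fin.succAbove, Fin.lt_def, Fin.val_castSucc, val_inr]
      split_ifs <;> simp <;> omega
    rw [this, glue_inr]

theorem merge_glue_inl_inr {a q N : ℕ} (hN : a + q = N) (hk : a + (q + 1) = N + 1)
    (x : Fin a → g) (y : Fin (q + 1) → g) (i : Fin a) (j : Fin (q + 1)) :
    merge (glue hk x y) (inl hN i) (inr hk j) =
      glue hN (Function.update x i ⁅x i, y j⁆) (j.removeNth y) := by
  have e : (inl hN i).castSucc = inl hk i := rfl
  refine eq_glue hN (fun p => ?_) fun p => ?_
  · rw [merge_apply, e, glue_inl, glue_inr]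
    by_cases h : p = i
    · subst h; simp
    · rw [if_neg ((inl_injective hN).ne h), Function.update_of_ne h]
      have : (inr hk j).succAbove (inl hN p) = inl hk p := by
        rw [Fin.succAbove_of_castSucc_lt _ _ (by simp [Fin.lt_def]; omega)]
        rfl
      rw [this, glue_inl]
  · rw [merge_apply, if_neg (inl_ne_inr hN i p).symm]
    have : (inr hk j).succAbove (inr hN p) = inr hk (j.succAbove p) := by
      ext; simp only [Fin.succAbove, Fin.lt_def, Fin.val_castSucc, val_inr]
      split_ifs <;> simp <;> omega
    rw [this, glue_inr]; rfl

end MergeGlue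

end Glue

/-! ### Slices of forms, and the coboundary on two blocks -/

section Slices

variable {g : Type u} [LieRing g] [LieAlgebra ℝ g] [TopologicalSpace g]

/-- The form `f(·, y)`. -/
def sliceL {a b k : ℕ} (hk : a + b = k) (f : Cochain g k) (y : Fin b → g) : Cochain g a where
  toFun x := f (glue hk x y)
  map_update_add' := by
    intro hd x l z z'
    obtain rfl : hd = instDecidableEqFin _ := Subsingleton.elim _ _
    simp only [glue_update_left, f.map_update_add]
  map_update_smul' := by
    intro hd x l c z
    obtain rfl : hd = instDecidableEqFin _ := Subsingleton.elim _ _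
    simp only [glue_update_left, f.map_update_smul]
  cont := f.cont.comp ((continuous_glue hk).comp (continuous_id.prodMk continuous_const))

/-- The form `f(x, ·)`. -/
def sliceR {a b k : ℕ} (hk : a + b = k) (f : Cochain g k) (x : Fin a → g) : Cochain g b where
  toFun y := f (glue hk x y)
  map_update_add' := by
    intro hd y l z z'
    obtain rfl : hd = instDecidableEqFin _ := Subsingleton.elim _ _
    simp only [glue_update_right, f.map_update_add]
  map_update_smul' := by
    intro hd y l c z
    obtain rfl : hd = instDecidableEqFin _ := Subsingleton.elim _ _
    simp only [glue_update_right, f.map_update_smul]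
  cont := f.cont.comp ((continuous_glue hk).comp (continuous_const.prodMk continuous_id))

@[simp] theorem sliceL_apply {a b k : ℕ} (hk : a + b = k) (f : Cochain g k) (y : Fin b → g)
    (x : Fin a → g) : sliceL hk f y x = f (glue hk x y) := rfl

@[simp] theorem sliceR_apply {a b k : ℕ} (hk : a + b = k) (f : Cochain g k) (x : Fin a → g)
    (y : Fin b → g) : sliceR hk f x y = f (glue hk x y) := rfl

theorem sliceL_add {a b k : ℕ} (hk : a + b = k) (f f' : Cochain g k) (y : Fin b → g) :
    sliceL hk (f + f') y = sliceL hk f y + sliceL hk f' y := rfl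

theorem sliceL_smul {a b k : ℕ} (hk : a + b = k) (c : ℝ) (f : Cochain g k) (y : Fin b → g) :
    sliceL hk (c • f) y = c • sliceL hk f y := rfl

theorem sliceL_sub {a b k : ℕ} (hk : a + b = k) (f f' : Cochain g k) (y : Fin b → g) :
    sliceL hk (f - f') y = sliceL hk f y - sliceL hk f' y := rfl

theorem sliceL_update_add {a b k : ℕ} (hk : a + b = k) (f : Cochain g k) (y : Fin b → g)
    (p : Fin b) (z z' : g) : sliceL hk f (Function.update y p (z + z')) =
      sliceL hk f (Function.update y p z) + sliceL hk f (Function.update y p z') := by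
  ext x; simp [glue_update_right]

theorem sliceL_update_smul {a b k : ℕ} (hk : a + b = k) (f : Cochain g k) (y : Fin b → g)
    (p : Fin b) (c : ℝ) (z : g) : sliceL hk f (Function.update y p (c • z)) =
      c • sliceL hk f (Function.update y p z) := by
  ext x; simp [glue_update_right]

@[simp] theorem cross_glue {a b k : ℕ} (hk : a + b = k) (α : Cochain g a) (β : Cochain g b)
    (x : Fin a → g) (y : Fin b → g) : cross α β hk (glue hk x y) = α x * β y := by
  show α (fun p => glue hk x y (inl hk p)) * β (fun p => glue hk x y (inr hk p)) = _
  simp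

theorem ext_glue {a b k : ℕ} (hk : a + b = k) {f f' : Cochain g k}
    (h : ∀ x y, f (glue hk x y) = f' (glue hk x y)) : f = f' := by
  ext v; rw [← glue_parts hk v]; exact h _ _

/-- A form in `a + b` arguments from a function that is multilinear in two blocks of arguments. -/
def biform {a b k : ℕ} (hk : a + b = k) (M : (Fin a → g) → (Fin b → g) → ℝ)
    (hl : ∀ x p z z' y, M (Function.update x p (z + z')) y =
      M (Function.update x p z) y + M (Function.update x p z') y)
    (hl' : ∀ x p (c : ℝ) z y, M (Function.update x p (c • z)) y = c * M (Function.update x p z) y)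
    (hr : ∀ x y p z z', M x (Function.update y p (z + z')) =
      M x (Function.update y p z) + M x (Function.update y p z'))
    (hr' : ∀ x y p (c : ℝ) z, M x (Function.update y p (c • z)) = c * M x (Function.update y p z))
    (hc : Continuous fun p : (Fin a → g) × (Fin b → g) => M p.1 p.2) : Cochain g k where
  toFun v := M (fun p => v (inl hk p)) (fun p => v (inr hk p))
  map_update_add' := by
    intro hd v l z z'
    obtain rfl : hd = instDecidableEqFin _ := Subsingleton.elim _ _
    obtain ⟨x, y, rfl⟩ : ∃ x y, v = glue hk x y := ⟨_, _, (glue_parts hk v).symm⟩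
    rcases inl_or_inr hk l with ⟨p, rfl⟩ | ⟨p, rfl⟩
    · simp only [← glue_update_left, glue_inl, glue_inr, hl]
    · simp only [← glue_update_right, glue_inl, glue_inr, hr]
  map_update_smul' := by
    intro hd v l c z
    obtain rfl : hd = instDecidableEqFin _ := Subsingleton.elim _ _
    obtain ⟨x, y, rfl⟩ : ∃ x y, v = glue hk x y := ⟨_, _, (glue_parts hk v).symm⟩
    rcases inl_or_inr hk l with ⟨p, rfl⟩ | ⟨p, rfl⟩
    · simp only [← glue_update_left, glue_inl, glue_inr, hl', smul_eq_mul]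
    · simp only [← glue_update_right, glue_inl, glue_inr, hr', smul_eq_mul]
  cont := by
    have h : Continuous fun v : Fin k → g => ((fun p => v (inl hk p)), (fun p => v (inr hk p))) :=
      (continuous_pi fun p => continuous_apply _).prodMk (continuous_pi fun p => continuous_apply _)
    exact hc.comp h

theorem biform_glue {a b k : ℕ} (hk : a + b = k) (M : (Fin a → g) → (Fin b → g) → ℝ)
    (hl hl' hr hr' hc) (x : Fin a → g) (y : Fin b → g) :
    biform hk M hl hl' hr hr' hc (glue hk x y) = M x y := by
  show M (fun p => glue hk x y (inl hk p)) (fun p => glue hk x y (inr hk p)) = M x y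
  simp

/-! ### Alternation in the second block -/

theorem skewLast_glue {a b k m : ℕ} (hk : a + b = k) {f : Cochain g k} (hf : f ∈ skewLast g m k)
    (x : Fin a → g) (y : Fin b → g) (p q : Fin b) (hpq : p ≠ q) (hp : b ≤ p + m) (hq : b ≤ q + m)
    (hy : y p = y q) : f (glue hk x y) = 0 :=
  hf _ (inr hk p) (inr hk q) ((inr_injective hk).ne hpq) (by simp; omega) (by simp; omega)
    (by simpa using hy)

/-- As `m ≤ b`, the arguments in question all belong to the second block, and adjacent pairs suffice
by `skew_of_adjacent`. -/
theorem mem_skewLast_iff_glue {a b k m : ℕ} (hk : a + b = k) (hm : m ≤ b) {f : Cochain g k} :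
    f ∈ skewLast g m k ↔ ∀ (x : Fin a → g) (y : Fin b → g) (p q : Fin b), (q : ℕ) = p + 1 →
      b ≤ p + m → y p = y q → f (glue hk x y) = 0 := by
  refine ⟨fun hf x y p q hpq hp hy => skewLast_glue hk hf x y p q
    (fun h => by subst h; omega) hp (by omega) hy, fun h => skew_of_adjacent f m ?_⟩
  intro v i j hij hi hv
  rw [← glue_parts hk v]
  rcases inl_or_inr hk i with ⟨p, rfl⟩ | ⟨p, rfl⟩
  · simp at hi; omega
  rcases inl_or_inr hk j with ⟨q, rfl⟩ | ⟨q, rfl⟩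
  · simp at hij; omega
  exact h _ _ p q (by simp at hij; omega) (by simp at hi; omega) hv

theorem mem_skewLast_iff_sliceR {a b k m : ℕ} (hk : a + b = k) (hm : m ≤ b) {f : Cochain g k} :
    f ∈ skewLast g m k ↔ ∀ x : Fin a → g, sliceR hk f x ∈ skewLast g m b := by
  refine ⟨fun hf x y p q hpq hp hq hy => skewLast_glue hk hf x y p q hpq hp hq hy, fun h => ?_⟩
  rw [mem_skewLast_iff_glue hk hm]
  exact fun x y p q hpq hp hy => h x y p q (fun h => by subst h; omega) hp (by omega) hy

theorem skewLast_anti {m m' : ℕ} (k : ℕ) (h : m ≤ m') : skewLast g m' k ≤ skewLast g m k :=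
  fun _ hf v i j hij hi hj hv => hf v i j hij (by omega) (by omega) hv

theorem skewLast_eq_top {m k : ℕ} (hm : m ≤ 1) : skewLast g m k = ⊤ := by
  refine eq_top_iff.2 fun f _ v i j hij hi hj _ => ?_
  exact absurd (Fin.ext (by omega)) hij

/-- `∑ᵢ α(x₁, …, [xᵢ, z], …, x_a)`. -/
def lieSum {a : ℕ} (α : Cochain g a) (z : g) (x : Fin a → g) : ℝ :=
  ∑ i, α (Function.update x i ⁅x i, z⁆)

variable [IsTopologicalLieAlgebra g]

/-- The coboundary on two blocks of arguments. -/
theorem leibnizD_glue {n q N : ℕ} (hN : n + (q + 1) = N) (hN' : n + 1 + q = N)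
    (hk : n + 1 + (q + 1) = N + 1) (f : Cochain g N) (x : Fin (n + 1) → g) (y : Fin (q + 1) → g) :
    leibnizD N f (glue hk x y) = leibnizD n (sliceL hN f y) x +
      (-1) ^ (n + 1) * (∑ l : Fin (q + 1), (-1) ^ (l : ℕ) *
        lieSum (sliceL hN' f (l.removeNth y)) (y l) x + leibnizD q (sliceR hN' f x) y) := by
  rw [leibnizD_apply, sum_inl_inr hk]
  congr 1
  · rw [leibnizD_apply]
    refine Finset.sum_congr rfl fun j _ => ?_
    rw [sum_inl_inr hN]
    -- No position of the second block precedes a removed argument of the first.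
    rw [Finset.sum_eq_zero (f := fun p => ite ((inr hN p).castSucc < inl hk j) _ _), add_zero]
    · refine Finset.sum_congr rfl fun i _ => ?_
      by_cases h : i.castSucc < j
      · have h' : (inl hN i).castSucc < inl hk j := h
        rw [if_pos h, if_pos h', merge_glue_inl_inl hN hk x y i j]; rfl
      · have h' : ¬ (inl hN i).castSucc < inl hk j := h
        rw [if_neg h, if_neg h']
    · intro p _
      rw [if_neg]
      rw [Fin.lt_def, Fin.val_castSucc, val_inr, val_inl]; omega
  -- The argument `y_l` has position `n + 1 + l`, whence the sign. Its brackets with the `x_i` make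
  -- up the Lie derivative, those with earlier arguments `y_i` the coboundary in the second block.
  · rw [leibnizD_apply, ← Finset.sum_add_distrib, Finset.mul_sum]
    refine Finset.sum_congr rfl fun l _ => ?_
    rw [sum_inl_inr hN', mul_add]
    congr 1
    · rw [lieSum, Finset.mul_sum, Finset.mul_sum]
      refine Finset.sum_congr rfl fun i _ => ?_
      rw [if_pos (by rw [Fin.lt_def, Fin.val_castSucc, val_inr, val_inl]; omega),
        merge_glue_inl_inr hN' hk, val_inr, pow_add, sliceL_apply, mul_assoc]
    · rw [Finset.mul_sum]
      refine Finset.sum_congr rfl fun i _ => ?_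
      have h : (inr hN' i).castSucc < inr hk l ↔ i.castSucc < l := by
        simp only [Fin.lt_def, Fin.val_castSucc, val_inr]; omega
      simp only [h]
      split_ifs
      · rw [merge_glue_inr_inr hN' hk, val_inr, pow_add, sliceR_apply, mul_assoc]
      · simp

end Slices

/-! ### Moving an argument of the second block to its front -/

section Front

variable {g : Type u}

theorem glue_glue_single {a b k : ℕ} (h1 : a + 1 + b = k) (h2 : a + (b + 1) = k) (x : Fin a → g)
    (z : g) (y : Fin b → g) :
    glue h1 (glue (rfl : a + 1 = a + 1) x ![z]) y = glue h2 x (Fin.cons z y) := by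
  refine eq_glue h2 (fun p => ?_) fun p => ?_
  · have : inl h2 p = inl h1 (inl (rfl : a + 1 = a + 1) p) := rfl
    rw [this, glue_inl, glue_inl]
  · refine Fin.cases ?_ (fun p => ?_) p
    · have : inr h2 0 = inl h1 (inr (rfl : a + 1 = a + 1) 0) := Fin.ext (by simp)
      rw [this, glue_inl, glue_inr]; simp
    · have : inr h2 p.succ = inr h1 p := Fin.ext (by simp; omega)
      rw [this, glue_inr]; simp

/-- The permutation moving the argument in position `l` to the front. -/
def toFront {q : ℕ} (l : Fin (q + 1)) : Fin (q + 1) ≃ Fin (q + 1) :=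
  (finSuccEquiv' 0).trans (finSuccEquiv' l).symm

theorem comp_toFront {q : ℕ} (l : Fin (q + 1)) (y : Fin (q + 1) → g) :
    (fun i => y (toFront l i)) = (Fin.cons (y l) (l.removeNth y) : Fin (q + 1) → g) := by
  ext i
  refine Fin.cases ?_ (fun p => ?_) i
  · simp [toFront]
  · have : finSuccEquiv' (0 : Fin (q + 1)) p.succ = some p := by
      rw [← Fin.succAbove_zero_apply, finSuccEquiv'_succAbove]
    simp [toFront, this, Fin.removeNth]

theorem continuous_front [TopologicalSpace g] {q : ℕ} (l : Fin (q + 1)) :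
    Continuous fun y : Fin (q + 1) → g => (Fin.cons (y l) (l.removeNth y) : Fin (q + 1) → g) := by
  simp only [← comp_toFront]
  exact continuous_pi fun i => continuous_apply _

end Front

/-! ### The Lie derivative, the correction of a form, and contractions -/

section Correction

variable {g : Type u} [LieRing g] [LieAlgebra ℝ g] [TopologicalSpace g]

theorem sliceL_sliceL_single {a b k : ℕ} (h1 : a + 1 + b = k) (h2 : a + (b + 1) = k)
    (f : Cochain g k) (z : g) (y : Fin b → g) :
    sliceL rfl (sliceL h1 f y) ![z] = sliceL h2 f (Fin.cons z y) := by
  ext x; simp [glue_glue_single h1 h2]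

theorem sliceL_eq_zero {a b k m : ℕ} (hk : a + b = k) {f : Cochain g k} (hf : f ∈ skewLast g m k)
    (y : Fin b → g) (p q : Fin b) (hpq : p ≠ q) (hp : b ≤ p + m) (hq : b ≤ q + m)
    (hy : y p = y q) : sliceL hk f y = 0 := by
  ext x; exact skewLast_glue hk hf x y p q hpq hp hq hy

theorem skewLast_le {k m : ℕ} : skewLast g k k ≤ skewLast g m k :=
  fun _ hf v i j hij _ _ hv => hf v i j hij (by omega) (by omega) hv

theorem sliceR_update_add {a b k : ℕ} (hk : a + b = k) (f : Cochain g k) (x : Fin a → g)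
    (p : Fin a) (z z' : g) : sliceR hk f (Function.update x p (z + z')) =
      sliceR hk f (Function.update x p z) + sliceR hk f (Function.update x p z') := by
  ext y; simp [glue_update_left]

theorem sliceR_update_smul {a b k : ℕ} (hk : a + b = k) (f : Cochain g k) (x : Fin a → g)
    (p : Fin a) (c : ℝ) (z : g) : sliceR hk f (Function.update x p (c • z)) =
      c • sliceR hk f (Function.update x p z) := by
  ext y; simp [glue_update_left]

variable [IsTopologicalLieAlgebra g]

theorem leibnizD_zero (f : Cochain g 0) : leibnizD 0 f = 0 := by
  ext v; rw [leibnizD_apply]; simp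

/-- The two-block formula for a second block of length one. This is Cartan's formula `ι_z d = d ι_z
± L_z` for insertion in the last position. -/
theorem leibnizD_snoc {n : ℕ} (α : Cochain g (n + 1)) (x : Fin (n + 1) → g) (z : g) :
    leibnizD (n + 1) α (glue rfl x ![z]) =
      leibnizD n (sliceL rfl α ![z]) x + (-1) ^ (n + 1) * lieSum α z x := by
  rw [leibnizD_glue (q := 0) rfl rfl rfl, leibnizD_zero]
  have : ∀ w : Fin 0 → g, sliceL (rfl : n + 1 + 0 = n + 1) α w = α := fun w => by
    ext x; rw [sliceL_apply]; congr 1; ext p; exact glue_inl (rfl : n + 1 + 0 = n + 1) x w p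
  simp [this]

/-- The Lie derivative of a cochain. -/
def lieDeriv {n : ℕ} (α : Cochain g (n + 1)) (z : g) : Cochain g (n + 1) :=
  (-1 : ℝ) ^ (n + 1) • (sliceL rfl (leibnizD (n + 1) α) ![z] - leibnizD n (sliceL rfl α ![z]))

/-- Defining the Lie derivative by Cartan's formula gives its continuity for free and makes it
evident that the Lie derivative of a cocycle is a coboundary. -/
theorem lieDeriv_apply {n : ℕ} (α : Cochain g (n + 1)) (z : g) (x : Fin (n + 1) → g) :
    lieDeriv α z x = lieSum α z x := by
  have h : ((-1 : ℝ) ^ (n + 1)) * (-1) ^ (n + 1) = 1 := by rw [← mul_pow]; simp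
  show (-1 : ℝ) ^ (n + 1) * (leibnizD (n + 1) α (glue rfl x ![z]) -
    leibnizD n (sliceL rfl α ![z]) x) = _
  rw [leibnizD_snoc, add_sub_cancel_left, ← mul_assoc, h, one_mul]

/-- The part of the coboundary that involves only the first block of arguments, as a form in the
second block. -/
def innerD {n b N : ℕ} (hN : n + b = N) (f : Cochain g N) (x : Fin (n + 1) → g) : Cochain g b :=
  ∑ j : Fin (n + 1), ∑ i : Fin n,
    if i.castSucc < j then (-1 : ℝ) ^ (j : ℕ) • sliceR hN f (merge x i j) else 0

theorem innerD_apply {n b N : ℕ} (hN : n + b = N) (f : Cochain g N) (x : Fin (n + 1) → g)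
    (y : Fin b → g) : innerD hN f x y = leibnizD n (sliceL hN f y) x := by
  rw [leibnizD_apply]
  simp only [innerD, sum_apply]
  refine Finset.sum_congr rfl fun j _ => Finset.sum_congr rfl fun i _ => ?_
  split_ifs <;> rfl

/-- On forms that are alternating in their last `q` arguments, the coboundary agrees with the
coboundary in the other arguments but the last `q + 1`, up to forms alternating in the last
`q + 1` arguments. -/
theorem leibnizD_glue_of_eq {n q N : ℕ} (hN : n + (q + 1) = N) (hk : n + 1 + (q + 1) = N + 1)
    {f : Cochain g N} (hf : f ∈ skewLast g q N) (x : Fin (n + 1) → g) (y : Fin (q + 1) → g)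
    (i j : Fin (q + 1)) (hij : i ≠ j) (hy : y i = y j) :
    leibnizD N f (glue hk x y) = leibnizD n (sliceL hN f y) x := by
  have hN' : n + 1 + q = N := by omega
  -- For fixed `x` the difference is a form in `y`, so that adjacent equal arguments suffice. There
  -- the Lie derivatives cancel in pairs, and the coboundary of the alternating form `f(x, ·)`
  -- vanishes.
  have key : sliceR hk (leibnizD N f) x - innerD hN f x ∈ skewLast g (q + 1) (q + 1) := by
    refine skew_of_adjacent _ _ fun y i j hij _ hy => ?_
    show leibnizD N f (glue hk x y) - innerD hN f x y = 0
    rw [innerD_apply, leibnizD_glue hN hN' hk,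
      sum_removeNth_eq_zero (fun z y' => lieSum (sliceL hN' f y') z x) _ y i j hij hy,
      leibnizD_skewLast (q + 1) q _ (skewLast_le
        ((mem_skewLast_iff_sliceR hN' le_rfl).1 hf x)) y i j (fun h => by subst h; omega)
        (by omega) (by omega) hy]
    · ring
    · intro z y' p p' hpp' hy'
      simp [sliceL_eq_zero hN' hf y' p p' hpp' (by omega) (by omega) hy', lieSum]
  have h := key y i j hij (by omega) (by omega) hy
  have h' : leibnizD N f (glue hk x y) - innerD hN f x y = 0 := h
  rw [innerD_apply] at h'
  linarith

/-- Antisymmetrisation of the first argument of the second block with the others. -/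
def spread {q : ℕ} (β : Cochain g (q + 1)) : Cochain g (q + 1) :=
  ∑ l : Fin (q + 1), (-1 : ℝ) ^ (l : ℕ) • β.domDomCongr (toFront l)

theorem spread_apply {q : ℕ} (β : Cochain g (q + 1)) (y : Fin (q + 1) → g) :
    spread β y = ∑ l : Fin (q + 1), (-1 : ℝ) ^ (l : ℕ) * β (Fin.cons (y l) (l.removeNth y)) := by
  simp only [spread, sum_apply]
  refine Finset.sum_congr rfl fun l _ => ?_
  rw [← comp_toFront]; rfl

theorem spread_add {q : ℕ} (β β' : Cochain g (q + 1)) : spread (β + β') = spread β + spread β' := by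
  ext y
  rw [add_apply]
  simp only [spread_apply, ← Finset.sum_add_distrib, add_apply, mul_add]

theorem spread_smul {q : ℕ} (c : ℝ) (β : Cochain g (q + 1)) : spread (c • β) = c • spread β := by
  ext y
  rw [smul_apply]
  simp only [spread_apply, smul_apply, smul_eq_mul, mul_left_comm, Finset.mul_sum]

/-- The correction of a form whose slices in the first block are cocycles. -/
def corr {n q N : ℕ} (hk : n + (q + 1) = N) : Cochain g N →ₗ[ℝ] Cochain g N where
  toFun f := biform hk (fun x y => spread (sliceR hk f x) y)
    (fun x p z z' y => by rw [sliceR_update_add, spread_add]; rfl)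
    (fun x p c z y => by rw [sliceR_update_smul, spread_smul]; rfl)
    (fun x y p z z' => (spread (sliceR hk f x)).map_update_add y p z z')
    (fun x y p c z => (spread (sliceR hk f x)).map_update_smul y p c z)
    (by
      simp only [spread_apply, sliceR_apply]
      refine continuous_finsetSum _ fun l _ => continuous_const.mul (f.cont.comp ?_)
      exact (continuous_glue hk).comp
        (continuous_fst.prodMk ((continuous_front l).comp continuous_snd)))
  map_add' f f' := ext_glue hk fun x y => by
    rw [add_apply, biform_glue, biform_glue, biform_glue]
    exact congrArg (fun h : Cochain g (q + 1) => h y) (spread_add (sliceR hk f x) (sliceR hk f' x))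
  map_smul' c f := ext_glue hk fun x y => by
    rw [RingHom.id_apply, smul_apply, biform_glue, biform_glue]
    exact congrArg (fun h : Cochain g (q + 1) => h y) (spread_smul c (sliceR hk f x))

theorem corr_glue {n q N : ℕ} (hk : n + (q + 1) = N) (f : Cochain g N) (x : Fin n → g)
    (y : Fin (q + 1) → g) : corr hk f (glue hk x y) =
      ∑ l : Fin (q + 1), (-1 : ℝ) ^ (l : ℕ) * f (glue hk x (Fin.cons (y l) (l.removeNth y))) :=
  (biform_glue hk _ _ _ _ _ _ x y).trans (spread_apply _ _)

theorem sliceL_corr {n q N : ℕ} (hk : n + (q + 1) = N) (f : Cochain g N) (y : Fin (q + 1) → g) :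
    sliceL hk (corr hk f) y =
      ∑ l : Fin (q + 1), (-1 : ℝ) ^ (l : ℕ) • sliceL hk f (Fin.cons (y l) (l.removeNth y)) := by
  ext x
  rw [sliceL_apply, corr_glue, sum_apply]
  rfl

/-- The term `l = 0` of the correction is `f` itself. In the other terms the first argument of the
block moves to second place, and their sum is alternating in the remaining `q + 1` arguments. -/
theorem corr_sub_mem {n q N : ℕ} (hk : n + (q + 1 + 1) = N) {f : Cochain g N}
    (hf : f ∈ skewLast g q N) : corr hk f - f ∈ skewLast g (q + 1) N := by
  rw [mem_skewLast_iff_glue hk (by omega)]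
  intro x y i j hij hi hy
  show corr hk f (glue hk x y) - f (glue hk x y) = 0
  rw [corr_glue, Fin.sum_univ_succ]
  obtain ⟨z, y, rfl⟩ : ∃ z y', y = (Fin.cons z y' : Fin (q + 1 + 1) → g) :=
    ⟨_, _, (Fin.cons_self_tail y).symm⟩
  obtain ⟨i, rfl⟩ := Fin.exists_succ_eq.2 (show i ≠ 0 by rintro rfl; simp at hi)
  obtain ⟨j, rfl⟩ := Fin.exists_succ_eq.2 (show j ≠ 0 by rintro rfl; simp at hij)
  have h := sum_removeNth_eq_zero (fun w y' => f (glue hk x (Fin.cons w (Fin.cons z y'))))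
    (fun w y' p p' hpp' hy' => skewLast_glue hk hf x _ p.succ.succ p'.succ.succ
      (by simpa using hpp') (by simp; omega) (by simp; omega) (by simpa using hy'))
    y i j (by simpa using hij) (by simpa using hy)
  have h0 : (Fin.removeNth 0 (Fin.cons z y : Fin (q + 1 + 1) → g)) = y := by
    ext p; simp [Fin.removeNth]
  have h1 : ∀ l : Fin (q + 1), l.succ.removeNth (Fin.cons z y : Fin (q + 1 + 1) → g) =
      (Fin.cons z (l.removeNth y) : Fin (q + 1) → g) := fun l => by
    ext p; refine Fin.cases ?_ (fun p => ?_) p <;> simp [Fin.removeNth]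
  simp only [h1, h0, Fin.cons_succ, Fin.val_succ, pow_succ, Fin.cons_zero, Fin.val_zero, pow_zero]
  simp only [mul_neg, mul_one, neg_mul, Finset.sum_neg_distrib, h]
  simp

/-- By Cartan's formula the Lie derivative of the cocycle `f(·, ŷ_l)` along `y_l` is, up to sign,
the coboundary of `f(·, y_l, ŷ_l)`. The alternating sum of these is the coboundary of `corr f` in
the first block. It cancels against `d (corr f - f)`, computed by `leibnizD_glue_of_eq`, and only
the coboundary in the second block is left. -/
theorem leibnizD_corr {n q N : ℕ} (hN : n + 1 + (q + 1) = N) (hk : n + (q + 1 + 1) = N)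
    (hk' : n + 1 + (q + 1 + 1) = N + 1) {f : Cochain g N} (hf : f ∈ skewLast g q N)
    (hz : ∀ y, leibnizD (n + 1) (sliceL hN f y) = 0) (x : Fin (n + 1) → g)
    (y : Fin (q + 1 + 1) → g) (i j : Fin (q + 1 + 1)) (hij : i ≠ j) (hy : y i = y j) :
    leibnizD N (corr hk f) (glue hk' x y) =
      (-1) ^ (n + 1) * leibnizD (q + 1) (sliceR hN f x) y := by
  have h1 := leibnizD_glue_of_eq hk hk' (corr_sub_mem hk hf) x y i j hij hy
  have h2 := leibnizD_glue hk hN hk' f x y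
  have h3 : ∀ l : Fin (q + 1 + 1), (-1) ^ (n + 1) * lieSum (sliceL hN f (l.removeNth y)) (y l) x =
      - leibnizD n (sliceL hk f (Fin.cons (y l) (l.removeNth y))) x := fun l => by
    have h := leibnizD_snoc (sliceL hN f (l.removeNth y)) x (y l)
    rw [hz, sliceL_sliceL_single hN hk, zero_apply] at h
    linarith
  have h4 : leibnizD n (sliceL hk (corr hk f) y) x = ∑ l : Fin (q + 1 + 1), (-1) ^ (l : ℕ) *
      leibnizD n (sliceL hk f (Fin.cons (y l) (l.removeNth y))) x := by
    rw [sliceL_corr, map_sum, sum_apply]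
    refine Finset.sum_congr rfl fun l _ => ?_
    rw [map_smul]; rfl
  rw [map_sub, sliceL_sub, map_sub] at h1
  simp only [sub_apply] at h1
  rw [mul_add, Finset.mul_sum] at h2
  simp only [mul_left_comm ((-1 : ℝ) ^ (n + 1)), h3, mul_neg, Finset.sum_neg_distrib] at h2
  rw [h4] at h1
  linarith

/-- Contraction of the first block with a functional vanishing on coboundaries commutes with the
coboundary, up to sign and alternating forms. -/
theorem contract_leibnizD {n q N : ℕ} (hN : n + 1 + (q + 1) = N)
    (hk' : n + 1 + (q + 1 + 1) = N + 1) {f : Cochain g N} (hf : f ∈ skewLast g q N)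
    (hdf : leibnizD N f ∈ skewLast g (q + 1) (N + 1))
    (t : Cochain g (n + 1) →ₗ[ℝ] ℝ) (ht : ∀ α, t (leibnizD n α) = 0)
    (c : Cochain g (q + 1)) (hc : ∀ y, c y = t (sliceL hN f y))
    (y : Fin (q + 1 + 1) → g) (i j : Fin (q + 1 + 1)) (hij : (j : ℕ) = i + 1) (hy : y i = y j) :
    t (sliceL hk' (leibnizD N f) y) = (-1) ^ (n + 1) * leibnizD (q + 1) c y := by
  have hk : n + (q + 1 + 1) = N := by omega
  have hk2 : n + 1 + 1 + (q + 1) = N + 1 := by omega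
  -- The two-block formula as an identity of cochains in the first block, to which `t` can be
  -- applied.
  have h1 : sliceL hk' (leibnizD N f) y = leibnizD n (sliceL hk f y) + (-1 : ℝ) ^ (n + 1) •
      (∑ l : Fin (q + 1 + 1), (-1 : ℝ) ^ (l : ℕ) • lieDeriv (sliceL hN f (l.removeNth y)) (y l) +
        ∑ j : Fin (q + 1 + 1), ∑ i : Fin (q + 1), if i.castSucc < j then
          (-1 : ℝ) ^ (j : ℕ) • sliceL hN f (merge y i j) else 0) := by
    ext x
    rw [sliceL_apply, leibnizD_glue hk hN hk', leibnizD_apply (sliceR hN f x), add_apply,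
      smul_apply, add_apply, sum_apply, sum_apply, smul_eq_mul]
    congr 3
    · refine Finset.sum_congr rfl fun l _ => ?_
      rw [smul_apply, lieDeriv_apply, smul_eq_mul]
    · refine Finset.sum_congr rfl fun j _ => ?_
      rw [sum_apply]
      refine Finset.sum_congr rfl fun i _ => ?_
      split_ifs <;> rfl
  -- If two arguments `y'` agree, then `f(·, y')` is a cocycle, because `d f` vanishes there; its
  -- Lie derivatives are coboundaries, which `t` kills.
  have h2 := sum_removeNth_eq_zero (fun z y' => t (lieDeriv (sliceL hN f y') z)) (by
    intro z y' p p' hpp' hy'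
    have h0 : leibnizD (n + 1) (sliceL hN f y') = 0 := by
      ext x
      rw [← leibnizD_glue_of_eq hN hk2 hf x y' p p' hpp' hy']
      exact skewLast_glue hk2 hdf x y' p p' hpp' (by omega) (by omega) hy'
    show t (lieDeriv (sliceL hN f y') z) = 0
    have h00 : sliceL (rfl : n + 1 + 1 = n + 1 + 1) (0 : Cochain g (n + 1 + 1)) ![z] = 0 := rfl
    rw [lieDeriv, h0, h00, zero_sub, map_smul, map_neg, ht, neg_zero, smul_zero]) y i j hij hy
  rw [h1, map_add, ht, zero_add, map_smul, map_add, map_sum, smul_eq_mul]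
  simp only [map_smul, smul_eq_mul, h2, zero_add]
  congr 1
  rw [leibnizD_apply, map_sum]
  refine Finset.sum_congr rfl fun j _ => ?_
  rw [map_sum]
  refine Finset.sum_congr rfl fun i _ => ?_
  split_ifs
  · rw [map_smul, hc]; rfl
  · simp

end Correction

/-! ### The Leibniz coboundary squares to zero -/

section Square

variable {g : Type u} [LieRing g] [LieAlgebra ℝ g] [TopologicalSpace g]

/-- Insertion of a vector in the last position. -/
def ins {n : ℕ} (α : Cochain g (n + 1)) (z : g) : Cochain g n := sliceL rfl α ![z]

theorem ext_ins {n : ℕ} {α β : Cochain g (n + 1)} (h : ∀ z, ins α z = ins β z) : α = β := by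
  refine ext_glue (rfl : n + 1 = n + 1) fun x y => ?_
  have : y = ![y 0] := by ext p; simp [Subsingleton.elim p 0]
  rw [this]
  exact congrArg (fun f : Cochain g n => f x) (h (y 0))

theorem ins_add {n : ℕ} (α β : Cochain g (n + 1)) (z : g) : ins (α + β) z = ins α z + ins β z := rfl

theorem ins_vec_sub {n : ℕ} (α : Cochain g (n + 1)) (z w : g) :
    ins α (z - w) = ins α z - ins α w := by
  have h : ∀ z, ![z] = Function.update ![(0 : g)] 0 z := fun z => by
    ext p; simp [Subsingleton.elim p 0]
  have h2 := sliceL_update_add (rfl : n + 1 = n + 1) α ![0] 0 (z - w) w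
  rw [sub_add_cancel, ← h, ← h, ← h] at h2
  exact eq_sub_of_add_eq h2.symm

variable [IsTopologicalLieAlgebra g]

/-- The Lie derivative in all degrees. -/
def lieD : ∀ n : ℕ, g → Cochain g n → Cochain g n
  | 0, _, _ => 0
  | _ + 1, z, α => lieDeriv α z

theorem lieD_apply {n : ℕ} (z : g) (α : Cochain g n) (x : Fin n → g) :
    lieD n z α x = lieSum α z x := by
  cases n with
  | zero => simp [lieD, lieSum]
  | succ n => exact lieDeriv_apply α z x

theorem lieD_add {n : ℕ} (z : g) (α β : Cochain g n) :
    lieD n z (α + β) = lieD n z α + lieD n z β := by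
  ext x
  rw [add_apply]
  simp only [lieD_apply, lieSum, add_apply, Finset.sum_add_distrib]

theorem lieD_smul {n : ℕ} (z : g) (c : ℝ) (α : Cochain g n) :
    lieD n z (c • α) = c • lieD n z α := by
  ext x
  rw [smul_apply]
  simp only [lieD_apply, lieSum, smul_apply, smul_eq_mul, Finset.mul_sum]

theorem ins_lieD {n : ℕ} (α : Cochain g (n + 1)) (z w : g) :
    ins (lieD (n + 1) z α) w = lieD n z (ins α w) + ins α ⁅w, z⁆ := by
  ext x
  show lieD (n + 1) z α (glue rfl x ![w]) = lieD n z (ins α w) x + ins α ⁅w, z⁆ x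
  rw [lieD_apply, lieD_apply, lieSum, sum_inl_inr (rfl : n + 1 = n + 1), lieSum]
  simp only [← glue_update_left, ← glue_update_right, glue_inl, glue_inr]
  congr 1
  rw [Fin.sum_univ_one]
  show α _ = α _
  congr 2
  ext p; simp [Subsingleton.elim p 0]

theorem ins_leibnizD {n : ℕ} (α : Cochain g (n + 1)) (z : g) :
    ins (leibnizD (n + 1) α) z =
      leibnizD n (ins α z) + (-1 : ℝ) ^ (n + 1) • lieD (n + 1) z α := by
  ext x
  show leibnizD (n + 1) α (glue rfl x ![z]) = leibnizD n (ins α z) x +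
    (-1 : ℝ) ^ (n + 1) * lieD (n + 1) z α x
  rw [leibnizD_snoc, lieD_apply]; rfl

/-- Induction on the degree: inserting a last argument `v` reduces the claim to `ins α v`, and the
remaining insertions match by the Jacobi identity for `⁅v, ⁅w, z⁆⁆`. -/
theorem lieD_lieD {n : ℕ} (w z : g) (α : Cochain g n) :
    lieD n w (lieD n z α) = lieD n z (lieD n w α) + lieD n ⁅w, z⁆ α := by
  induction n with
  | zero => simp [lieD]
  | succ n ih =>
    refine ext_ins fun v => ?_
    have h : ⁅v, ⁅w, z⁆⁆ = ⁅⁅v, w⁆, z⁆ - ⁅⁅v, z⁆, w⁆ := by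
      rw [leibniz_lie, ← lie_skew w ⁅v, z⁆]; abel
    rw [ins_add]
    simp only [ins_lieD, lieD_add, h, ins_vec_sub, ih (ins α v)]
    abel

/-- Induction on the degree through Cartan's formula; the commutator of two Lie derivatives accounts
for the term with `⁅w, z⁆`. -/
theorem leibnizD_lieD {n : ℕ} (z : g) (α : Cochain g n) :
    leibnizD n (lieD n z α) = lieD (n + 1) z (leibnizD n α) := by
  induction n with
  | zero =>
    rw [leibnizD_zero, leibnizD_zero]
    ext x; rw [lieD_apply]; simp [lieSum]
  | succ n ih =>
    refine ext_ins fun w => ?_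
    rw [ins_leibnizD, ins_lieD, ins_lieD, ins_leibnizD, ins_leibnizD, lieD_add, lieD_smul,
      lieD_lieD w z, map_add, ih, smul_add]
    abel

/-- As `L_w` commutes with `d`, the two Lie derivative terms of Cartan's formula have opposite
signs, so that `ι_w d d = d d ι_w`, and induction on the degree applies. -/
theorem leibnizD_leibnizD {n : ℕ} (α : Cochain g n) : leibnizD (n + 1) (leibnizD n α) = 0 := by
  induction n with
  | zero => rw [leibnizD_zero, map_zero]
  | succ n ih =>
    refine ext_ins fun w => ?_
    rw [ins_leibnizD, ins_leibnizD, map_add, ih, map_smul, leibnizD_lieD, zero_add]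
    ext x
    show (-1 : ℝ) ^ (n + 1) * lieD (n + 2) w (leibnizD (n + 1) α) x +
      (-1) ^ (n + 1 + 1) * lieD (n + 2) w (leibnizD (n + 1) α) x = 0
    ring

end Square

/-! ### Representing the second page and `HR` by multilinear forms -/

section Representatives

variable {g : Type u} [LieRing g] [LieAlgebra ℝ g] [TopologicalSpace g]

theorem mem_range_incl {m : ℕ} {f : Cochain g (m + 1)} :
    f ∈ LinearMap.range (incl (g := g) m) ↔ f ∈ skewLast g m (m + 1) :=
  ⟨by rintro ⟨β, rfl⟩; exact incl_mem_skewLast m β, fun h => ⟨ofSkew m f h, incl_ofSkew m f h⟩⟩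

theorem mem_range_var {m : ℕ} {β : CoadCochain g m} :
    β ∈ LinearMap.range (var (g := g) m) ↔ incl m β ∈ skewLast g (m + 1) (m + 1) := by
  constructor
  · rintro ⟨α, rfl⟩
    exact (incl_ofSkew m _ (alt_mem_skewLast _ _ α)).symm ▸ alt_mem_skewLast _ _ α
  · intro h
    refine ⟨{ incl m β with
      map_eq_zero_of_eq' := fun v a b hv hab => h v a b hab (by omega) (by omega) hv },
      incl_injective m ?_⟩
    exact incl_ofSkew m _ (incl_mem_skewLast m β)

/-- Forms that are alternating in all arguments but the first, as cochains with coefficients in the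
continuous dual. -/
def ofSkewL (m : ℕ) : skewLast g m (m + 1) →ₗ[ℝ] CoadCochain g m where
  toFun f := ofSkew m f.1 f.2
  map_add' f f' := by
    apply incl_injective; rw [map_add]; simp only [incl_ofSkew]; rfl
  map_smul' c f := by
    apply incl_injective; rw [RingHom.id_apply, map_smul]; simp only [incl_ofSkew]; rfl

theorem incl_ofSkewL (m : ℕ) (f : skewLast g m (m + 1)) : incl m (ofSkewL m f) = f.1 :=
  incl_ofSkew m f.1 f.2

theorem ofSkewL_incl (m : ℕ) (β : CoadCochain g m) :
    ofSkewL m ⟨incl m β, incl_mem_skewLast m β⟩ = β :=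
  incl_injective m (incl_ofSkewL m _)

theorem mk_CR_eq_zero {n : ℕ} {β : CoadCochain g (n + 1)} :
    CR.mk g n β = 0 ↔ incl (n + 1) β ∈ skewLast g (n + 2) (n + 2) :=
  (Submodule.Quotient.mk_eq_zero _).trans mem_range_var

theorem mk_CRG_eq_zero {n : ℕ} {f : Cochain g (n + 2)} :
    CRG.mk g n f = 0 ↔ f ∈ skewLast g (n + 1) (n + 2) :=
  (Submodule.Quotient.mk_eq_zero _).trans mem_range_incl

theorem mk_CRG_surjective (n : ℕ) : Function.Surjective (CRG.mk g n) :=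
  Submodule.mkQ_surjective _

theorem mk_CR_surjective (n : ℕ) : Function.Surjective (CR.mk g n) :=
  Submodule.mkQ_surjective _

variable [IsTopologicalLieAlgebra g]

theorem rgD_mk {n : ℕ} (f : Cochain g (n + 2)) :
    rgD g n (CRG.mk g n f) = CRG.mk g (n + 1) (leibnizD (n + 2) f) := rfl

theorem crD_mk {n : ℕ} (β : CoadCochain g (n + 1)) :
    crD g n (CR.mk g n β) = CR.mk g (n + 1) (coadD (n + 1) β) := rfl

theorem rgD_rgD (n : ℕ) (x : CRG g n) : rgD g (n + 1) (rgD g n x) = 0 := by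
  obtain ⟨f, rfl⟩ := mk_CRG_surjective n x
  rw [rgD_mk, rgD_mk, leibnizD_leibnizD, map_zero]

/-- A class determines its form up to forms alternating in the last `n + 1` arguments; for `s ≤ n`
these are alternating in the last `s + 1`. -/
theorem mk_mem_rgFiltration {s n : ℕ} (h : s ≤ n) {f : Cochain g (n + 2)} :
    CRG.mk g n f ∈ rgFiltration g s n ↔ f ∈ skewLast g (s + 1) (n + 2) := by
  refine ⟨?_, fun hf => ⟨f, hf, rfl⟩⟩
  rintro ⟨f', hf', h'⟩
  have h0 : CRG.mk g n (f - f') = 0 := by rw [map_sub, h', sub_self]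
  have := skewLast_anti (n + 2) (show s + 1 ≤ n + 1 by omega) (mk_CRG_eq_zero.1 h0)
  simpa using add_mem this hf'

/-- Representatives of elements of the second page. -/
def pageReps (g : Type u) [LieRing g] [LieAlgebra ℝ g] [TopologicalSpace g]
    [IsTopologicalLieAlgebra g] (s m : ℕ) : Submodule ℝ (Cochain g (m + 2)) :=
  skewLast g (s + 1) (m + 2) ⊓ (skewLast g (s + 3) (m + 3)).comap (leibnizD (m + 2))

/-- The bound `s + 1 ≤ m`, that is `n ≥ 1`, ensures that neither `F^s` in degree `m` nor `F^{s+2}`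
in degree `m + 1` depends on the choice of representatives. -/
theorem mk_mem_pageCycles {s m : ℕ} (h : s + 1 ≤ m) {f : Cochain g (m + 2)} :
    CRG.mk g m f ∈ pageCycles (rgD g) (rgFiltration g) 2 s m ↔ f ∈ pageReps g s m := by
  rw [pageCycles, Submodule.mem_inf, Submodule.mem_comap, rgD_mk,
    mk_mem_rgFiltration (by omega), mk_mem_rgFiltration (by omega)]
  rfl

/-- The class on the second page of a representative. -/
def toPage {s m : ℕ} (h : s + 1 ≤ m) :
    pageReps g s m →ₗ[ℝ] Page (rgD g) (rgFiltration g) 2 s m :=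
  (Page.mk (rgD g) (rgFiltration g) 2 s m).comp
    ((CRG.mk g m).restrict fun _ hf => (mk_mem_pageCycles h).2 hf)

theorem toPage_apply {s m : ℕ} (h : s + 1 ≤ m) (f : pageReps g s m) :
    toPage h f = Page.mk (rgD g) (rgFiltration g) 2 s m
      ⟨CRG.mk g m f.1, (mk_mem_pageCycles h).2 f.2⟩ := rfl

theorem toPage_surjective {s m : ℕ} (h : s + 1 ≤ m) : Function.Surjective (toPage (g := g) h) := by
  intro x
  obtain ⟨⟨x, hx⟩, rfl⟩ := Submodule.mkQ_surjective _ x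
  obtain ⟨f, rfl⟩ := mk_CRG_surjective m x
  exact ⟨⟨f, (mk_mem_pageCycles h).1 hx⟩, rfl⟩

/-- On page `2` boundaries come from `F^{s-1}`, represented by forms alternating in the last `s`
arguments. That `d y` lies in `F^s` need not be required, since `f` and `f - d y` do. -/
theorem toPage_eq_zero {s m : ℕ} (h : s + 1 ≤ m) (f : pageReps g s m) :
    toPage h f = 0 ↔ ∃ y ∈ skewLast g s (m + 1),
      f.1 - leibnizD (m + 1) y ∈ skewLast g (s + 2) (m + 2) := by
  obtain ⟨m, rfl⟩ : ∃ m', m = m' + 1 := ⟨m - 1, by omega⟩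
  rw [toPage_apply]
  refine (Submodule.Quotient.mk_eq_zero _).trans ?_
  change CRG.mk g (m + 1) f.1 ∈ pageBoundaries (rgD g) (rgFiltration g) 2 s (m + 1) ↔ _
  constructor
  · intro hx
    obtain ⟨u, ⟨-, hu⟩, w, ⟨-, hw⟩, huw⟩ := Submodule.mem_sup.1 hx
    obtain ⟨_, ⟨y, hy, rfl⟩, rfl⟩ := hw
    refine ⟨y, skewLast_anti _ (show s ≤ s + 1 - 2 + 1 by omega) hy, ?_⟩
    rw [← mk_mem_rgFiltration (by omega), map_sub, ← rgD_mk]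
    have : u = CRG.mk g (m + 1) f.1 - rgD g m (CRG.mk g m y) := eq_sub_of_add_eq huw
    rwa [← this]
  · rintro ⟨y, hy, hfy⟩
    -- For `s = 0` the truncated index demands alternation in one argument, which is no condition at
    -- all.
    have hy' : y ∈ skewLast g (s + 1 - 2 + 1) (m + 1 + 1) := by
      rcases Nat.eq_zero_or_pos s with rfl | hs
      · rw [skewLast_eq_top (by omega)]; trivial
      · rwa [show s + 1 - 2 + 1 = s by omega]
    have h1 : CRG.mk g (m + 1) (f.1 - leibnizD (m + 1 + 1) y) ∈
        rgFiltration g (s + 1) (m + 1) := (mk_mem_rgFiltration (by omega)).2 hfy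
    have h1' : CRG.mk g (m + 1) (f.1 - leibnizD (m + 1 + 1) y) ∈
        rgFiltration g s (m + 1) :=
      (mk_mem_rgFiltration (by omega)).2 (skewLast_anti _ (by omega) hfy)
    have h2 : rgD g (m + 1) (CRG.mk g (m + 1) (f.1 - leibnizD (m + 1 + 1) y)) =
        rgD g (m + 1) (CRG.mk g (m + 1) f.1) := by
      rw [map_sub, map_sub, ← rgD_mk, rgD_rgD, sub_zero]
    have hf := (mk_mem_pageCycles h).2 f.2
    have e : CRG.mk g (m + 1) f.1 = CRG.mk g (m + 1) (f.1 - leibnizD (m + 1 + 1) y) +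
        rgD g m (CRG.mk g m y) := by rw [rgD_mk, map_sub, sub_add_cancel]
    show CRG.mk g (m + 1) f.1 ∈ _
    rw [e]
    refine Submodule.add_mem_sup ⟨⟨h1', ?_⟩, h1⟩ ⟨?_, ⟨_, ⟨y, hy', rfl⟩, rfl⟩⟩
    · show rgD g (m + 1) _ ∈ rgFiltration g (s + 2) (m + 1 + 1)
      rw [h2]; exact hf.2
    · rw [← sub_eq_of_eq_add' e]
      exact sub_mem hf.1 h1'

/-- Representatives of elements of `HR^s(g)`. -/
def hrReps (g : Type u) [LieRing g] [LieAlgebra ℝ g] [TopologicalSpace g]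
    [IsTopologicalLieAlgebra g] (s : ℕ) : Submodule ℝ (Cochain g (s + 2)) :=
  skewLast g (s + 1) (s + 2) ⊓ (skewLast g (s + 3) (s + 3)).comap (leibnizD (s + 2))

theorem mk_mem_cocycles_crD {s : ℕ} {γ : CoadCochain g (s + 1)} :
    CR.mk g s γ ∈ Cocycles (crD g) s ↔ incl (s + 1) γ ∈ hrReps g s := by
  rw [LinearMap.mem_ker, crD_mk, mk_CR_eq_zero, ← leibnizD_comp_incl]
  exact ⟨fun h => ⟨incl_mem_skewLast _ _, h⟩, fun h => h.2⟩

/-- The class in `HR^s(g)` of a representative. -/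
def toHR (g : Type u) [LieRing g] [LieAlgebra ℝ g] [TopologicalSpace g]
    [IsTopologicalLieAlgebra g] (s : ℕ) : hrReps g s →ₗ[ℝ] HR g s :=
  (Cohomology.mk (crD g) s).comp
    ((((CR.mk g s).comp (ofSkewL (s + 1))).comp (Submodule.inclusion inf_le_left)).codRestrict
      (Cocycles (crD g) s) fun β => mk_mem_cocycles_crD.2 (by rw [incl_ofSkewL]; exact β.2))

theorem toHR_incl {s : ℕ} (γ : CoadCochain g (s + 1)) (h : CR.mk g s γ ∈ Cocycles (crD g) s) :
    toHR g s ⟨incl (s + 1) γ, mk_mem_cocycles_crD.1 h⟩ =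
      Cohomology.mk (crD g) s ⟨CR.mk g s γ, h⟩ :=
  congrArg (Cohomology.mk (crD g) s) (Subtype.ext (congrArg (CR.mk g s) (ofSkewL_incl _ γ)))

theorem exists_incl {s : ℕ} (β : hrReps g s) :
    ∃ (γ : CoadCochain g (s + 1)) (h : CR.mk g s γ ∈ Cocycles (crD g) s),
      β = ⟨incl (s + 1) γ, mk_mem_cocycles_crD.1 h⟩ := by
  obtain ⟨γ, hγ⟩ := mem_range_incl.2 β.2.1
  exact ⟨γ, mk_mem_cocycles_crD.2 (hγ ▸ β.2), Subtype.ext hγ.symm⟩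

theorem toHR_surjective (s : ℕ) : Function.Surjective (toHR g s) := by
  intro x
  obtain ⟨⟨x, hx⟩, rfl⟩ := Submodule.mkQ_surjective _ x
  obtain ⟨γ, rfl⟩ := mk_CR_surjective s x
  exact ⟨_, toHR_incl γ hx⟩

/-- There are no coboundaries in `HR^0`. The description of zero classes in `toHR_eq_zero` allows
for a term `d y` nevertheless, which is harmless for `s = 0` because it is alternating. -/
theorem leibnizD_mem_skewLast_two (y : Cochain g 1) : leibnizD 1 y ∈ skewLast g 2 2 :=
  leibnizD_skewLast 2 1 y (skewLast_le (by rw [skewLast_eq_top le_rfl]; trivial))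

/-- The same shape as `toPage_eq_zero`, so that contraction in the first block carries one condition
to the other. -/
theorem toHR_eq_zero {s : ℕ} (β : hrReps g s) :
    toHR g s β = 0 ↔ ∃ y ∈ skewLast g s (s + 1),
      β.1 - leibnizD (s + 1) y ∈ skewLast g (s + 2) (s + 2) := by
  obtain ⟨γ, hγ, rfl⟩ := exists_incl β
  rw [toHR_incl γ hγ]
  refine (Submodule.Quotient.mk_eq_zero _).trans ?_
  change CR.mk g s γ ∈ dImage (crD g) (fun _ => ⊤) s ↔ _
  cases s with
  | zero =>
    show CR.mk g 0 γ ∈ (⊥ : Submodule ℝ _) ↔ _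
    rw [Submodule.mem_bot, mk_CR_eq_zero]
    refine ⟨fun h => ⟨0, zero_mem _, by simpa using h⟩, ?_⟩
    rintro ⟨y, -, h⟩
    simpa using add_mem h (leibnizD_mem_skewLast_two y)
  | succ s =>
    constructor
    · rintro ⟨x, -, hx⟩
      obtain ⟨γ', rfl⟩ := mk_CR_surjective s x
      refine ⟨incl (s + 1) γ', incl_mem_skewLast _ _, ?_⟩
      rw [leibnizD_comp_incl, ← map_sub]
      refine mk_CR_eq_zero.1 ?_
      rw [map_sub, ← crD_mk, hx]
      exact sub_self _
    · rintro ⟨y, hy, h⟩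
      obtain ⟨γ', rfl⟩ := mem_range_incl.2 hy
      rw [leibnizD_comp_incl, ← map_sub] at h
      have h' := mk_CR_eq_zero.2 h
      rw [map_sub, ← crD_mk, sub_eq_zero] at h'
      exact ⟨_, trivial, h'.symm⟩

end Representatives

/-! ### Forms whose slices are cocycles -/

section Normal

variable {g : Type u} [LieRing g] [LieAlgebra ℝ g] [TopologicalSpace g] [IsTopologicalLieAlgebra g]

/-- Forms whose slices are Leibniz cocycles in the first block of arguments, and representatives of
elements of `HR^s(g)` in the second. -/
def biCocycles {n s k : ℕ} (hN : n + 1 + (s + 2) = k) : Submodule ℝ (Cochain g k) where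
  carrier := {f | (∀ y, leibnizD (n + 1) (sliceL hN f y) = 0) ∧ ∀ x, sliceR hN f x ∈ hrReps g s}
  add_mem' hf hf' := ⟨fun y => by rw [sliceL_add, map_add, hf.1, hf'.1, add_zero],
    fun x => add_mem (hf.2 x) (hf'.2 x)⟩
  zero_mem' := ⟨fun y => map_zero _, fun x => zero_mem _⟩
  smul_mem' c f hf := ⟨fun y => by rw [sliceL_smul, map_smul, hf.1, smul_zero],
    fun x => Submodule.smul_mem _ c (hf.2 x)⟩

theorem biCocycles_skew {n s k : ℕ} (hN : n + 1 + (s + 2) = k) {f : Cochain g k}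
    (hf : f ∈ biCocycles hN) : f ∈ skewLast g (s + 1) k :=
  (mem_skewLast_iff_sliceR hN (by omega)).2 fun x => (hf.2 x).1

/-- The correction changes `f` only by an element of `F^{s+1}`. By `leibnizD_corr`, alternation of
its coboundary in the last `s + 3` arguments is inherited from the coboundaries of the slices `f(x,
·)`. -/
theorem corr_mem_pageReps {n s m : ℕ} (hN : n + 1 + (s + 2) = m + 2) (hk : n + (s + 3) = m + 2)
    {f : Cochain g (m + 2)} (hf : f ∈ biCocycles hN) : corr hk f ∈ pageReps g s m := by
  have hs := biCocycles_skew hN hf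
  constructor
  · simpa using add_mem (skewLast_anti _ (by omega) (corr_sub_mem hk hs)) hs
  · have hk' : n + 1 + (s + 3) = m + 3 := by omega
    refine (mem_skewLast_iff_glue hk' le_rfl).2 fun x y i j hij hi hy => ?_
    have hne : i ≠ j := fun h => by subst h; omega
    rw [leibnizD_corr hN hk hk' hs hf.1 x y i j hne hy,
      (hf.2 x).2 y i j hne (by omega) (by omega) hy, mul_zero]

/-- The class on the second page of the correction of a form whose slices are cocycles. -/
def biClass {n s m : ℕ} (hN : n + 1 + (s + 2) = m + 2) :
    biCocycles (g := g) hN →ₗ[ℝ] Page (rgD g) (rgFiltration g) 2 s m :=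
  (toPage (show s + 1 ≤ m by omega)).comp
    ((corr (show n + (s + 3) = m + 2 by omega)).restrict fun _ hf => corr_mem_pageReps hN _ hf)

theorem biClass_apply {n s m : ℕ} (hN : n + 1 + (s + 2) = m + 2) (f : biCocycles (g := g) hN) :
    biClass hN f = toPage (show s + 1 ≤ m by omega)
      ⟨corr (show n + (s + 3) = m + 2 by omega) f.1, corr_mem_pageReps hN _ f.2⟩ := rfl

/-- The correction may be dropped here, since `corr f - f` is alternating in the last `s + 2`
arguments. -/
theorem biClass_eq_zero {n s m : ℕ} (hN : n + 1 + (s + 2) = m + 2) (f : biCocycles (g := g) hN) :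
    biClass hN f = 0 ↔ ∃ y ∈ skewLast g s (m + 1),
      f.1 - leibnizD (m + 1) y ∈ skewLast g (s + 2) (m + 2) := by
  have h := corr_sub_mem (show n + (s + 3) = m + 2 by omega) (biCocycles_skew hN f.2)
  rw [biClass_apply, toPage_eq_zero]
  refine exists_congr fun y => and_congr_right fun _ => ?_
  constructor
  · intro h'; simpa using sub_mem h' h
  · intro h'; simpa using add_mem h' h

theorem toPage_eq_biClass {n s m : ℕ} (hN : n + 1 + (s + 2) = m + 2) (h : s + 1 ≤ m)
    (f : pageReps g s m) (f₀ : biCocycles (g := g) hN) (k : Cochain g (m + 1))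
    (hk : k ∈ skewLast g s (m + 1))
    (hf : f.1 - leibnizD (m + 1) k - f₀.1 ∈ skewLast g (s + 2) (m + 2)) :
    toPage h f = biClass hN f₀ := by
  have h' := corr_sub_mem (show n + (s + 3) = m + 2 by omega) (biCocycles_skew hN f₀.2)
  rw [← sub_eq_zero, biClass_apply, ← map_sub, toPage_eq_zero]
  refine ⟨k, hk, ?_⟩
  have e := sub_mem hf h'
  rw [show f.1 - leibnizD (m + 1) k - f₀.1 -
    (corr (show n + (s + 3) = m + 2 by omega) f₀.1 - f₀.1) =
      f.1 - corr (show n + (s + 3) = m + 2 by omega) f₀.1 - leibnizD (m + 1) k by abel] at e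
  exact e

/-- The classes of `d`-images in the first and in the second block of arguments vanish. -/
theorem biClass_eq_zero_of_left {n s m : ℕ} (hN : n + 1 + (s + 2) = m + 2)
    (hM : n + (s + 2) = m + 1) (f : biCocycles (g := g) hN) (y : Cochain g (m + 1))
    (hy : y ∈ skewLast g (s + 1) (m + 1))
    (h : ∀ z, sliceL hN f.1 z = leibnizD n (sliceL hM y z)) : biClass hN f = 0 := by
  refine (biClass_eq_zero hN f).2 ⟨y, skewLast_anti _ (by omega) hy,
    (mem_skewLast_iff_glue hN (by omega)).2 fun x z i j hij hi hz => ?_⟩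
  show f.1 (glue hN x z) - leibnizD (m + 1) y (glue hN x z) = 0
  rw [leibnizD_glue_of_eq hM hN hy x z i j (fun h => by subst h; omega) hz, ← h, sliceL_apply,
    sub_self]

/-- A primitive in the second block has to be corrected as well before it serves as a primitive of
the whole form; the sign is that of `leibnizD_corr`. -/
theorem biClass_eq_zero_of_right {n s m : ℕ} (hN : n + 1 + (s + 2) = m + 2)
    (hM : n + 1 + (s + 1) = m + 1) (f : biCocycles (g := g) hN) (Y : Cochain g (m + 1))
    (hY : Y ∈ skewLast g s (m + 1)) (hz : ∀ y, leibnizD (n + 1) (sliceL hM Y y) = 0)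
    (h : ∀ x, sliceR hN f.1 x - leibnizD (s + 1) (sliceR hM Y x) ∈ skewLast g (s + 2) (s + 2)) :
    biClass hN f = 0 := by
  have hk : n + (s + 1 + 1) = m + 1 := by omega
  have hc : corr hk Y ∈ skewLast g s (m + 1) := by
    simpa using add_mem (skewLast_anti _ (by omega) (corr_sub_mem hk hY)) hY
  refine (biClass_eq_zero hN f).2 ⟨(-1 : ℝ) ^ (n + 1) • corr hk Y, Submodule.smul_mem _ _ hc,
    (mem_skewLast_iff_glue hN le_rfl).2 fun x y i j hij hi hy => ?_⟩
  have hne : i ≠ j := fun h => by subst h; omega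
  have h1 := h x y i j hne (by omega) (by omega) hy
  have h2 : ((-1 : ℝ) ^ (n + 1)) * (-1) ^ (n + 1) = 1 := by rw [← mul_pow]; simp
  rw [map_smul]
  show f.1 (glue hN x y) - (-1 : ℝ) ^ (n + 1) * leibnizD (m + 1) (corr hk Y) (glue hN x y) = 0
  rw [leibnizD_corr hM hk hN hY hz x y i j hne hy, ← mul_assoc, h2, one_mul]
  exact h1

/-! ### Operators on the first block of arguments -/

/-- Linear operators on cochains, applied to the first arguments of a continuous form, yield
continuous forms. -/
def LeftContinuous (g : Type u) [LieRing g] [LieAlgebra ℝ g] [TopologicalSpace g] : Prop :=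
  ∀ (a b c k : ℕ) (hk : a + b = k) (L : Cochain g a →ₗ[ℝ] Cochain g c) (f : Cochain g k),
    Continuous fun p : (Fin c → g) × (Fin b → g) => L (sliceL hk f p.2) p.1

/-- The operator `L` applied to the first block of arguments. -/
def leftOp (hg : LeftContinuous g) {a b c k k' : ℕ} (hk : a + b = k) (hk' : c + b = k')
    (L : Cochain g a →ₗ[ℝ] Cochain g c) (f : Cochain g k) : Cochain g k' :=
  biform hk' (fun x y => L (sliceL hk f y) x)
    (fun x p z z' y => (L (sliceL hk f y)).map_update_add x p z z')
    (fun x p c z y => (L (sliceL hk f y)).map_update_smul x p c z)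
    (fun x y p z z' => by rw [sliceL_update_add, map_add]; rfl)
    (fun x y p c z => by rw [sliceL_update_smul, map_smul]; rfl)
    (hg a b c k hk L f)

theorem leftOp_glue (hg : LeftContinuous g) {a b c k k' : ℕ} (hk : a + b = k) (hk' : c + b = k')
    (L : Cochain g a →ₗ[ℝ] Cochain g c) (f : Cochain g k) (x : Fin c → g) (y : Fin b → g) :
    leftOp hg hk hk' L f (glue hk' x y) = L (sliceL hk f y) x :=
  biform_glue ..

theorem sliceL_leftOp (hg : LeftContinuous g) {a b c k k' : ℕ} (hk : a + b = k) (hk' : c + b = k')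
    (L : Cochain g a →ₗ[ℝ] Cochain g c) (f : Cochain g k) (y : Fin b → g) :
    sliceL hk' (leftOp hg hk hk' L f) y = L (sliceL hk f y) := by
  ext x; exact leftOp_glue hg ..

theorem leftOp_mem_skewLast (hg : LeftContinuous g) {a b c k k' m : ℕ} (hk : a + b = k)
    (hk' : c + b = k') (hm : m ≤ b) (L : Cochain g a →ₗ[ℝ] Cochain g c) {f : Cochain g k}
    (hf : f ∈ skewLast g m k) : leftOp hg hk hk' L f ∈ skewLast g m k' := by
  refine (mem_skewLast_iff_glue hk' hm).2 fun x y i j hij hi hy => ?_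
  rw [leftOp_glue, sliceL_eq_zero hk hf y i j (fun h => by subst h; omega) hi (by omega) hy,
    map_zero]
  rfl

/-- Contraction of the first block of arguments with a functional. -/
def contract (hg : LeftContinuous g) {a b k : ℕ} (hk : a + b = k) (t : Cochain g a →ₗ[ℝ] ℝ)
    (f : Cochain g k) : Cochain g b :=
  leftOp hg hk (zero_add b)
    -- A functional is treated as an operator with values in cochains of degree zero.
    ({ toFun := fun α => ContinuousMultilinearMap.constOfIsEmpty ℝ (fun _ : Fin 0 => g) (t α)
       map_add' := fun α β => by ext; simp
       map_smul' := fun c α => by ext; simp } : Cochain g a →ₗ[ℝ] Cochain g 0) f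

theorem contract_apply (hg : LeftContinuous g) {a b k : ℕ} (hk : a + b = k)
    (t : Cochain g a →ₗ[ℝ] ℝ) (f : Cochain g k) (y : Fin b → g) :
    contract hg hk t f y = t (sliceL hk f y) := by
  have : y = glue (zero_add b) ![] y := by
    refine eq_glue (zero_add b) (fun p => p.elim0) fun p => ?_
    congr 1; ext; simp
  conv_lhs => rw [this]
  exact leftOp_glue hg ..

theorem contract_mem_skewLast (hg : LeftContinuous g) {a b k m : ℕ} (hk : a + b = k) (hm : m ≤ b)
    (t : Cochain g a →ₗ[ℝ] ℝ) {f : Cochain g k} (hf : f ∈ skewLast g m k) :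
    contract hg hk t f ∈ skewLast g m b :=
  leftOp_mem_skewLast hg hk _ hm _ hf

/-- The coboundary in the second block is a finite linear combination of slices, so that it commutes
with every functional; `t` need not vanish on coboundaries. -/
theorem leibnizD_contract (hg : LeftContinuous g) {a b k : ℕ} (hk : a + b = k)
    (t : Cochain g a →ₗ[ℝ] ℝ) (f : Cochain g k) (y : Fin (b + 1) → g)
    (h : ∀ x, leibnizD b (sliceR hk f x) y = 0) : leibnizD b (contract hg hk t f) y = 0 := by
  have h0 : ∑ j : Fin (b + 1), ∑ i : Fin b,
      (if i.castSucc < j then (-1 : ℝ) ^ (j : ℕ) • sliceL hk f (merge y i j) else 0) = 0 := by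
    ext x
    rw [zero_apply, ← h x, leibnizD_apply]
    simp only [sum_apply]
    refine Finset.sum_congr rfl fun j _ => Finset.sum_congr rfl fun i _ => ?_
    split_ifs <;> rfl
  have h1 := congrArg t h0
  rw [map_zero] at h1
  rw [← h1, leibnizD_apply, map_sum]
  refine Finset.sum_congr rfl fun j _ => ?_
  rw [map_sum]
  refine Finset.sum_congr rfl fun i _ => ?_
  split_ifs
  · rw [map_smul, contract_apply]; rfl
  · simp

theorem contract_mem_hrReps (hg : LeftContinuous g) {n s k : ℕ} (hN : n + 1 + (s + 2) = k)
    (t : Cochain g (n + 1) →ₗ[ℝ] ℝ) {f : Cochain g k} (hf : f ∈ biCocycles hN) :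
    contract hg hN t f ∈ hrReps g s :=
  ⟨contract_mem_skewLast hg hN (by omega) t (biCocycles_skew hN hf),
    fun y i j hij hi hj hy => leibnizD_contract hg hN t f y fun x =>
      (hf.2 x).2 y i j hij hi hj hy⟩

/-- If the class of `f` on the second page vanishes, so do its contractions with cycles. -/
theorem toHR_contract_eq_zero (hg : LeftContinuous g) {n s m : ℕ} (hN : n + 1 + (s + 2) = m + 2)
    (t : Cochain g (n + 1) →ₗ[ℝ] ℝ) (ht : ∀ α, t (leibnizD n α) = 0) (f : biCocycles (g := g) hN)
    (h : biClass hN f = 0) : toHR g s ⟨contract hg hN t f.1, contract_mem_hrReps hg hN t f.2⟩ = 0 := by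
  obtain ⟨Y, hY, hf⟩ := (biClass_eq_zero hN f).1 h
  have hM : n + 1 + (s + 1) = m + 1 := by omega
  -- Both `f` and `f - d Y` are alternating in the last `s + 1` arguments, hence so is `d Y`. This
  -- is what `contract_leibnizD` needs of `Y`.
  have hdY : leibnizD (m + 1) Y ∈ skewLast g (s + 1) (m + 2) := by
    have := sub_mem (biCocycles_skew hN f.2) (skewLast_anti _ (show s + 1 ≤ s + 2 by omega) hf)
    simpa using this
  refine (toHR_eq_zero _).2 ⟨(-1 : ℝ) ^ (n + 1) • contract hg hM t Y,
    Submodule.smul_mem _ _ (contract_mem_skewLast hg hM (by omega) t hY),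
    skew_of_adjacent _ _ fun y i j hij hi hy => ?_⟩
  have h1 := contract_leibnizD hM hN hY hdY t ht (contract hg hM t Y)
    (fun y => contract_apply hg hM t Y y) y i j hij hy
  have h2 := sliceL_eq_zero hN hf y i j (fun h => by subst h; omega) (by omega) (by omega) hy
  rw [sliceL_sub, sub_eq_zero] at h2
  rw [map_smul]
  show contract hg hN t f.1 y - (-1 : ℝ) ^ (n + 1) * leibnizD (s + 1) (contract hg hM t Y) y = 0
  rw [← h1, contract_apply, h2, sub_self]

/-- A linear section of `d` over its range, extended arbitrarily. No continuity is claimed, which is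
why `LeftContinuous` is needed. -/
theorem exists_generalizedInverse {V W : Type*} [AddCommGroup V] [Module ℝ V] [AddCommGroup W]
    [Module ℝ W] (d : V →ₗ[ℝ] W) : ∃ σ : W →ₗ[ℝ] V, ∀ x, d (σ (d x)) = d x := by
  obtain ⟨τ, hτ⟩ := d.rangeRestrict.exists_rightInverse_of_surjective d.range_rangeRestrict
  obtain ⟨σ, hσ⟩ := LinearMap.exists_extend τ
  refine ⟨σ, fun x => ?_⟩
  have h1 : σ (d x) = τ ⟨d x, x, rfl⟩ := LinearMap.congr_fun hσ ⟨d x, x, rfl⟩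
  rw [h1]
  exact congrArg Subtype.val (LinearMap.congr_fun hτ ⟨d x, x, rfl⟩)

/-- A complex of vector spaces is homotopy equivalent to its cohomology. -/
theorem exists_contraction {V₀ V₁ V₂ : Type*} [AddCommGroup V₀] [Module ℝ V₀] [AddCommGroup V₁]
    [Module ℝ V₁] [AddCommGroup V₂] [Module ℝ V₂] (d₀ : V₀ →ₗ[ℝ] V₁) (d₁ : V₁ →ₗ[ℝ] V₂)
    (hd : ∀ x, d₁ (d₀ x) = 0) :
    ∃ (h₀ : V₁ →ₗ[ℝ] V₀) (h₁ : V₂ →ₗ[ℝ] V₁) (π : V₁ →ₗ[ℝ] V₁),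
      (∀ x, x = h₁ (d₁ x) + d₀ (h₀ x) + π x) ∧ (∀ x, d₁ (π x) = 0) ∧ ∀ x, π (d₀ x) = 0 := by
  obtain ⟨σ₀, h0⟩ := exists_generalizedInverse d₀
  obtain ⟨σ₁, h1⟩ := exists_generalizedInverse d₁
  -- `ρ` projects onto the cocycles and `d₀ ∘ σ₀` onto the coboundaries; `π` retains a complement of
  -- the coboundaries in the cocycles.
  let ρ : V₁ →ₗ[ℝ] V₁ := LinearMap.id - σ₁ ∘ₗ d₁
  have hρ : ∀ x, ρ x = x - σ₁ (d₁ x) := fun x => rfl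
  refine ⟨σ₀ ∘ₗ ρ, σ₁, ρ - d₀ ∘ₗ σ₀ ∘ₗ ρ, fun x => ?_, fun x => ?_, fun x => ?_⟩
  · simp [hρ]
  · simp [hρ, hd, h1]
  · simp [hρ, hd, h0]

/-- Every element of the second page is the class of a form whose slices are cocycles. -/
theorem biClass_surjective (hg : LeftContinuous g) {n s m : ℕ} (hN : n + 1 + (s + 2) = m + 2) :
    Function.Surjective (biClass (g := g) hN) := by
  intro z
  have hs : s + 1 ≤ m := by omega
  have hM : n + (s + 2) = m + 1 := by omega
  have hk : n + 1 + (s + 3) = m + 3 := by omega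
  have hk' : n + 1 + 1 + (s + 2) = m + 3 := by omega
  obtain ⟨f, rfl⟩ := toPage_surjective hs z
  -- Applied to the first block of `f`, only `π` matters: the part `d h₀ f` is a coboundary up to
  -- filtration, and `h₁ d f` vanishes where two arguments `y` agree.
  obtain ⟨h₀, h₁, π, hsum, hdπ, hπd⟩ := exists_contraction (leibnizD (g := g) n)
    (leibnizD (n + 1)) leibnizD_leibnizD
  have hf : f.1 ∈ skewLast g (s + 1) (m + 2) := f.2.1
  have hdf : leibnizD (m + 2) f.1 ∈ skewLast g (s + 3) (m + 3) := f.2.2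
  have hskew := leftOp_mem_skewLast hg hN hM (by omega) h₀ hf
  refine ⟨⟨leftOp hg hN hN π f.1, fun y => ?_, fun x => ?_⟩, (toPage_eq_biClass hN hs f _
    (leftOp hg hN hM h₀ f.1) (skewLast_anti _ (by omega) hskew) ?_).symm⟩
  · rw [sliceL_leftOp, hdπ]
  -- The slice at `x` is the contraction with `α ↦ π α x`. As this functional vanishes on
  -- coboundaries, `contract_leibnizD` turns alternation of `d f` into alternation of the coboundary
  -- of the slice.
  · have e : sliceR hN (leftOp hg hN hN π f.1) x = contract hg hN
        { toFun := fun α => π α x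
          map_add' := fun α β => by rw [map_add]; rfl
          map_smul' := fun c α => by rw [map_smul]; rfl } f.1 := by
      ext y
      rw [sliceR_apply, leftOp_glue, contract_apply]; rfl
    rw [e]
    refine ⟨contract_mem_skewLast hg hN (by omega) _ hf,
      skew_of_adjacent _ _ fun y i j hij hi hy => ?_⟩
    have h1 := contract_leibnizD hN hk hf (skewLast_anti _ (by omega) hdf)
      { toFun := fun α => π α x
        map_add' := fun α β => by rw [map_add]; rfl
        map_smul' := fun c α => by rw [map_smul]; rfl }
      (fun α => by show π (leibnizD n α) x = 0; rw [hπd]; rfl) _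
      (fun y => contract_apply hg hN _ f.1 y) y i j hij hy
    rw [sliceL_eq_zero hk hdf y i j (fun h => by subst h; omega) (by omega) (by omega) hy,
      map_zero] at h1
    exact (mul_eq_zero.1 h1.symm).resolve_left (by simp)
  · refine (mem_skewLast_iff_glue hN le_rfl).2 fun x y i j hij hi hy => ?_
    have hne : i ≠ j := fun h => by subst h; omega
    show f.1 (glue hN x y) - leibnizD (m + 1) _ (glue hN x y) - leftOp hg hN hN π f.1 (glue hN x y)
      = 0
    rw [leibnizD_glue_of_eq hM hN hskew x y i j hne hy, sliceL_leftOp, leftOp_glue]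
    -- For repeated arguments `y` the coboundary of the slice is given by values of `d f`, which
    -- vanish there.
    have h1 : leibnizD (n + 1) (sliceL hN f.1 y) = 0 := by
      ext x'
      rw [← leibnizD_glue_of_eq hN hk' hf x' y i j hne hy]
      exact skewLast_glue hk' (skewLast_anti _ (show s + 2 ≤ s + 3 by omega) hdf) x' y i j hne
        (by omega) (by omega) hy
    have h2 := congrArg (fun α : Cochain g (n + 1) => α x) (hsum (sliceL hN f.1 y))
    simp only [h1, map_zero, zero_add, add_apply] at h2
    rw [sliceL_apply] at h2
    rw [h2]; ring

end Normal

/-! ### Linear algebra -/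

section LinearAlgebra

theorem exists_linear_section {V W : Type*} [AddCommGroup V] [Module ℝ V] [AddCommGroup W]
    [Module ℝ W] (f : V →ₗ[ℝ] W) (hf : Function.Surjective f) :
    ∃ σ : W →ₗ[ℝ] V, ∀ w, f (σ w) = w := by
  obtain ⟨σ, hσ⟩ := f.exists_rightInverse_of_surjective (LinearMap.range_eq_top.2 hf)
  exact ⟨σ, LinearMap.congr_fun hσ⟩

theorem exists_linear_projection {V : Type*} [AddCommGroup V] [Module ℝ V] (P : Submodule ℝ V) :
    ∃ π : V →ₗ[ℝ] P, ∀ x (hx : x ∈ P), π x = ⟨x, hx⟩ := by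
  obtain ⟨π, hπ⟩ := P.subtype.exists_leftInverse_of_injective P.ker_subtype
  exact ⟨π, fun x hx => LinearMap.congr_fun hπ ⟨x, hx⟩⟩

theorem exists_linear_extension {V W : Type*} [AddCommGroup V] [Module ℝ V] [AddCommGroup W]
    [Module ℝ W] (P : Submodule ℝ V) (f : P →ₗ[ℝ] W) :
    ∃ h : V →ₗ[ℝ] W, ∀ x : P, h x = f x := by
  obtain ⟨h, hh⟩ := f.exists_extend
  exact ⟨h, LinearMap.congr_fun hh⟩

theorem mem_span_of_separating {V ι : Type*} [AddCommGroup V] [Module ℝ V]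
    [FiniteDimensional ℝ V] (L : ι → V →ₗ[ℝ] ℝ) (h : ∀ x, (∀ i, L i x = 0) → x = 0)
    (t : V →ₗ[ℝ] ℝ) : t ∈ Submodule.span ℝ (Set.range L) :=
  FiniteDimensional.mem_span_of_iInf_ker_le_ker fun x hx => by
    rw [h x fun i => (Submodule.mem_iInf _).1 hx i]; exact zero_mem _

theorem exists_finite_coordinates (V : Type*) [AddCommGroup V] [Module ℝ V]
    [FiniteDimensional ℝ V] :
    ∃ (n : ℕ) (b : Fin n → V) (c : Fin n → V →ₗ[ℝ] ℝ), ∀ x, ∑ i, c i x • b i = x :=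
  ⟨_, Module.finBasis ℝ V, (Module.finBasis ℝ V).coord, (Module.finBasis ℝ V).sum_repr⟩

-- Precomposition with linear sections defines the map; the two vanishing conditions make it
-- independent of the sections.
open TensorProduct in
theorem exists_lift_of_surjective {V V' W W' P : Type*} [AddCommGroup V] [Module ℝ V]
    [AddCommGroup W] [Module ℝ W] [AddCommGroup V'] [Module ℝ V'] [AddCommGroup W'] [Module ℝ W']
    [AddCommGroup P] [Module ℝ P] (f : V →ₗ[ℝ] V') (hf : Function.Surjective f) (h : W →ₗ[ℝ] W')
    (hh : Function.Surjective h) (B : V →ₗ[ℝ] W →ₗ[ℝ] P) (hl : ∀ v w, f v = 0 → B v w = 0)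
    (hr : ∀ v w, h w = 0 → B v w = 0) :
    ∃ Ψ : V' ⊗[ℝ] W' →ₗ[ℝ] P, ∀ v w, Ψ (f v ⊗ₜ h w) = B v w := by
  obtain ⟨σ, hσ⟩ := exists_linear_section f hf
  obtain ⟨τ, hτ⟩ := exists_linear_section h hh
  refine ⟨TensorProduct.lift (B.compl₁₂ σ τ), fun v w => ?_⟩
  have h1 : B (σ (f v) - v) (τ (h w)) = 0 := hl _ _ (by rw [map_sub, hσ, sub_self])
  have h2 : B v (τ (h w) - w) = 0 := hr _ _ (by rw [map_sub, hτ, sub_self])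
  rw [map_sub, LinearMap.sub_apply, sub_eq_zero] at h1
  rw [map_sub, sub_eq_zero] at h2
  exact h1.trans h2

end LinearAlgebra

/-! ### Completed tensor products of spaces in which zero is open -/

section CompletedBot

open TensorProduct

/-- The contraction of the first factor of a tensor product with a linear form. -/
def contractLeft {E F : Type*} [AddCommGroup E] [Module ℝ E] [AddCommGroup F]
    [Module ℝ F] (t : E →ₗ[ℝ] ℝ) : E ⊗[ℝ] F →ₗ[ℝ] F :=
  (TensorProduct.lid ℝ F).toLinearMap.comp (t.rTensor F)

theorem contractLeft_tmul {E F : Type*} [AddCommGroup E] [Module ℝ E] [AddCommGroup F]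
    [Module ℝ F] (t : E →ₗ[ℝ] ℝ) (x : E) (y : F) : contractLeft t (x ⊗ₜ y) = t x • y := by
  simp [contractLeft]

theorem eq_zero_of_forall_contractLeft {E F : Type*} [AddCommGroup E] [Module ℝ E] [AddCommGroup F]
    [Module ℝ F] (z : E ⊗[ℝ] F) (h : ∀ t : E →ₗ[ℝ] ℝ, contractLeft t z = 0) : z = 0 := by
  classical
  refine (TensorProduct.equivFinsuppOfBasisLeft (Module.Basis.ofVectorSpace ℝ E)).injective ?_
  rw [map_zero]
  ext i
  rw [TensorProduct.equivFinsuppOfBasisLeft_apply]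
  exact h _

variable {E F : Type u} [AddCommGroup E] [Module ℝ E] [AddCommGroup F] [Module ℝ F]

/-- The map of the tensor product to the completed tensor product. -/
def toCompleted (𝒰 : Set (Submodule ℝ E)) (𝒲 : Set (Submodule ℝ F)) :
    E ⊗[ℝ] F →ₗ[ℝ] CompletedTensor 𝒰 𝒲 where
  toFun z := ⟨fun U W => TensorProduct.map U.1.mkQ W.1.mkQ z, fun U U' W W' hU hW => by
    rw [← LinearMap.comp_apply, ← TensorProduct.map_comp, Submodule.factor_comp_mk,
      Submodule.factor_comp_mk]⟩
  map_add' z z' := Subtype.ext (funext fun U => funext fun W => map_add _ z z')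
  map_smul' c z := Subtype.ext (funext fun U => funext fun W => map_smul _ c z)

/-- If zero is open in both factors, a compatible family is determined by its member at `⊥` and `⊥`.
-/
theorem toCompleted_bijective {𝒰 : Set (Submodule ℝ E)} {𝒲 : Set (Submodule ℝ F)} (hU : ⊥ ∈ 𝒰)
    (hW : ⊥ ∈ 𝒲) : Function.Bijective (toCompleted 𝒰 𝒲) := by
  let e : E ⊗[ℝ] F ≃ₗ[ℝ] (E ⧸ (⊥ : Submodule ℝ E)) ⊗[ℝ] (F ⧸ (⊥ : Submodule ℝ F)) :=
    TensorProduct.congr (Submodule.quotEquivOfEqBot _ rfl).symm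
      (Submodule.quotEquivOfEqBot _ rfl).symm
  have he : ∀ z, (toCompleted 𝒰 𝒲 z).1 ⟨⊥, hU⟩ ⟨⊥, hW⟩ = e z := by
    intro z
    induction z with
    | zero => rw [map_zero, map_zero]; rfl
    | tmul x y => rfl
    | add z z' h h' => rw [map_add, map_add, ← h, ← h']; rfl
  have hinj : ∀ t t' : CompletedTensor 𝒰 𝒲, t.1 ⟨⊥, hU⟩ ⟨⊥, hW⟩ = t'.1 ⟨⊥, hU⟩ ⟨⊥, hW⟩ → t = t' := by
    intro t t' h
    refine Subtype.ext (funext fun U => funext fun W => ?_)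
    rw [← t.2 ⟨⊥, hU⟩ U ⟨⊥, hW⟩ W bot_le bot_le, h, t'.2 ⟨⊥, hU⟩ U ⟨⊥, hW⟩ W bot_le bot_le]
  constructor
  · intro z z' h
    refine e.injective ?_
    rw [← he, ← he, h]
  · intro t
    refine ⟨e.symm (t.1 ⟨⊥, hU⟩ ⟨⊥, hW⟩), hinj _ _ ?_⟩
    rw [he, LinearEquiv.apply_symm_apply]

theorem exists_completed_equiv {𝒰 : Set (Submodule ℝ E)} {𝒲 : Set (Submodule ℝ F)} (hU : ⊥ ∈ 𝒰)
    (hW : ⊥ ∈ 𝒲) {P : Type*} [AddCommGroup P] [Module ℝ P] (e : E ⊗[ℝ] F ≃ₗ[ℝ] P) :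
    ∃ e' : CompletedTensor 𝒰 𝒲 ≃ₗ[ℝ] P,
      ∀ x y, e' (CompletedTensor.tmul 𝒰 𝒲 x y) = e (x ⊗ₜ y) := by
  let G := LinearEquiv.ofBijective (toCompleted 𝒰 𝒲) (toCompleted_bijective hU hW)
  exact ⟨G.symm.trans e, fun x y => congrArg e (G.symm_apply_apply (x ⊗ₜ y))⟩

end CompletedBot

/-! ### Continuous forms on pro-finite-dimensional spaces -/

section ProFinite

variable {g : Type u} [LieRing g] [LieAlgebra ℝ g] [TopologicalSpace g]

theorem exists_finset_sup_span {M : Type*} [AddCommGroup M] [Module ℝ M] {N : Submodule ℝ M}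
    (hN : N.CoFG) : ∃ S : Finset M, N ⊔ Submodule.span ℝ (S : Set M) = ⊤ := by
  obtain ⟨T, hT⟩ := exists_isCompl N
  obtain ⟨S, hS⟩ := Submodule.CoFG.fg_of_isCompl hT hN
  exact ⟨S, by rw [hS]; exact hT.sup_eq_top⟩

/-- A form that is continuous at zero in some of its arguments vanishes when one of these lies in a
suitable subspace of finite codimension. -/
theorem exists_coFG_of_free (hg : ∀ V ∈ nhds (0 : g), ∃ N : Submodule ℝ g,
    IsClosed (N : Set g) ∧ FiniteDimensional ℝ (g ⧸ N) ∧ (N : Set g) ⊆ V) {k : ℕ} (f : Cochain g k)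
    (n : ℕ) : ∀ (s : Finset (Fin k)), s.card = n → ∀ w : Fin k → g, ∃ N : Submodule ℝ g, N.CoFG ∧
      ∀ v : Fin k → g, (∀ i ∉ s, v i = w i) → (∃ i ∈ s, v i ∈ N) → f v = 0 := by
  induction n with
  | zero =>
    intro s hs w
    refine ⟨⊤, Submodule.CoFG.top, fun v _ ⟨i, hi, _⟩ => ?_⟩
    rw [Finset.card_eq_zero.1 hs] at hi
    simp at hi
  | succ n ih =>
    intro s hs w
    have h1 : ∀ (j : Fin k) (e : g), ∃ N : Submodule ℝ g, N.CoFG ∧ (j ∈ s → ∀ v : Fin k → g,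
        (∀ i ∉ s.erase j, v i = Function.update w j e i) → (∃ i ∈ s.erase j, v i ∈ N) →
          f v = 0) := by
      intro j e
      by_cases hj : j ∈ s
      · obtain ⟨N, hN, h⟩ := ih (s.erase j) (by rw [Finset.card_erase_of_mem hj]; omega)
          (Function.update w j e)
        exact ⟨N, hN, fun _ => h⟩
      · exact ⟨⊤, Submodule.CoFG.top, fun h => absurd h hj⟩
    choose N' hN' hN'f using h1
    obtain ⟨i0, hi0⟩ : s.Nonempty := Finset.card_pos.1 (by omega)
    have hcont : Continuous fun u : Fin k → g => f (s.piecewise u w) := by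
      refine f.cont.comp (continuous_pi fun i => ?_)
      by_cases hi : i ∈ s
      · simp only [Finset.piecewise_eq_of_mem _ _ _ hi]; exact continuous_apply i
      · simp only [Finset.piecewise_eq_of_notMem _ _ _ hi]; exact continuous_const
    have h0 : f (s.piecewise (0 : Fin k → g) w) = 0 :=
      f.map_coord_zero i0 (by simp [hi0])
    -- Near zero in the free arguments the form is smaller than `1`; homogeneity will make it vanish
    -- if these arguments all lie in a subspace `N₀` inside this neighbourhood.
    have hV : {u : Fin k → g | |f (s.piecewise u w)| < 1} ∈ nhds (0 : Fin k → g) :=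
      (isOpen_lt hcont.abs continuous_const).mem_nhds (by simp [h0])
    rw [nhds_pi, Filter.mem_pi'] at hV
    obtain ⟨I, t, ht, hI⟩ := hV
    obtain ⟨N₀, -, hN₀, hN₀V⟩ := hg (⋂ i, t i) (Filter.iInter_mem.2 fun i => ht i)
    obtain ⟨S, hS⟩ := exists_finset_sup_span hN₀
    -- Modulo `N₀` every argument is a combination of elements of the finite set `S`. Fixing one
    -- argument in `S` leaves a form with fewer free arguments, and `N` lies in the subspaces found
    -- for all of these.
    let N := N₀ ⊓ sInf (Set.range fun p : Fin k × S => N' p.1 p.2)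
    refine ⟨N, Submodule.CoFG.inf hN₀ (Submodule.CoFG.sInf_of_finite (Set.finite_range _)
      (by rintro _ ⟨p, rfl⟩; exact hN' _ _)), ?_⟩
    rintro v hvw ⟨i, his, hiN⟩
    -- Induction on the set `T` of arguments that are allowed to lie outside `N₀`.
    have key : ∀ T : Finset (Fin k), ∀ v : Fin k → g, (∀ i ∉ s, v i = w i) → v i ∈ N →
        (∀ j ∈ s, j ∉ T → v j ∈ N₀) → f v = 0 := by
      intro T
      induction T using Finset.induction with
      | empty =>
        intro v hvw hiN hv
        by_contra hne
        -- Scaling one argument by the inverse of the value `f v` gives the value `1`, contrary to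
        -- the bound.
        have hu : s.piecewise (Function.update v i ((f v)⁻¹ • v i)) 0 ∈ Set.pi (I : Set (Fin k)) t := by
          intro j _
          refine Set.mem_iInter.1 (hN₀V ?_) j
          by_cases hj : j ∈ s
          · rw [Finset.piecewise_eq_of_mem _ _ _ hj]
            by_cases hji : j = i
            · subst hji; rw [Function.update_self]; exact N₀.smul_mem _ (hv j hj (by simp))
            · rw [Function.update_of_ne hji]; exact hv j hj (by simp)
          · rw [Finset.piecewise_eq_of_notMem _ _ _ hj]; exact N₀.zero_mem
        have h2 := hI hu
        have h3 : s.piecewise (s.piecewise (Function.update v i ((f v)⁻¹ • v i)) 0) w =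
            Function.update v i ((f v)⁻¹ • v i) := by
          ext j
          by_cases hj : j ∈ s
          · simp [hj]
          · rw [Finset.piecewise_eq_of_notMem _ _ _ hj,
              Function.update_of_ne (by rintro rfl; exact hj his), hvw j hj]
        change |f (s.piecewise _ w)| < 1 at h2
        rw [h3, f.map_update_smul, Function.update_eq_self, smul_eq_mul, inv_mul_cancel₀ hne] at h2
        simp at h2
      | insert j T hj ihT =>
        intro v hvw hiN hv
        by_cases hjs : j ∈ s
        swap
        · exact ihT v hvw hiN fun j' hj' hj'T => hv j' hj' (by
            rw [Finset.mem_insert]; rintro (rfl | h)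
            · exact hjs hj'
            · exact hj'T h)
        by_cases hji : j = i
        · subst hji
          refine ihT v hvw hiN fun j' hj' hj'T => ?_
          by_cases hjj : j' = j
          · subst hjj; exact hiN.1
          · exact hv j' hj' (by simp [hjj, hj'T])
        have hoff : ∀ (y : g), ∀ i ∉ s, Function.update v j y i = w i := fun y i hi => by
          rw [Function.update_of_ne (by rintro rfl; exact hi hjs), hvw i hi]
        have hker : LinearMap.ker (f.toMultilinearMap.toLinearMap v j) = ⊤ := by
          rw [← top_le_iff, ← hS, sup_le_iff, Submodule.span_le]
          constructor
          · intro y hy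
            refine ihT (Function.update v j y) (hoff y)
              (by rwa [Function.update_of_ne (Ne.symm hji)]) fun j' hj' hj'T => ?_
            by_cases hjj : j' = j
            · subst hjj; rwa [Function.update_self]
            · rw [Function.update_of_ne hjj]; exact hv j' hj' (by simp [hjj, hj'T])
          · intro y hy
            refine hN'f j y hjs (Function.update v j y) (fun i' hi' => ?_)
              ⟨i, Finset.mem_erase.2 ⟨Ne.symm hji, his⟩, ?_⟩
            · by_cases hij : i' = j
              · subst hij; simp
              · rw [Function.update_of_ne hij, Function.update_of_ne hij]
                exact hvw i' fun h => hi' (Finset.mem_erase.2 ⟨hij, h⟩)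
            · rw [Function.update_of_ne (Ne.symm hji)]
              exact (Submodule.mem_sInf.1 hiN.2) _ ⟨(j, ⟨y, hy⟩), rfl⟩
        have h4 : v j ∈ LinearMap.ker (f.toMultilinearMap.toLinearMap v j) := hker ▸ trivial
        have h5 : f (Function.update v j (v j)) = 0 := h4
        rwa [Function.update_eq_self] at h5
    exact key Finset.univ v hvw hiN fun j _ hj => absurd (Finset.mem_univ j) hj

/-- The first slices of a continuous form on a pro-finite-dimensional space span a
finite-dimensional space. -/
theorem exists_finiteDimensional_slices (hg : ∀ V ∈ nhds (0 : g), ∃ N : Submodule ℝ g,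
    IsClosed (N : Set g) ∧ FiniteDimensional ℝ (g ⧸ N) ∧ (N : Set g) ⊆ V) {a b k : ℕ}
    (hk : a + b = k) (f : Cochain g k) :
    ∃ P : Submodule ℝ (Cochain g a), FiniteDimensional ℝ P ∧ ∀ y, sliceL hk f y ∈ P := by
  obtain ⟨N, hN, hf⟩ := exists_coFG_of_free hg f _ Finset.univ rfl 0
  have hf' : ∀ (y : Fin b → g) (j : Fin b), y j ∈ N → sliceL hk f y = 0 := fun y j hj => by
    ext x
    exact hf _ (by simp) ⟨inr hk j, by simp, by simpa using hj⟩
  obtain ⟨S, hS⟩ := exists_finset_sup_span hN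
  let P := Submodule.span ℝ (Set.range fun I : Fin b → S => sliceL hk f fun j => (I j : g))
  refine ⟨P, FiniteDimensional.span_of_finite ℝ (Set.finite_range _), fun y => ?_⟩
  -- A slice vanishes as soon as one argument lies in `N`, so that by linearity each argument may be
  -- taken from `S`; the induction is on the set of arguments not known to lie in `S`.
  have key : ∀ T : Finset (Fin b), ∀ y : Fin b → g, (∀ j ∉ T, y j ∈ S) → sliceL hk f y ∈ P := by
    intro T
    induction T using Finset.induction with
    | empty =>
      intro y hy
      exact Submodule.subset_span ⟨fun j => ⟨y j, hy j (by simp)⟩, rfl⟩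
    | insert j T hj ih =>
      intro y hy
      let ℓ : g →ₗ[ℝ] Cochain g a :=
        { toFun := fun z => sliceL hk f (Function.update y j z)
          map_add' := fun z z' => sliceL_update_add hk f y j z z'
          map_smul' := fun c z => sliceL_update_smul hk f y j c z }
      have hℓ : P.comap ℓ = ⊤ := by
        rw [← top_le_iff, ← hS, sup_le_iff, Submodule.span_le]
        constructor
        · intro z hz
          show sliceL hk f (Function.update y j z) ∈ P
          rw [hf' _ j (by simpa using hz)]
          exact zero_mem _
        · intro z hz
          refine ih (Function.update y j z) fun j' hj' => ?_
          by_cases h : j' = j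
          · subst h; simpa using hz
          · rw [Function.update_of_ne h]; exact hy j' (by simp [h, hj'])
      have h4 : y j ∈ P.comap ℓ := hℓ ▸ trivial
      have h5 : sliceL hk f (Function.update y j (y j)) ∈ P := h4
      rwa [Function.update_eq_self] at h5
  exact key Finset.univ y (by simp)

/-- A form whose first slices span a finite-dimensional space is a sum of products. -/
theorem mem_span_cross {a b k : ℕ} (hk : a + b = k) (f : Cochain g k)
    (P : Submodule ℝ (Cochain g a)) [FiniteDimensional ℝ P] (hP : ∀ y, sliceL hk f y ∈ P) :
    f ∈ Submodule.span ℝ {h | ∃ (α : Cochain g a) (β : Cochain g b), h = cross α β hk} := by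
  let ev : (Fin a → g) → P →ₗ[ℝ] ℝ := fun x =>
    { toFun := fun α => α.1 x
      map_add' := fun _ _ => rfl
      map_smul' := fun _ _ => rfl }
  -- Evaluations separate the points of the finite-dimensional space `P`, so that every linear form
  -- on `P` is a finite combination of them. Hence the coordinates of `f(·, y)` in `P` are
  -- continuous forms in `y`.
  have hev := mem_span_of_separating (V := P) ev fun α hα =>
    Subtype.ext (ContinuousMultilinearMap.ext fun x => hα x)
  have hβ : ∀ t : P →ₗ[ℝ] ℝ, ∃ β : Cochain g b, ∀ y, β y = t ⟨sliceL hk f y, hP y⟩ := fun t => by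
    refine Submodule.span_induction ?_ ?_ ?_ ?_ (hev t)
    · rintro _ ⟨x, rfl⟩
      exact ⟨sliceR hk f x, fun y => rfl⟩
    · exact ⟨0, fun y => rfl⟩
    · rintro t t' _ _ ⟨β, h⟩ ⟨β', h'⟩
      exact ⟨β + β', fun y => by rw [add_apply, h, h']; rfl⟩
    · rintro c t _ ⟨β, h⟩
      exact ⟨c • β, fun y => by rw [smul_apply, h]; rfl⟩
  obtain ⟨n, b, c, hbc⟩ := exists_finite_coordinates P
  choose β hβ using fun i => hβ (c i)
  have hf : f = ∑ i, cross (b i).1 (β i) hk := by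
    refine ext_glue hk fun x y => ?_
    rw [sum_apply]
    have h1 := congrArg (ev x) (hbc ⟨sliceL hk f y, hP y⟩)
    rw [map_sum] at h1
    refine Eq.trans (Eq.symm h1) (Finset.sum_congr rfl fun i _ => ?_)
    rw [cross_glue, hβ, map_smul, smul_eq_mul, mul_comm]
    rfl
  rw [hf]
  exact sum_mem fun i _ => Submodule.subset_span ⟨_, _, rfl⟩

theorem sliceL_cross {a b k : ℕ} (hk : a + b = k) (α : Cochain g a) (β : Cochain g b)
    (y : Fin b → g) : sliceL hk (cross α β hk) y = β y • α := by
  ext x; simp [mul_comm]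

theorem sliceR_cross {a b k : ℕ} (hk : a + b = k) (α : Cochain g a) (β : Cochain g b)
    (x : Fin a → g) : sliceR hk (cross α β hk) x = α x • β := by
  ext y; simp

/-- On a product `α × β` an operator just replaces `α` by `L α`, again a continuous form; no
continuity of `L` is involved. -/
theorem leftContinuous_of_span (h : ∀ (a b k : ℕ) (hk : a + b = k) (f : Cochain g k),
    f ∈ Submodule.span ℝ {h | ∃ (α : Cochain g a) (β : Cochain g b), h = cross α β hk}) :
    LeftContinuous g := by
  intro a b c k hk L f
  refine Submodule.span_induction ?_ ?_ ?_ ?_ (h a b k hk f)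
  · rintro _ ⟨α, β, rfl⟩
    simp only [sliceL_cross, map_smul]
    exact (β.cont.comp continuous_snd).mul ((L α).cont.comp continuous_fst)
  · have : ∀ y, sliceL hk (0 : Cochain g k) y = 0 := fun y => rfl
    simp only [this, map_zero]
    exact continuous_const
  · intro f f' _ _ hf hf'
    simp only [sliceL_add, map_add]
    exact hf.add hf'
  · intro c f _ hf
    simp only [sliceL_smul, map_smul]
    exact continuous_const.mul hf

theorem leftContinuous_of_discrete [DiscreteTopology g] : LeftContinuous g :=
  fun _ _ _ _ _ _ _ => continuous_of_discreteTopology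

/-- The topologies on cohomology refer to linearly compact subspaces; this makes `g` itself
available as one of them. -/
theorem isLinearlyCompact_top (hg : IsLinearlyCompact g) :
    IsLinearlyCompact (⊤ : Submodule ℝ g) := by
  intro 𝒜 h𝒜 hfin
  let ι : g → (⊤ : Submodule ℝ g) := fun x => ⟨x, trivial⟩
  have hι : Continuous ι := continuous_id.subtype_mk _
  have h1 : ∀ A ∈ (fun A => ι ⁻¹' A) '' 𝒜, ∃ (N : Submodule ℝ g) (x : g),
      IsClosed (N : Set g) ∧ A = {y | y - x ∈ N} := by
    rintro _ ⟨A, hA, rfl⟩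
    obtain ⟨N, x, hN, rfl⟩ := h𝒜 A hA
    exact ⟨N.comap (Submodule.topEquiv (R := ℝ) (M := g)).symm.toLinearMap, x.1,
      hN.preimage hι, rfl⟩
  obtain ⟨x, hx⟩ := hg _ h1 fun t ht => by
    classical
    obtain ⟨t', ht', rfl⟩ := Finset.subset_set_image_iff.1 ht
    obtain ⟨x, hx⟩ := hfin t' ht'
    refine ⟨x.1, ?_⟩
    intro A hA
    obtain ⟨A', hA', rfl⟩ := Finset.mem_image.1 (Finset.mem_coe.1 hA)
    exact hx A' hA'
  exact ⟨ι x, fun A hA => hx _ ⟨A, hA, rfl⟩⟩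

end ProFinite

theorem Cohomology.mk_surjective {C : ℕ → Type u} [∀ m, AddCommGroup (C m)]
    [∀ m, Module ℝ (C m)] (d : ∀ m, C m →ₗ[ℝ] C (m + 1)) (m : ℕ) :
    Function.Surjective (Cohomology.mk d m) := Submodule.mkQ_surjective _

/-! ### Products of cocycles on the second page, and the pro-finite-dimensional case -/

section CrossPage

open TensorProduct

variable {g : Type u} [LieRing g] [LieAlgebra ℝ g] [TopologicalSpace g] [IsTopologicalLieAlgebra g]

theorem cross_mem_biCocycles {n s k : ℕ} (hN : n + 1 + (s + 2) = k) {α : Cochain g (n + 1)}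
    (hα : α ∈ Cocycles (leibnizD (g := g)) (n + 1)) {β : Cochain g (s + 2)}
    (hβ : β ∈ hrReps g s) : cross α β hN ∈ biCocycles hN :=
  ⟨fun y => by rw [sliceL_cross, map_smul, LinearMap.mem_ker.1 hα, smul_zero],
    fun x => by rw [sliceR_cross]; exact Submodule.smul_mem _ _ hβ⟩

theorem contract_cross (hg : LeftContinuous g) {a b k : ℕ} (hk : a + b = k)
    (t : Cochain g a →ₗ[ℝ] ℝ) (α : Cochain g a) (β : Cochain g b) :
    contract hg hk t (cross α β hk) = t α • β := by
  ext y
  rw [contract_apply, sliceL_cross, map_smul, smul_apply, smul_eq_mul, smul_eq_mul, mul_comm]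

/-- The cross product as a bilinear map. -/
def crossₗ {a b k : ℕ} (hk : a + b = k) : Cochain g a →ₗ[ℝ] Cochain g b →ₗ[ℝ] Cochain g k :=
  LinearMap.mk₂ ℝ (fun α β => cross α β hk)
    (fun α α' β => ext_glue hk fun x y => by simp [add_mul])
    (fun c α β => ext_glue hk fun x y => by simp [mul_assoc])
    (fun α β β' => ext_glue hk fun x y => by simp [mul_add])
    (fun c α β => ext_glue hk fun x y => by simp [mul_left_comm])

/-- The cross product of cocycles, with values in the second page. -/
def crossClass {n s m : ℕ} (hN : n + 1 + (s + 2) = m + 2) :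
    Cocycles (leibnizD (g := g)) (n + 1) →ₗ[ℝ] hrReps g s →ₗ[ℝ]
      Page (rgD g) (rgFiltration g) 2 s m :=
  LinearMap.mk₂ ℝ (fun α β => biClass hN ⟨cross α.1 β.1 hN, cross_mem_biCocycles hN α.2 β.2⟩)
    (fun α α' β => by
      rw [← map_add]; congr 1
      exact Subtype.ext (LinearMap.map_add₂ (crossₗ hN) α.1 α'.1 β.1))
    (fun c α β => by
      rw [← map_smul]; congr 1
      exact Subtype.ext (LinearMap.map_smul₂ (crossₗ hN) c α.1 β.1))
    (fun α β β' => by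
      rw [← map_add]; congr 1
      exact Subtype.ext (map_add (crossₗ hN α.1) β.1 β'.1))
    (fun c α β => by
      rw [← map_smul]; congr 1
      exact Subtype.ext (map_smul (crossₗ hN α.1) c β.1))

/-- If `α = d α'`, the product `α' × β` is a primitive in the first block. In the same way a
primitive of `β` gives one in the second block, `α` being a cocycle. -/
theorem crossClass_eq_zero_left {n s m : ℕ} (hN : n + 1 + (s + 2) = m + 2)
    (α : Cocycles (leibnizD (g := g)) (n + 1)) (β : hrReps g s)
    (h : Cohomology.mk (leibnizD (g := g)) (n + 1) α = 0) : crossClass hN α β = 0 := by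
  obtain ⟨α', -, hα'⟩ := (Submodule.Quotient.mk_eq_zero _).1 h
  have hM : n + (s + 2) = m + 1 := by omega
  refine biClass_eq_zero_of_left hN hM _ (cross α' β.1 hM) ?_ fun z => ?_
  · refine (mem_skewLast_iff_sliceR hM (by omega)).2 fun x => ?_
    rw [sliceR_cross]; exact Submodule.smul_mem _ _ β.2.1
  · rw [sliceL_cross, sliceL_cross, map_smul, hα']; rfl

theorem crossClass_eq_zero_right {n s m : ℕ} (hN : n + 1 + (s + 2) = m + 2)
    (α : Cocycles (leibnizD (g := g)) (n + 1)) (β : hrReps g s) (h : toHR g s β = 0) :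
    crossClass hN α β = 0 := by
  obtain ⟨y, hy, hβ⟩ := (toHR_eq_zero β).1 h
  have hM : n + 1 + (s + 1) = m + 1 := by omega
  refine biClass_eq_zero_of_right hN hM _ (cross α.1 y hM) ?_ (fun z => ?_) fun x => ?_
  · refine (mem_skewLast_iff_sliceR hM (by omega)).2 fun x => ?_
    rw [sliceR_cross]; exact Submodule.smul_mem _ _ hy
  · rw [sliceL_cross, map_smul, LinearMap.mem_ker.1 α.2, smul_zero]
  · rw [sliceR_cross, sliceR_cross, map_smul]
    have h2 : α.1 x • β.1 - α.1 x • leibnizD (s + 1) y = α.1 x • (β.1 - leibnizD (s + 1) y) :=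
      (smul_sub (α.1 x) β.1 (leibnizD (s + 1) y)).symm
    rw [h2]
    exact Submodule.smul_mem _ _ hβ

-- Induction on the tensor: its image is the class of a sum of products of cocycles, and contracting
-- this sum with `T` represents the contraction of the tensor with `t`. Since `f` is chosen before
-- `t`, the vanishing of `Ψ z` can be exploited for all `t`.
set_option maxHeartbeats 1000000 in
theorem exists_biCocycle_contract (hg : LeftContinuous g) {n s m : ℕ} (hN : n + 1 + (s + 2) = m + 2)
    (Ψ : HL g (n + 1) ⊗[ℝ] HR g s →ₗ[ℝ] Page (rgD g) (rgFiltration g) 2 s m)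
    (hΨ : ∀ α β, Ψ (Cohomology.mk (leibnizD (g := g)) (n + 1) α ⊗ₜ toHR g s β) =
      crossClass hN α β) :
    ∀ z, ∃ f : biCocycles (g := g) hN, Ψ z = biClass hN f ∧
    ∀ (t : HL g (n + 1) →ₗ[ℝ] ℝ) (T : Cochain g (n + 1) →ₗ[ℝ] ℝ),
      (∀ α : Cocycles (leibnizD (g := g)) (n + 1), T α.1 =
        t (Cohomology.mk (leibnizD (g := g)) (n + 1) α)) →
      ∃ h : contract hg hN T f.1 ∈ hrReps g s,
        toHR g s ⟨_, h⟩ = contractLeft t z := by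
  have hmk : Function.Surjective (Cohomology.mk (leibnizD (g := g)) (n + 1)) :=
    Cohomology.mk_surjective _ _
  intro z
  induction z with
  | zero =>
    refine ⟨0, (map_zero Ψ).trans (map_zero (biClass hN)).symm, fun t T hT => ?_⟩
    have : contract hg hN T (0 : Cochain g (m + 2)) = 0 := by
      ext y; rw [contract_apply]; exact map_zero T
    refine ⟨this ▸ zero_mem _, ?_⟩
    exact (congrArg (toHR g s) (Subtype.ext this)).trans
      ((map_zero _).trans (contractLeft t).map_zero.symm)
  | tmul x y =>
    obtain ⟨α, rfl⟩ := hmk x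
    obtain ⟨β, rfl⟩ := toHR_surjective s y
    refine ⟨⟨cross α.1 β.1 hN, cross_mem_biCocycles hN α.2 β.2⟩, hΨ α β, fun t T hT => ?_⟩
    have := contract_cross hg hN T α.1 β.1
    rw [hT] at this
    refine ⟨this ▸ Submodule.smul_mem _ _ β.2, ?_⟩
    refine (congrArg (toHR g s) (Subtype.ext this)).trans
      (((toHR g s).map_smul (t (Cohomology.mk (leibnizD (g := g)) (n + 1) α)) β).trans
        (contractLeft_tmul t _ _).symm)
  | add z z' h h' =>
    obtain ⟨f, hf, h⟩ := h
    obtain ⟨f', hf', h'⟩ := h'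
    refine ⟨f + f', ?_, fun t T hT => ?_⟩
    · rw [map_add, hf, hf']; exact (map_add (biClass hN) f f').symm
    · obtain ⟨h1, e1⟩ := h t T hT
      obtain ⟨h2, e2⟩ := h' t T hT
      have : contract hg hN T (f.1 + f'.1) = contract hg hN T f.1 + contract hg hN T f'.1 := by
        ext y
        rw [add_apply, contract_apply, contract_apply, contract_apply, sliceL_add, map_add]
      refine ⟨this ▸ add_mem h1 h2, ?_⟩
      exact (congrArg (toHR g s) (Subtype.ext this)).trans
        (((toHR g s).map_add ⟨_, h1⟩ ⟨_, h2⟩).trans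
          ((congrArg₂ (· + ·) e1 e2).trans ((contractLeft t).map_add z z').symm))

-- A form whose slices are cocycles is a sum of products of arbitrary forms. Projecting the right
-- factors to `hrReps` and then the left factors to the cocycles does not change it, because its
-- slices already lie in these subspaces, and turns each term into a product of cocycles.
set_option maxHeartbeats 1000000 in
theorem biClass_mem_range_of_cross (hs : ∀ (a b k : ℕ) (hk : a + b = k) (f : Cochain g k),
    f ∈ Submodule.span ℝ {h | ∃ (α : Cochain g a) (β : Cochain g b), h = cross α β hk})
    {n s m : ℕ} (hN : n + 1 + (s + 2) = m + 2)
    (Ψ : HL g (n + 1) ⊗[ℝ] HR g s →ₗ[ℝ] Page (rgD g) (rgFiltration g) 2 s m)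
    (hΨ : ∀ α β, Ψ (Cohomology.mk (leibnizD (g := g)) (n + 1) α ⊗ₜ toHR g s β) =
      crossClass hN α β) (p : Page (rgD g) (rgFiltration g) 2 s m) : p ∈ LinearMap.range Ψ := by
  have hg := leftContinuous_of_span hs
  obtain ⟨⟨f, hf⟩, rfl⟩ := biClass_surjective hg hN p
  obtain ⟨π₁, hπ₁⟩ := exists_linear_projection (Cocycles (leibnizD (g := g)) (n + 1))
  obtain ⟨π₂, hπ₂⟩ := exists_linear_projection (hrReps g s)
  -- Here `f''` is the intermediate form, in which only the right factors have been projected.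
  have key : ∀ f ∈ Submodule.span ℝ {h : Cochain g (m + 2) | ∃ α β, h = cross α β hN},
      ∃ f' : biCocycles (g := g) hN, biClass hN f' ∈ LinearMap.range Ψ ∧ ∃ f'' : Cochain g (m + 2),
        (∀ x, sliceR hN f'' x = (π₂ (sliceR hN f x)).1) ∧
          ∀ y, sliceL hN f'.1 y = (π₁ (sliceL hN f'' y)).1 := by
    intro f hf
    induction hf using Submodule.span_induction with
    | mem f h =>
      obtain ⟨α, β, rfl⟩ := h
      refine ⟨⟨cross (π₁ α).1 (π₂ β).1 hN, cross_mem_biCocycles hN (π₁ α).2 (π₂ β).2⟩,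
        ⟨_, hΨ _ _⟩, cross α (π₂ β).1 hN, fun x => ?_, fun y => ?_⟩
      · rw [sliceR_cross, sliceR_cross, map_smul]; rfl
      · rw [sliceL_cross, sliceL_cross, map_smul]; rfl
    | zero =>
      refine ⟨0, by rw [map_zero]; exact zero_mem _, 0, fun x => ?_, fun y => ?_⟩
      · exact (congrArg Subtype.val (map_zero π₂)).symm
      · exact (congrArg Subtype.val (map_zero π₁)).symm
    | add f₁ f₂ _ _ h₁ h₂ =>
      obtain ⟨f₁', h₁, f₁'', h₁', h₁''⟩ := h₁
      obtain ⟨f₂', h₂, f₂'', h₂', h₂''⟩ := h₂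
      refine ⟨f₁' + f₂', by rw [map_add]; exact add_mem h₁ h₂, f₁'' + f₂'', fun x => ?_, fun y => ?_⟩
      · refine (congrArg₂ (· + ·) (h₁' x) (h₂' x)).trans ?_
        exact (congrArg Subtype.val (map_add π₂ (sliceR hN f₁ x) (sliceR hN f₂ x))).symm
      · refine (congrArg₂ (· + ·) (h₁'' y) (h₂'' y)).trans ?_
        exact (congrArg Subtype.val (map_add π₁ (sliceL hN f₁'' y) (sliceL hN f₂'' y))).symm
    | smul c f _ h =>
      obtain ⟨f', h, f'', h', h''⟩ := h
      refine ⟨c • f', by rw [map_smul]; exact Submodule.smul_mem _ _ h, c • f'',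
        fun x => ?_, fun y => ?_⟩
      · refine (congrArg (c • ·) (h' x)).trans ?_
        exact (congrArg Subtype.val (map_smul π₂ c (sliceR hN f x))).symm
      · refine (congrArg (c • ·) (h'' y)).trans ?_
        exact (congrArg Subtype.val (map_smul π₁ c (sliceL hN f'' y))).symm
  obtain ⟨f', hf', f'', h1, h2⟩ := key f (hs _ _ _ hN f)
  have hf'' : f'' = f := ext_glue hN fun x y => by
    have h3 := h1 x
    rw [hπ₂ _ (hf.2 x)] at h3
    exact congrArg (fun β : Cochain g (s + 2) => β y) h3
  subst hf''
  have hff : f' = ⟨f'', hf⟩ := Subtype.ext (ext_glue hN fun x y => by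
    have h3 := h2 y
    rw [hπ₁ _ (hf.1 y)] at h3
    exact congrArg (fun β : Cochain g (n + 1) => β x) h3)
  rw [hff] at hf'
  exact hf'

set_option maxHeartbeats 1000000 in
/-- The tensor product of `HL` and `HR` is the second page, if forms are sums of products. -/
theorem exists_tensor_equiv (hs : ∀ (a b k : ℕ) (hk : a + b = k) (f : Cochain g k),
    f ∈ Submodule.span ℝ {h | ∃ (α : Cochain g a) (β : Cochain g b), h = cross α β hk})
    {n s m : ℕ} (hN : n + 1 + (s + 2) = m + 2) :
    ∃ e : HL g (n + 1) ⊗[ℝ] HR g s ≃ₗ[ℝ] Page (rgD g) (rgFiltration g) 2 s m,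
      ∀ α β, e (Cohomology.mk (leibnizD (g := g)) (n + 1) α ⊗ₜ toHR g s β) =
        crossClass hN α β := by
  have hg := leftContinuous_of_span hs
  have hmk : Function.Surjective (Cohomology.mk (leibnizD (g := g)) (n + 1)) :=
    Cohomology.mk_surjective _ _
  obtain ⟨Ψ, hΨ⟩ := exists_lift_of_surjective (V := Cocycles (leibnizD (g := g)) (n + 1))
    (V' := HL g (n + 1)) (W := hrReps g s) (W' := HR g s) _ hmk (toHR g s) (toHR_surjective s)
    (crossClass hN) (crossClass_eq_zero_left hN) (crossClass_eq_zero_right hN)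
  refine ⟨LinearEquiv.ofBijective Ψ ⟨?_, ?_⟩, hΨ⟩
  · have key := exists_biCocycle_contract hg hN Ψ hΨ
    refine (injective_iff_map_eq_zero Ψ).2 fun z hz => eq_zero_of_forall_contractLeft z fun t => ?_
    -- The form `t` on `HL`, pulled back to cocycles, is extended to all cochains; the extension
    -- vanishes on coboundaries.
    obtain ⟨T, hT⟩ := exists_linear_extension _
      (t.comp (Cohomology.mk (leibnizD (g := g)) (n + 1)))
    have hTd : ∀ α, T (leibnizD n α) = 0 := fun α => by
      refine (hT ⟨leibnizD n α, leibnizD_leibnizD α⟩).trans ?_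
      have : Cohomology.mk (leibnizD (g := g)) (n + 1) ⟨leibnizD n α, leibnizD_leibnizD α⟩ = 0 :=
        (Submodule.Quotient.mk_eq_zero _).2 ⟨α, trivial, rfl⟩
      exact (congrArg t this).trans (map_zero t)
    obtain ⟨f, hf, hfT⟩ := key z
    obtain ⟨h, e⟩ := hfT t T hT
    rw [← e]
    exact toHR_contract_eq_zero hg hN T hTd f (hf ▸ hz)
  · exact fun p => biClass_mem_range_of_cross hs hN Ψ hΨ p

/-- With `K` all of `g`, a cochain vanishing on `K` is zero. Hence the topologies on `HL` and,
below, on `HR` are discrete. -/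
theorem bot_mem_hlOpen (hg : IsLinearlyCompact g) (n : ℕ) : ⊥ ∈ hlOpen g n := by
  refine ⟨⊤, isLinearlyCompact_top hg, fun z hz => ?_⟩
  have : z = 0 := Subtype.ext (ContinuousMultilinearMap.ext fun v => hz v fun _ => trivial)
  rw [this, map_zero]; exact zero_mem _

theorem bot_mem_hrOpen (hg : IsLinearlyCompact g) (n : ℕ) : ⊥ ∈ hrOpen g n := by
  refine ⟨⊤, isLinearlyCompact_top hg, fun z β hzβ hβ => ?_⟩
  have h0 : β = 0 := Subtype.ext (AlternatingMap.ext fun v => ContinuousLinearMap.ext fun h =>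
    hβ v (fun _ => trivial) h trivial)
  have : z = 0 := Subtype.ext (by rw [hzβ, h0, map_zero]; rfl)
  rw [this, map_zero]; exact zero_mem _

set_option maxHeartbeats 1000000 in
theorem exists_completed_equiv_of_proFinite (hg : IsProFiniteDimensional g) {n s m : ℕ}
    (hN : n + 1 + (s + 2) = m + 2) :
    ∃ e : CompletedTensor (hlOpen g (n + 1)) (hrOpen g s) ≃ₗ[ℝ]
        Page (rgD g) (rgFiltration g) 2 s m,
      ∀ (α : Cocycles (leibnizD (g := g)) (n + 1)) (β : hrReps g s),
        e (CompletedTensor.tmul (hlOpen g (n + 1)) (hrOpen g s)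
          (Cohomology.mk (leibnizD (g := g)) (n + 1) α) (toHR g s β)) = crossClass hN α β := by
  have hs : ∀ (a b k : ℕ) (hk : a + b = k) (f : Cochain g k),
      f ∈ Submodule.span ℝ {h | ∃ (α : Cochain g a) (β : Cochain g b), h = cross α β hk} := by
    intro a b k hk f
    obtain ⟨P, hP, h⟩ := exists_finiteDimensional_slices hg.1 hk f
    exact mem_span_cross hk f P h
  obtain ⟨e, he⟩ := exists_tensor_equiv hs hN
  obtain ⟨e', he'⟩ := exists_completed_equiv (E := HL g (n + 1)) (F := HR g s)
    (bot_mem_hlOpen hg.2 (n + 1)) (bot_mem_hrOpen hg.2 s) e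
  refine ⟨e', fun α β => ?_⟩
  have h1 := he' (Cohomology.mk (leibnizD (g := g)) (n + 1) α) (toHR g s β)
  exact h1.trans (he α β)

end CrossPage

/-! ### Dual pairs -/

section DualPair

theorem exists_lift_of_range_le {V X A : Type*} [AddCommGroup V] [Module ℝ V] [AddCommGroup X]
    [Module ℝ X] [AddCommGroup A] [Module ℝ A] (f : V →ₗ[ℝ] X) (h : A →ₗ[ℝ] X)
    (hr : ∀ a, ∃ v, f v = h a) : ∃ σ : A →ₗ[ℝ] V, ∀ a, f (σ a) = h a := by
  obtain ⟨τ, hτ⟩ := exists_linear_section f.rangeRestrict f.surjective_rangeRestrict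
  refine ⟨τ.comp (h.codRestrict (LinearMap.range f) hr), fun a => ?_⟩
  exact congrArg Subtype.val (hτ (h.codRestrict (LinearMap.range f) hr a))

theorem exists_factor_of_ker_le {V X Y : Type*} [AddCommGroup V] [Module ℝ V] [AddCommGroup X]
    [Module ℝ X] [AddCommGroup Y] [Module ℝ Y] (f : V →ₗ[ℝ] X) (h : V →ₗ[ℝ] Y)
    (hk : ∀ v, f v = 0 → h v = 0) : ∃ m : X →ₗ[ℝ] Y, ∀ v, m (f v) = h v := by
  obtain ⟨τ, hτ⟩ := exists_linear_section f.rangeRestrict f.surjective_rangeRestrict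
  obtain ⟨m, hm⟩ := exists_linear_extension (LinearMap.range f) (h.comp τ)
  refine ⟨m, fun v => ?_⟩
  rw [show f v = (f.rangeRestrict v : X) from rfl, hm]
  have h1 : f (τ (f.rangeRestrict v) - v) = 0 := by
    rw [map_sub, sub_eq_zero]
    exact congrArg Subtype.val (hτ (f.rangeRestrict v))
  have h2 := hk _ h1
  rwa [map_sub, sub_eq_zero] at h2

theorem exists_equiv_of_ker_eq {V P Q : Type*} [AddCommGroup V] [Module ℝ V] [AddCommGroup P]
    [Module ℝ P] [AddCommGroup Q] [Module ℝ Q] (f : V →ₗ[ℝ] P) (h : V →ₗ[ℝ] Q)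
    (hf : Function.Surjective f) (hh : Function.Surjective h) (hk : ∀ v, f v = 0 ↔ h v = 0) :
    ∃ e : P ≃ₗ[ℝ] Q, ∀ v, e (f v) = h v := by
  obtain ⟨m, hm⟩ := exists_factor_of_ker_le f h fun v => (hk v).1
  refine ⟨LinearEquiv.ofBijective m ⟨?_, fun y => ?_⟩, hm⟩
  · refine (injective_iff_map_eq_zero m).2 fun x hx => ?_
    obtain ⟨v, rfl⟩ := hf x
    rw [hm] at hx
    exact (hk v).2 hx
  · obtain ⟨v, rfl⟩ := hh y
    exact ⟨f v, hm v⟩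

variable {C C' : Type*} [AddCommGroup C] [Module ℝ C] [AddCommGroup C'] [Module ℝ C']

/-- `C` is the full algebraic dual of the space `T` of linear forms on `C`. -/
structure IsDualPair (T : Submodule ℝ (C →ₗ[ℝ] ℝ)) : Prop where
  separating : ∀ c, (∀ t ∈ T, t c = 0) → c = 0
  represents : ∀ ℓ : T →ₗ[ℝ] ℝ, ∃ c, ∀ t : T, t.1 c = ℓ t

/-- Subspaces that are annihilators of sets of forms in `T`. -/
def IsWeaklyClosed (T : Submodule ℝ (C →ₗ[ℝ] ℝ)) (Z : Submodule ℝ C) : Prop :=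
  ∀ c, (∀ t ∈ T, (∀ z ∈ Z, t z = 0) → t c = 0) → c ∈ Z

/-- The forms on the target of `q` that come from forms in `T`. -/
def inducedForms (T : Submodule ℝ (C →ₗ[ℝ] ℝ)) {Z : Submodule ℝ C} {E : Type*} [AddCommGroup E]
    [Module ℝ E] (q : Z →ₗ[ℝ] E) : Submodule ℝ (E →ₗ[ℝ] ℝ) where
  carrier := {a | ∃ t ∈ T, ∀ z : Z, a (q z) = t z}
  add_mem' := by
    rintro a a' ⟨t, ht, h⟩ ⟨t', ht', h'⟩
    exact ⟨t + t', add_mem ht ht', fun z => congrArg₂ (· + ·) (h z) (h' z)⟩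
  zero_mem' := ⟨0, zero_mem _, fun z => rfl⟩
  smul_mem' := by
    rintro c a ⟨t, ht, h⟩
    exact ⟨c • t, Submodule.smul_mem _ c ht, fun z => congrArg (c • ·) (h z)⟩

section Subquotient

variable {T : Submodule ℝ (C →ₗ[ℝ] ℝ)} {Z : Submodule ℝ C} {E : Type*} [AddCommGroup E]
  [Module ℝ E] {q : Z →ₗ[ℝ] E}

theorem exists_mem_inducedForms {t : C →ₗ[ℝ] ℝ} (ht : t ∈ T)
    (h : ∀ z : Z, q z = 0 → t z = 0) : ∃ a ∈ inducedForms T q, ∀ z : Z, a (q z) = t z := by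
  obtain ⟨a, ha⟩ := exists_factor_of_ker_le (V := Z) q (t.comp Z.subtype) h
  exact ⟨a, ⟨t, ht, ha⟩, ha⟩

/-- Lifting induced forms, and restricting forms in `T`. -/
theorem exists_lift_inducedForms (hq : Function.Surjective q) :
    ∃ (r : T →ₗ[ℝ] inducedForms T q) (l : inducedForms T q →ₗ[ℝ] T),
      (∀ a (z : Z), (l a).1 z = a.1 (q z)) ∧
      ∀ t : T, (∀ z : Z, q z = 0 → t.1 z = 0) → ∀ z : Z, (r t).1 (q z) = t.1 z := by
  let f : T →ₗ[ℝ] Z →ₗ[ℝ] ℝ := (LinearMap.lcomp ℝ ℝ Z.subtype).comp T.subtype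
  let h : inducedForms T q →ₗ[ℝ] Z →ₗ[ℝ] ℝ :=
    (LinearMap.lcomp ℝ ℝ q).comp (inducedForms T q).subtype
  have hinj : ∀ a, h a = 0 → a = 0 := fun a ha => Subtype.ext (LinearMap.ext fun e => by
    obtain ⟨z, rfl⟩ := hq e
    exact LinearMap.congr_fun ha z)
  obtain ⟨l, hl⟩ := exists_lift_of_range_le (V := T) (X := Z →ₗ[ℝ] ℝ)
    (A := inducedForms T q) f h fun a => by
    obtain ⟨t, ht, hta⟩ := a.2
    exact ⟨⟨t, ht⟩, LinearMap.ext fun z => (hta z).symm⟩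
  -- The restriction is defined on all of `T` by an arbitrary linear extension; it is meaningful
  -- only for forms that vanish on `ker q`.
  obtain ⟨m, hm⟩ := exists_factor_of_ker_le (V := inducedForms T q)
    (X := Z →ₗ[ℝ] ℝ) (Y := inducedForms T q) h LinearMap.id hinj
  refine ⟨m.comp f, l, fun a z => LinearMap.congr_fun (hl a) z, fun t ht z => ?_⟩
  obtain ⟨a, ha, hat⟩ := exists_mem_inducedForms t.2 ht
  have h1 : f t = h ⟨a, ha⟩ := LinearMap.ext fun z => (hat z).symm
  rw [← hat z, LinearMap.comp_apply, h1, hm]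
  rfl

/-- Duality passes to subquotients by weakly closed subspaces; `hk` says that `ker q` is weakly
closed in `Z`. A form on the induced forms is extended to the restrictions to `Z` of all forms in
`T` and is then represented by an element `c`. -/
theorem IsDualPair.inducedForms (hT : IsDualPair T) (hZ : IsWeaklyClosed T Z)
    (hq : Function.Surjective q)
    (hk : ∀ z : Z, (∀ t ∈ T, (∀ z' : Z, q z' = 0 → t z' = 0) → t z = 0) → q z = 0) :
    IsDualPair (inducedForms T q) where
  separating e he := by
    obtain ⟨z, rfl⟩ := hq e
    refine hk z fun t ht htk => ?_
    obtain ⟨a, ha, hat⟩ := exists_mem_inducedForms ht htk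
    rw [← hat]; exact he a ha
  represents ℓ := by
    let f : T →ₗ[ℝ] Z →ₗ[ℝ] ℝ := (LinearMap.lcomp ℝ ℝ Z.subtype).comp T.subtype
    obtain ⟨r, l, hl, -⟩ := exists_lift_inducedForms (T := T) hq
    have hfl : ∀ a, f (l a) = 0 → a = 0 := fun a ha => Subtype.ext (LinearMap.ext fun e => by
      obtain ⟨z, rfl⟩ := hq e
      exact (hl a z).symm.trans (LinearMap.congr_fun ha z))
    obtain ⟨m, hm⟩ := exists_factor_of_ker_le (V := Leibniz.inducedForms T q)
      (X := Z →ₗ[ℝ] ℝ) (Y := ℝ) (f.comp l) ℓ fun a ha => by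
      rw [hfl a ha, map_zero]
    obtain ⟨c, hc⟩ := hT.represents (m.comp f)
    -- The value of a form in `T` at `c` depends only on its restriction to `Z`, so that weak
    -- closedness applies.
    have hcZ : c ∈ Z := hZ c fun t ht htZ => by
      have h1 : f ⟨t, ht⟩ = 0 := LinearMap.ext fun z => htZ z z.2
      rw [hc ⟨t, ht⟩, LinearMap.comp_apply, h1, map_zero]
    refine ⟨q ⟨c, hcZ⟩, fun a => ?_⟩
    rw [← hl a ⟨c, hcZ⟩, hc, LinearMap.comp_apply]
    exact hm a

end Subquotient

/-- The sum of a weakly closed subspace and of the image of a weakly closed subspace under a weakly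
continuous map is weakly closed. -/
theorem IsDualPair.exists_sub_mem {T : Submodule ℝ (C →ₗ[ℝ] ℝ)} {T' : Submodule ℝ (C' →ₗ[ℝ] ℝ)}
    (hT' : IsDualPair T') (d : C' →ₗ[ℝ] C) (hd : ∀ t ∈ T, t.comp d ∈ T') {S : Submodule ℝ C}
    (hS : IsWeaklyClosed T S) {Y : Submodule ℝ C'} (hY : IsWeaklyClosed T' Y) (c : C)
    (hc : ∀ t ∈ T, (∀ z ∈ S, t z = 0) → (∀ y ∈ Y, t (d y) = 0) → t c = 0) :
    ∃ y ∈ Y, c - d y ∈ S := by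
  let TS : Submodule ℝ (C →ₗ[ℝ] ℝ) := T ⊓ S.dualAnnihilator
  let TY : Submodule ℝ (C' →ₗ[ℝ] ℝ) := T' ⊓ Y.dualAnnihilator
  -- The element `y` must satisfy `t (d y) = t c` for all `t` vanishing on `S`, and `u y = 0` for
  -- all `u` vanishing on `Y`. This prescribes a form on the sums `t ∘ d + u`, well defined by `hc`;
  -- it extends to `T'` and is represented by the desired `y`.
  let f : TS × TY →ₗ[ℝ] T' :=
    { toFun := fun p => ⟨p.1.1.comp d + p.2.1, add_mem (hd _ p.1.2.1) p.2.2.1⟩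
      map_add' := fun p p' => Subtype.ext (LinearMap.ext fun x => by
        simp only [Prod.fst_add, Prod.snd_add, Submodule.coe_add, LinearMap.add_apply,
          LinearMap.comp_apply]
        ring)
      map_smul' := fun c p => Subtype.ext (LinearMap.ext fun x => by
        simp) }
  let h : TS × TY →ₗ[ℝ] ℝ := (LinearMap.applyₗ c).comp (TS.subtype.comp (LinearMap.fst ℝ _ _))
  obtain ⟨ℓ, hℓ⟩ := exists_factor_of_ker_le (V := TS × TY) (X := T') (Y := ℝ) f h fun p hp => by
    refine hc _ p.1.2.1 (fun z hz => (Submodule.mem_dualAnnihilator _).1 p.1.2.2 z hz)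
      fun y hy => ?_
    have h1 : p.1.1 (d y) + p.2.1 y = 0 := LinearMap.congr_fun (congrArg Subtype.val hp) y
    rwa [(Submodule.mem_dualAnnihilator _).1 p.2.2.2 y hy, add_zero] at h1
  obtain ⟨y, hy⟩ := hT'.represents ℓ
  refine ⟨y, hY y fun t ht htY => ?_, hS _ fun t ht htS => ?_⟩
  · have h1 := hℓ (0, ⟨t, ht, (Submodule.mem_dualAnnihilator _).2 htY⟩)
    rw [← hy] at h1
    simpa [f, h] using h1
  · have h1 := hℓ (⟨t, ht, (Submodule.mem_dualAnnihilator _).2 htS⟩, 0)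
    rw [← hy] at h1
    have h2 : t (d y) = t c := by simpa [f, h] using h1
    rw [map_sub, h2, sub_self]

end DualPair

/-! ### The completed tensor product of spaces with open subspaces of finite codimension -/

section CompletedFinite

open TensorProduct

variable {E F : Type u} [AddCommGroup E] [Module ℝ E] [AddCommGroup F] [Module ℝ F]

/-- The open subspaces of a linear topology for which these have finite codimension. -/
structure IsFiniteTopology (𝒰 : Set (Submodule ℝ E)) : Prop where
  top_mem : ⊤ ∈ 𝒰
  mem_of_le : ∀ U ∈ 𝒰, ∀ U', U ≤ U' → U' ∈ 𝒰
  inf_mem : ∀ U ∈ 𝒰, ∀ U' ∈ 𝒰, U ⊓ U' ∈ 𝒰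
  finite : ∀ U ∈ 𝒰, FiniteDimensional ℝ (E ⧸ U)

/-- The continuous linear forms. -/
def openForms {𝒰 : Set (Submodule ℝ E)} (h : IsFiniteTopology 𝒰) : Submodule ℝ (E →ₗ[ℝ] ℝ) where
  carrier := {a | LinearMap.ker a ∈ 𝒰}
  add_mem' ha ha' := h.mem_of_le _ (h.inf_mem _ ha _ ha') _ fun x hx => by
    rw [LinearMap.mem_ker, LinearMap.add_apply, LinearMap.mem_ker.1 hx.1, LinearMap.mem_ker.1 hx.2,
      add_zero]
  zero_mem' := by
    have h0 : LinearMap.ker (0 : E →ₗ[ℝ] ℝ) = ⊤ := LinearMap.ker_zero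
    show LinearMap.ker (0 : E →ₗ[ℝ] ℝ) ∈ 𝒰
    rw [h0]; exact h.top_mem
  smul_mem' c a ha := h.mem_of_le _ ha _ fun x hx => by
    rw [LinearMap.mem_ker, LinearMap.smul_apply, LinearMap.mem_ker.1 hx, smul_zero]

/-- The pairing of a tensor with two linear forms. -/
def pairing (a : E →ₗ[ℝ] ℝ) (b : F →ₗ[ℝ] ℝ) : E ⊗[ℝ] F →ₗ[ℝ] ℝ :=
  b.comp (contractLeft a)

theorem pairing_tmul (a : E →ₗ[ℝ] ℝ) (b : F →ₗ[ℝ] ℝ) (x : E) (y : F) :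
    pairing a b (x ⊗ₜ y) = a x * b y := by
  rw [pairing, LinearMap.comp_apply, contractLeft_tmul, map_smul, smul_eq_mul]

theorem eq_of_forall_pairing {z z' : E ⊗[ℝ] F} (h : ∀ a b, pairing a b z = pairing a b z') :
    z = z' := by
  rw [← sub_eq_zero]
  refine eq_zero_of_forall_contractLeft _ fun a => ?_
  rw [← Module.forall_dual_apply_eq_zero_iff ℝ]
  intro b
  rw [map_sub, map_sub, sub_eq_zero]
  exact h a b

theorem exists_tensor_of_bilin [FiniteDimensional ℝ E] [FiniteDimensional ℝ F]
    (β : (E →ₗ[ℝ] ℝ) →ₗ[ℝ] (F →ₗ[ℝ] ℝ) →ₗ[ℝ] ℝ) :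
    ∃ z : E ⊗[ℝ] F, ∀ a b, pairing a b z = β a b := by
  obtain ⟨n, x, c, hx⟩ := exists_finite_coordinates E
  obtain ⟨n', y, c', hy⟩ := exists_finite_coordinates F
  refine ⟨∑ i, ∑ j, β (c i) (c' j) • x i ⊗ₜ[ℝ] y j, fun a b => ?_⟩
  have ha : a = ∑ i, a (x i) • c i := LinearMap.ext fun e => by
    conv_lhs => rw [← hx e]
    simp [mul_comm]
  have hb : b = ∑ j, b (y j) • c' j := LinearMap.ext fun e => by
    conv_lhs => rw [← hy e]
    simp [mul_comm]
  have h1 : β a b = ∑ i, a (x i) * β (c i) b := by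
    conv_lhs => rw [ha]
    rw [map_sum, LinearMap.sum_apply]
    refine Finset.sum_congr rfl fun i _ => ?_
    rw [map_smul, LinearMap.smul_apply, smul_eq_mul]
  have h2 : ∀ i, β (c i) b = ∑ j, b (y j) * β (c i) (c' j) := fun i => by
    conv_lhs => rw [hb]
    rw [map_sum]
    refine Finset.sum_congr rfl fun j _ => ?_
    rw [map_smul, smul_eq_mul]
  rw [h1, map_sum]
  refine Finset.sum_congr rfl fun i _ => ?_
  rw [h2, map_sum, Finset.mul_sum]
  refine Finset.sum_congr rfl fun j _ => ?_
  rw [map_smul, pairing_tmul, smul_eq_mul]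
  ring

theorem pairing_map {E' F' : Type u} [AddCommGroup E'] [Module ℝ E'] [AddCommGroup F']
    [Module ℝ F'] (p : E →ₗ[ℝ] E') (p' : F →ₗ[ℝ] F') (a : E' →ₗ[ℝ] ℝ) (b : F' →ₗ[ℝ] ℝ)
    (z : E ⊗[ℝ] F) :
    pairing a b (TensorProduct.map p p' z) = pairing (a.comp p) (b.comp p') z := by
  induction z with
  | zero => rw [map_zero, map_zero, map_zero]
  | tmul x y => rw [TensorProduct.map_tmul, pairing_tmul, pairing_tmul]; rfl
  | add z z' h h' => rw [map_add, map_add, map_add, h, h']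

variable {𝒰 : Set (Submodule ℝ E)} {𝒲 : Set (Submodule ℝ F)}

/-- Compatibility of the family makes the pairing independent of the open subspaces through which
the forms factor. To compare several forms, a common open subspace can therefore be used. -/
theorem pairing_liftQ (t : CompletedTensor 𝒰 𝒲) {U U' : 𝒰} {W W' : 𝒲} (hU : U.1 ≤ U'.1)
    (hW : W.1 ≤ W'.1) (a : E →ₗ[ℝ] ℝ) (b : F →ₗ[ℝ] ℝ) (ha : U'.1 ≤ LinearMap.ker a)
    (hb : W'.1 ≤ LinearMap.ker b) :
    pairing (U.1.liftQ a (hU.trans ha)) (W.1.liftQ b (hW.trans hb)) (t.1 U W) =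
      pairing (U'.1.liftQ a ha) (W'.1.liftQ b hb) (t.1 U' W') := by
  rw [← t.2 U U' W W' hU hW, pairing_map]
  have h1 : U.1.liftQ a (hU.trans ha) = (U'.1.liftQ a ha).comp (Submodule.factor hU) :=
    Submodule.linearMap_qext _ rfl
  have h2 : W.1.liftQ b (hW.trans hb) = (W'.1.liftQ b hb).comp (Submodule.factor hW) :=
    Submodule.linearMap_qext _ rfl
  rw [h1, h2]

/-- The pairing of an element of the completed tensor product with two continuous forms. -/
def openPairing (hU : IsFiniteTopology 𝒰) (hW : IsFiniteTopology 𝒲) (t : CompletedTensor 𝒰 𝒲)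
    (a : openForms hU) (b : openForms hW) : ℝ :=
  pairing ((LinearMap.ker a.1).liftQ a.1 le_rfl) ((LinearMap.ker b.1).liftQ b.1 le_rfl)
    (t.1 ⟨_, a.2⟩ ⟨_, b.2⟩)

theorem openPairing_eq (hU : IsFiniteTopology 𝒰) (hW : IsFiniteTopology 𝒲)
    (t : CompletedTensor 𝒰 𝒲) (a : openForms hU) (b : openForms hW) (U : 𝒰) (W : 𝒲)
    (ha : U.1 ≤ LinearMap.ker a.1) (hb : W.1 ≤ LinearMap.ker b.1) :
    openPairing hU hW t a b = pairing (U.1.liftQ a.1 ha) (W.1.liftQ b.1 hb) (t.1 U W) :=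
  (pairing_liftQ t (U' := ⟨_, a.2⟩) (W' := ⟨_, b.2⟩) ha hb a.1 b.1 le_rfl le_rfl).symm

theorem openPairing_add_left (hU : IsFiniteTopology 𝒰) (hW : IsFiniteTopology 𝒲)
    (t : CompletedTensor 𝒰 𝒲) (a a' : openForms hU) (b : openForms hW) :
    openPairing hU hW t (a + a') b = openPairing hU hW t a b + openPairing hU hW t a' b := by
  have h : LinearMap.ker a.1 ⊓ LinearMap.ker a'.1 ≤ LinearMap.ker (a + a').1 := fun x hx => by
    rw [LinearMap.mem_ker, Submodule.coe_add, LinearMap.add_apply, LinearMap.mem_ker.1 hx.1,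
      LinearMap.mem_ker.1 hx.2, add_zero]
  rw [openPairing_eq hU hW t _ b ⟨_, hU.inf_mem _ a.2 _ a'.2⟩ ⟨_, b.2⟩ h le_rfl,
    openPairing_eq hU hW t a b ⟨_, hU.inf_mem _ a.2 _ a'.2⟩ ⟨_, b.2⟩ inf_le_left le_rfl,
    openPairing_eq hU hW t a' b ⟨_, hU.inf_mem _ a.2 _ a'.2⟩ ⟨_, b.2⟩ inf_le_right le_rfl]
  generalize t.1 _ _ = z
  induction z with
  | zero => simp
  | tmul x y =>
    obtain ⟨x, rfl⟩ := Submodule.mkQ_surjective _ x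
    obtain ⟨y, rfl⟩ := Submodule.mkQ_surjective _ y
    simp [pairing_tmul, add_mul]
  | add z z' h h' => simp only [map_add, h, h']; ring

theorem openPairing_smul_left (hU : IsFiniteTopology 𝒰) (hW : IsFiniteTopology 𝒲)
    (t : CompletedTensor 𝒰 𝒲) (c : ℝ) (a : openForms hU) (b : openForms hW) :
    openPairing hU hW t (c • a) b = c * openPairing hU hW t a b := by
  have h : LinearMap.ker a.1 ≤ LinearMap.ker (c • a).1 := fun x hx => by
    rw [LinearMap.mem_ker, Submodule.coe_smul, LinearMap.smul_apply, LinearMap.mem_ker.1 hx,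
      smul_zero]
  rw [openPairing_eq hU hW t _ b ⟨_, a.2⟩ ⟨_, b.2⟩ h le_rfl, openPairing]
  generalize t.1 _ _ = z
  induction z with
  | zero => simp
  | tmul x y =>
    obtain ⟨x, rfl⟩ := Submodule.mkQ_surjective _ x
    obtain ⟨y, rfl⟩ := Submodule.mkQ_surjective _ y
    simp [pairing_tmul, mul_assoc]
  | add z z' h h' => simp only [map_add, h, h']; ring

theorem openPairing_add_right (hU : IsFiniteTopology 𝒰) (hW : IsFiniteTopology 𝒲)
    (t : CompletedTensor 𝒰 𝒲) (a : openForms hU) (b b' : openForms hW) :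
    openPairing hU hW t a (b + b') = openPairing hU hW t a b + openPairing hU hW t a b' := by
  have h : LinearMap.ker b.1 ⊓ LinearMap.ker b'.1 ≤ LinearMap.ker (b + b').1 := fun x hx => by
    rw [LinearMap.mem_ker, Submodule.coe_add, LinearMap.add_apply, LinearMap.mem_ker.1 hx.1,
      LinearMap.mem_ker.1 hx.2, add_zero]
  rw [openPairing_eq hU hW t a _ ⟨_, a.2⟩ ⟨_, hW.inf_mem _ b.2 _ b'.2⟩ le_rfl h,
    openPairing_eq hU hW t a b ⟨_, a.2⟩ ⟨_, hW.inf_mem _ b.2 _ b'.2⟩ le_rfl inf_le_left,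
    openPairing_eq hU hW t a b' ⟨_, a.2⟩ ⟨_, hW.inf_mem _ b.2 _ b'.2⟩ le_rfl inf_le_right]
  generalize t.1 _ _ = z
  induction z with
  | zero => simp
  | tmul x y =>
    obtain ⟨x, rfl⟩ := Submodule.mkQ_surjective _ x
    obtain ⟨y, rfl⟩ := Submodule.mkQ_surjective _ y
    simp [pairing_tmul, mul_add]
  | add z z' h h' => simp only [map_add, h, h']; ring

theorem openPairing_smul_right (hU : IsFiniteTopology 𝒰) (hW : IsFiniteTopology 𝒲)
    (t : CompletedTensor 𝒰 𝒲) (c : ℝ) (a : openForms hU) (b : openForms hW) :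
    openPairing hU hW t a (c • b) = c * openPairing hU hW t a b := by
  have h : LinearMap.ker b.1 ≤ LinearMap.ker (c • b).1 := fun x hx => by
    rw [LinearMap.mem_ker, Submodule.coe_smul, LinearMap.smul_apply, LinearMap.mem_ker.1 hx,
      smul_zero]
  rw [openPairing_eq hU hW t a _ ⟨_, a.2⟩ ⟨_, b.2⟩ le_rfl h, openPairing]
  generalize t.1 _ _ = z
  induction z with
  | zero => simp
  | tmul x y =>
    obtain ⟨x, rfl⟩ := Submodule.mkQ_surjective _ x
    obtain ⟨y, rfl⟩ := Submodule.mkQ_surjective _ y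
    simp [pairing_tmul, mul_left_comm]
  | add z z' h h' => simp only [map_add, h, h']; ring

/-- An element of the completed tensor product as a bilinear form on the continuous duals. -/
def toBilin (hU : IsFiniteTopology 𝒰) (hW : IsFiniteTopology 𝒲) :
    CompletedTensor 𝒰 𝒲 →ₗ[ℝ] openForms hU →ₗ[ℝ] openForms hW →ₗ[ℝ] ℝ where
  toFun t := LinearMap.mk₂ ℝ (openPairing hU hW t) (openPairing_add_left hU hW t)
    (openPairing_smul_left hU hW t) (openPairing_add_right hU hW t)
    (fun c => openPairing_smul_right hU hW t c)
  map_add' t t' := LinearMap.ext₂ fun a b => by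
    show openPairing hU hW (t + t') a b = openPairing hU hW t a b + openPairing hU hW t' a b
    exact (pairing _ _).map_add _ _
  map_smul' c t := LinearMap.ext₂ fun a b => by
    show openPairing hU hW (c • t) a b = c • openPairing hU hW t a b
    exact (pairing _ _).map_smul c _

theorem toBilin_apply (hU : IsFiniteTopology 𝒰) (hW : IsFiniteTopology 𝒲)
    (t : CompletedTensor 𝒰 𝒲) (a : openForms hU) (b : openForms hW) (U : 𝒰) (W : 𝒲)
    (ha : U.1 ≤ LinearMap.ker a.1) (hb : W.1 ≤ LinearMap.ker b.1) :
    toBilin hU hW t a b = pairing (U.1.liftQ a.1 ha) (W.1.liftQ b.1 hb) (t.1 U W) :=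
  openPairing_eq hU hW t a b U W ha hb

theorem toBilin_tmul (hU : IsFiniteTopology 𝒰) (hW : IsFiniteTopology 𝒲) (x : E) (y : F)
    (a : openForms hU) (b : openForms hW) :
    toBilin hU hW (CompletedTensor.tmul 𝒰 𝒲 x y) a b = a.1 x * b.1 y :=
  pairing_tmul _ _ _ _

/-- A form on a quotient by an open subspace as a continuous form. -/
def liftForm (hU : IsFiniteTopology 𝒰) (U : 𝒰) : (E ⧸ U.1 →ₗ[ℝ] ℝ) →ₗ[ℝ] openForms hU :=
  (LinearMap.lcomp ℝ ℝ U.1.mkQ).codRestrict _ fun a => hU.mem_of_le _ U.2 _ fun x hx => by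
    exact (congrArg a ((Submodule.Quotient.mk_eq_zero U.1).2 hx)).trans (map_zero a)

theorem le_ker_liftForm (hU : IsFiniteTopology 𝒰) (U : 𝒰) (a : E ⧸ U.1 →ₗ[ℝ] ℝ) :
    U.1 ≤ LinearMap.ker (liftForm hU U a).1 := fun x hx => by
  exact (congrArg a ((Submodule.Quotient.mk_eq_zero U.1).2 hx)).trans (map_zero a)

theorem liftQ_liftForm (hU : IsFiniteTopology 𝒰) (U : 𝒰) (a : E ⧸ U.1 →ₗ[ℝ] ℝ) :
    U.1.liftQ (liftForm hU U a).1 (le_ker_liftForm hU U a) = a :=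
  Submodule.linearMap_qext _ rfl

theorem toBilin_liftForm (hU : IsFiniteTopology 𝒰) (hW : IsFiniteTopology 𝒲)
    (t : CompletedTensor 𝒰 𝒲) (U : 𝒰) (W : 𝒲) (a : E ⧸ U.1 →ₗ[ℝ] ℝ) (b : F ⧸ W.1 →ₗ[ℝ] ℝ) :
    toBilin hU hW t (liftForm hU U a) (liftForm hW W b) = pairing a b (t.1 U W) := by
  rw [toBilin_apply hU hW t _ _ U W (le_ker_liftForm hU U a) (le_ker_liftForm hW W b),
    liftQ_liftForm, liftQ_liftForm]

/-- The continuous dual is the union of the duals of the finite-dimensional quotients by open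
subspaces. Tensors on these quotients are bilinear forms on their duals, and compatible families are
bilinear forms on the unions. -/
theorem toBilin_bijective (hU : IsFiniteTopology 𝒰) (hW : IsFiniteTopology 𝒲) :
    Function.Bijective (toBilin hU hW) := by
  constructor
  · intro t t' h
    refine Subtype.ext (funext fun U => funext fun W => eq_of_forall_pairing fun a b => ?_)
    rw [← toBilin_liftForm hU hW, ← toBilin_liftForm hU hW, h]
  · intro β
    have h1 : ∀ (U : 𝒰) (W : 𝒲), ∃ z : (E ⧸ U.1) ⊗[ℝ] (F ⧸ W.1), ∀ a b,
        pairing a b z = β (liftForm hU U a) (liftForm hW W b) := fun U W => by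
      have := hU.finite _ U.2
      have := hW.finite _ W.2
      exact exists_tensor_of_bilin (β.compl₁₂ (liftForm hU U) (liftForm hW W))
    choose t ht using h1
    refine ⟨⟨t, fun U U' W W' hUU hWW => eq_of_forall_pairing fun a b => ?_⟩,
      LinearMap.ext₂ fun a b => ?_⟩
    · rw [pairing_map, ht, ht]
      rfl
    · rw [toBilin_apply hU hW _ a b ⟨_, a.2⟩ ⟨_, b.2⟩ le_rfl le_rfl, ht]
      rfl

/-- If `F` is the dual of its continuous dual, elements of the completed tensor product are linear
maps from the continuous dual of `E` to `F`. -/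
theorem exists_completed_equiv_hom (hU : IsFiniteTopology 𝒰) (hW : IsFiniteTopology 𝒲)
    (hF : IsDualPair (openForms hW)) :
    ∃ e : CompletedTensor 𝒰 𝒲 ≃ₗ[ℝ] (openForms hU →ₗ[ℝ] F),
      ∀ x y a, e (CompletedTensor.tmul 𝒰 𝒲 x y) a = a.1 x • y := by
  -- Evaluation identifies `F` with the full dual of its continuous dual; bilinear forms thereby
  -- become linear maps to `F`.
  let ev : F →ₗ[ℝ] openForms hW →ₗ[ℝ] ℝ := LinearMap.flip (openForms hW).subtype
  have hev : Function.Bijective ev :=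
    ⟨(injective_iff_map_eq_zero ev).2 fun y hy => hF.separating y fun b hb =>
      LinearMap.congr_fun hy ⟨b, hb⟩, fun ℓ => (hF.represents ℓ).imp fun y hy => LinearMap.ext hy⟩
  let ev' := LinearEquiv.ofBijective ev hev
  refine ⟨(LinearEquiv.ofBijective _ (toBilin_bijective hU hW)).trans
    (LinearEquiv.congrRight ev'.symm), fun x y a => ?_⟩
  show ev'.symm (toBilin hU hW (CompletedTensor.tmul 𝒰 𝒲 x y) a) = a.1 x • y
  rw [LinearEquiv.symm_apply_eq]
  ext b
  rw [toBilin_tmul]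
  show _ = b.1 (a.1 x • y)
  rw [map_smul, smul_eq_mul]

theorem exists_completed_equiv_of_hom (hU : IsFiniteTopology 𝒰) (hW : IsFiniteTopology 𝒲)
    {T : Submodule ℝ (E →ₗ[ℝ] ℝ)} (hT : openForms hU = T) {T' : Submodule ℝ (F →ₗ[ℝ] ℝ)}
    (hT' : openForms hW = T') (hF : IsDualPair T') {P : Type*} [AddCommGroup P] [Module ℝ P]
    (e' : P ≃ₗ[ℝ] T →ₗ[ℝ] F) :
    ∃ e : CompletedTensor 𝒰 𝒲 ≃ₗ[ℝ] P, ∀ x y p, (∀ a, e' p a = a.1 x • y) →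
      e (CompletedTensor.tmul 𝒰 𝒲 x y) = p := by
  subst hT hT'
  obtain ⟨e, he⟩ := exists_completed_equiv_hom hU hW hF
  refine ⟨e.trans e'.symm, fun x y p h => ?_⟩
  show e'.symm (e (CompletedTensor.tmul 𝒰 𝒲 x y)) = p
  rw [LinearEquiv.symm_apply_eq]
  exact LinearMap.ext fun a => (he x y a).trans (h a).symm

end CompletedFinite

/-! ### Linear compactness of discrete spaces -/

section LinearCompactness

variable {M : Type u} [AddCommGroup M] [Module ℝ M] [TopologicalSpace M]

/-- The affine hyperplanes on which a basis coordinate equals `1` have the finite intersection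
property. At a common point all coordinates are `1`, so that the basis is finite. -/
theorem IsLinearlyCompact.finiteDimensional [DiscreteTopology M] (h : IsLinearlyCompact M) :
    FiniteDimensional ℝ M := by
  classical
  let b := Module.Basis.ofVectorSpace ℝ M
  obtain ⟨y, hy⟩ := h (Set.range fun i => {y | b.coord i y = 1}) (by
      rintro _ ⟨i, rfl⟩
      refine ⟨LinearMap.ker (b.coord i), b i, isClosed_discrete _, Set.ext fun y => ?_⟩
      show b.coord i y = 1 ↔ b.coord i (y - b i) = 0
      rw [map_sub, sub_eq_zero]
      simp) (by
      intro t ht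
      rw [← Set.image_univ] at ht
      obtain ⟨s, -, rfl⟩ := Finset.subset_set_image_iff.1 ht
      refine ⟨∑ i ∈ s, b i, ?_⟩
      intro A hA
      obtain ⟨i, hi, rfl⟩ := Finset.mem_image.1 (Finset.mem_coe.1 hA)
      show b.coord i (∑ j ∈ s, b j) = 1
      rw [map_sum, Finset.sum_eq_single i]
      · simp
      · intro j _ hj; simp [hj]
      · exact fun h => absurd hi h)
  have hy' : ∀ i, b.repr y i = 1 := fun i => hy _ ⟨i, rfl⟩
  have hfin : Finite (Module.Basis.ofVectorSpaceIndex ℝ M) := by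
    refine Set.finite_univ_iff.1 ((b.repr y).support.finite_toSet.subset fun i _ => ?_)
    rw [Finset.mem_coe, Finsupp.mem_support_iff, hy']
    exact one_ne_zero
  exact Module.Finite.of_basis b

/-- Some finite intersection has a minimal direction. Intersecting it with a further member leaves a
nonempty affine subspace of the same direction, hence the same subspace; so each of its points is
common to all members. -/
theorem isLinearlyCompact_of_finiteDimensional [FiniteDimensional ℝ M] : IsLinearlyCompact M := by
  classical
  intro 𝒜 h𝒜 hfin
  choose! N x _ hA using h𝒜
  let 𝒮 : Set (Submodule ℝ M) :=
    {P | ∃ t : Finset (Set M), (t : Set (Set M)) ⊆ 𝒜 ∧ P = t.inf N}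
  obtain ⟨P, ⟨t, ht, rfl⟩, hmin⟩ := wellFounded_lt.has_min 𝒮 ⟨_, ∅, by simp, rfl⟩
  have hmem : ∀ A ∈ 𝒜, ∀ y z, y ∈ A → (z ∈ A ↔ z - y ∈ N A) := fun A hA' y z hy => by
    have hy' : y - x A ∈ N A := (Set.ext_iff.1 (hA A hA') y).1 hy
    refine (Set.ext_iff.1 (hA A hA') z).trans ⟨fun hz => ?_, fun hz => ?_⟩
    · have := sub_mem (show z - x A ∈ N A from hz) hy'
      rwa [sub_sub_sub_cancel_right] at this
    · have := add_mem hz hy'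
      rw [sub_add_sub_cancel] at this
      exact this
  obtain ⟨y, hy⟩ := hfin t ht
  refine ⟨y, fun A hA' => ?_⟩
  have ht' : ((insert A t : Finset (Set M)) : Set (Set M)) ⊆ 𝒜 := by
    rw [Finset.coe_insert]; exact Set.insert_subset hA' ht
  obtain ⟨z, hz⟩ := hfin _ ht'
  have hle : t.inf N ≤ N A := by
    by_contra hn
    refine hmin _ ⟨_, ht', rfl⟩ ?_
    rw [Finset.inf_insert]
    exact lt_of_le_of_ne inf_le_right fun h => hn (h ▸ inf_le_left)
  have hyz : y - z ∈ t.inf N := by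
    rw [Submodule.mem_finsetInf]
    intro B hB
    exact (hmem B (ht hB) z y (hz B (by simp [hB]))).1 (hy B hB)
  exact (hmem A hA' z y (hz A (by simp))).2 (hle hyz)

theorem isLinearlyCompact_iff_finiteDimensional [DiscreteTopology M] (K : Submodule ℝ M) :
    IsLinearlyCompact K ↔ FiniteDimensional ℝ K :=
  ⟨fun h => h.finiteDimensional, fun _ => isLinearlyCompact_of_finiteDimensional⟩

end LinearCompactness

/-! ### Evaluations of cochains -/

theorem mem_span_of_forall_eq_zero {V ι : Type*} [Finite ι] [AddCommGroup V] [Module ℝ V]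
    (L : ι → V →ₗ[ℝ] ℝ) (t : V →ₗ[ℝ] ℝ) (h : ∀ x, (∀ i, L i x = 0) → t x = 0) :
    t ∈ Submodule.span ℝ (Set.range L) :=
  mem_span_of_iInf_ker_le_ker fun x hx => h x fun i => (Submodule.mem_iInf _).1 hx i

section Evaluation

variable {g : Type u} [LieRing g] [LieAlgebra ℝ g] [TopologicalSpace g]

/-- The evaluation of cochains. -/
def evalForm {k : ℕ} (v : Fin k → g) : Cochain g k →ₗ[ℝ] ℝ where
  toFun f := f v
  map_add' _ _ := rfl
  map_smul' _ _ := rfl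

theorem evalForm_apply {k : ℕ} (v : Fin k → g) (f : Cochain g k) : evalForm v f = f v := rfl

/-- The linear forms on cochains spanned by the evaluations. -/
def evalSpan (g : Type u) [LieRing g] [LieAlgebra ℝ g] [TopologicalSpace g] (k : ℕ) :
    Submodule ℝ (Cochain g k →ₗ[ℝ] ℝ) :=
  Submodule.span ℝ (Set.range evalForm)

theorem evalForm_mem {k : ℕ} (v : Fin k → g) : evalForm v ∈ evalSpan g k :=
  Submodule.subset_span ⟨v, rfl⟩

/-- The evaluation as a multilinear map. -/
def evalMulti (g : Type u) [LieRing g] [LieAlgebra ℝ g] [TopologicalSpace g] (k : ℕ) :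
    MultilinearMap ℝ (fun _ : Fin k => g) (evalSpan g k) where
  toFun v := ⟨evalForm v, evalForm_mem v⟩
  map_update_add' v i x y := Subtype.ext (LinearMap.ext fun f => f.map_update_add v i x y)
  map_update_smul' v i c x := Subtype.ext (LinearMap.ext fun f => f.map_update_smul v i c x)

theorem evalSpan_hom_ext {k : ℕ} {W : Type*} [AddCommGroup W] [Module ℝ W]
    (ℓ ℓ' : evalSpan g k →ₗ[ℝ] W) (h : ∀ v, ℓ (evalMulti g k v) = ℓ' (evalMulti g k v))
    (t : evalSpan g k) : ℓ t = ℓ' t := by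
  obtain ⟨t, ht⟩ := t
  induction ht using Submodule.span_induction with
  | mem t ht => obtain ⟨v, rfl⟩ := ht; exact h v
  | zero => exact (map_zero ℓ).trans (map_zero ℓ').symm
  | add t t' ht ht' e e' =>
    exact (map_add ℓ ⟨t, ht⟩ ⟨t', ht'⟩).trans
      ((congrArg₂ (· + ·) e e').trans (map_add ℓ' ⟨t, ht⟩ ⟨t', ht'⟩).symm)
  | smul c t ht e =>
    exact (map_smul ℓ c ⟨t, ht⟩).trans
      ((congrArg (c • ·) e).trans (map_smul ℓ' c ⟨t, ht⟩).symm)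

/-- A linear form `ℓ` on the span of the evaluations is represented by the multilinear form sending
`v` to the value of `ℓ` on the evaluation at `v`; it is continuous because `g` is discrete. -/
theorem isDualPair_evalSpan [DiscreteTopology g] (k : ℕ) : IsDualPair (evalSpan g k) where
  separating f hf := ContinuousMultilinearMap.ext fun v => hf _ (evalForm_mem v)
  represents ℓ := by
    refine ⟨⟨ℓ.compMultilinearMap (evalMulti g k), continuous_of_discreteTopology⟩, fun t => ?_⟩
    exact evalSpan_hom_ext ((LinearMap.applyₗ _).comp (evalSpan g k).subtype) ℓ (fun v => rfl) t

/-- Weak continuity of the coboundary: each value of `d f` is a finite combination of values of `f`.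
-/
theorem comp_leibnizD_mem_evalSpan [IsTopologicalLieAlgebra g] {k : ℕ}
    {t : Cochain g (k + 1) →ₗ[ℝ] ℝ} (ht : t ∈ evalSpan g (k + 1)) :
    t.comp (leibnizD k) ∈ evalSpan g k := by
  have h : evalSpan g (k + 1) ≤ (evalSpan g k).comap (LinearMap.lcomp ℝ ℝ (leibnizD (g := g) k)) := by
    refine Submodule.span_le.2 ?_
    rintro _ ⟨v, rfl⟩
    have e : (evalForm v).comp (leibnizD (g := g) k) = ∑ j : Fin (k + 1), ∑ i : Fin k,
        if i.castSucc < j then (-1 : ℝ) ^ (j : ℕ) • evalForm (merge v i j) else 0 := by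
      refine LinearMap.ext fun f => ?_
      rw [LinearMap.comp_apply, evalForm_apply, leibnizD_apply, LinearMap.sum_apply]
      refine Finset.sum_congr rfl fun j _ => ?_
      rw [LinearMap.sum_apply]
      refine Finset.sum_congr rfl fun i _ => ?_
      split_ifs <;> rfl
    show (evalForm v).comp (leibnizD (g := g) k) ∈ evalSpan g k
    rw [e]
    refine sum_mem fun j _ => sum_mem fun i _ => ?_
    split_ifs
    · exact Submodule.smul_mem _ _ (evalForm_mem _)
    · exact zero_mem _
  exact h ht

/-- Alternation is the vanishing of certain evaluations. -/
theorem isWeaklyClosed_skewLast (m k : ℕ) : IsWeaklyClosed (evalSpan g k) (skewLast g m k) :=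
  fun f hf v i j hij hi hj hv => hf _ (evalForm_mem v) fun z hz => hz v i j hij hi hj hv

theorem isWeaklyClosed_hrReps [IsTopologicalLieAlgebra g] (s : ℕ) :
    IsWeaklyClosed (evalSpan g (s + 2)) (hrReps g s) := fun f hf =>
  ⟨isWeaklyClosed_skewLast _ _ f fun t ht h => hf t ht fun z hz => h z hz.1,
    fun v i j hij hi hj hv => hf _ (comp_leibnizD_mem_evalSpan (evalForm_mem v))
      fun z hz => hz.2 v i j hij hi hj hv⟩

/-- A multilinear map on the first block with values in forms on the second, as a form. -/
theorem exists_sliceR_eq [DiscreteTopology g] {a b k : ℕ} (hk : a + b = k)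
    (ℓ : evalSpan g a →ₗ[ℝ] Cochain g b) :
    ∃ f : Cochain g k, ∀ x, sliceR hk f x = ℓ (evalMulti g a x) := by
  refine ⟨biform hk (fun x y => ℓ (evalMulti g a x) y) (fun x p z z' y => ?_)
    (fun x p c z y => ?_) (fun x y p z z' => (ℓ (evalMulti g a x)).map_update_add y p z z')
    (fun x y p c z => (ℓ (evalMulti g a x)).map_update_smul y p c z)
    continuous_of_discreteTopology, fun x => ?_⟩
  · rw [MultilinearMap.map_update_add, map_add]; rfl
  · rw [MultilinearMap.map_update_smul, map_smul]; rfl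
  · ext y
    rw [sliceR_apply]
    exact biform_glue hk _ _ _ _ _ _ x y

/-- Contraction as a linear map of the functional. -/
def contractL [IsTopologicalLieAlgebra g] (hg : LeftContinuous g) {a b k : ℕ} (hk : a + b = k) (f : Cochain g k) :
    (Cochain g a →ₗ[ℝ] ℝ) →ₗ[ℝ] Cochain g b where
  toFun t := contract hg hk t f
  map_add' t t' := ContinuousMultilinearMap.ext fun y => by
    rw [add_apply, contract_apply, contract_apply, contract_apply]; rfl
  map_smul' c t := ContinuousMultilinearMap.ext fun y => by
    rw [smul_apply, contract_apply, contract_apply]; rfl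

/-- Both sides are linear in the functional and agree on evaluations, where contraction is a slice.
-/
theorem contract_of_sliceR [IsTopologicalLieAlgebra g] (hg : LeftContinuous g) {a b k : ℕ} (hk : a + b = k) {f : Cochain g k}
    {ℓ : evalSpan g a →ₗ[ℝ] Cochain g b} (h : ∀ x, sliceR hk f x = ℓ (evalMulti g a x))
    (t : evalSpan g a) : contract hg hk t.1 f = ℓ t := by
  refine evalSpan_hom_ext ((contractL hg hk f).comp (evalSpan g a).subtype) ℓ (fun x => ?_) t
  rw [← h]
  ext y
  exact contract_apply hg hk (evalForm x) f y

/-- The space of multilinear forms is tested on finite-dimensional subspaces by finitely many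
evaluations. -/
theorem exists_finite_test (K : Submodule ℝ g) [FiniteDimensional ℝ K] (k : ℕ) :
    ∃ (n : ℕ) (w : (Fin k → Fin n) → Fin k → g), (∀ I p, w I p ∈ K) ∧
      ∀ z : Cochain g k, (∀ I, z (w I) = 0) → ∀ v, (∀ p, v p ∈ K) → z v = 0 := by
  let b := Module.finBasis ℝ K
  refine ⟨_, fun I p => (b (I p) : g), fun I p => (b (I p)).2, fun z hz v hv => ?_⟩
  have h : z.toMultilinearMap.compLinearMap (fun _ => K.subtype) = 0 :=
    Module.Basis.ext_multilinear (fun _ => b) fun I => hz I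
  exact congrArg (fun f : MultilinearMap ℝ (fun _ : Fin k => K) ℝ => f fun p => ⟨v p, hv p⟩) h

theorem exists_finite_support {k : ℕ} {t : Cochain g k →ₗ[ℝ] ℝ} (ht : t ∈ evalSpan g k) :
    ∃ K : Submodule ℝ g, FiniteDimensional ℝ K ∧
      ∀ z : Cochain g k, (∀ v, (∀ p, v p ∈ K) → z v = 0) → t z = 0 := by
  induction ht using Submodule.span_induction with
  | mem t ht =>
    obtain ⟨v, rfl⟩ := ht
    exact ⟨Submodule.span ℝ (Set.range v), FiniteDimensional.span_of_finite ℝ (Set.finite_range _),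
      fun z hz => hz v fun p => Submodule.subset_span ⟨p, rfl⟩⟩
  | zero => exact ⟨⊥, inferInstance, fun z _ => rfl⟩
  | add t t' _ _ h h' =>
    obtain ⟨K, hK, h⟩ := h
    obtain ⟨K', hK', h'⟩ := h'
    refine ⟨K ⊔ K', inferInstance, fun z hz => ?_⟩
    rw [LinearMap.add_apply, h z fun v hv => hz v fun p => le_sup_left (a := K) (hv p),
      h' z fun v hv => hz v fun p => le_sup_right (a := K) (hv p), add_zero]
  | smul c t _ h =>
    obtain ⟨K, hK, h⟩ := h
    exact ⟨K, hK, fun z hz => by rw [LinearMap.smul_apply, h z hz, smul_zero]⟩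

variable {k : ℕ} {Z : Submodule ℝ (Cochain g k)} {E : Type u} [AddCommGroup E] [Module ℝ E]

theorem isFiniteTopology_of_iff (q : Z →ₗ[ℝ] E) (hq : Function.Surjective q)
    {𝒰 : Set (Submodule ℝ E)}
    (h : ∀ N, N ∈ 𝒰 ↔ ∃ K : Submodule ℝ g, FiniteDimensional ℝ K ∧
      ∀ z : Z, (∀ v, (∀ p, v p ∈ K) → z.1 v = 0) → q z ∈ N) : IsFiniteTopology 𝒰 where
  top_mem := (h _).2 ⟨⊥, inferInstance, fun _ _ => trivial⟩
  mem_of_le U hU U' hle := by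
    obtain ⟨K, hK, hz⟩ := (h _).1 hU
    exact (h _).2 ⟨K, hK, fun z hzK => hle (hz z hzK)⟩
  inf_mem U hU U' hU' := by
    obtain ⟨K, hK, hz⟩ := (h _).1 hU
    obtain ⟨K', hK', hz'⟩ := (h _).1 hU'
    exact (h _).2 ⟨K ⊔ K', inferInstance, fun z hzK =>
      ⟨hz z fun v hv => hzK v fun p => le_sup_left (a := K) (hv p),
        hz' z fun v hv => hzK v fun p => le_sup_right (a := K) (hv p)⟩⟩
  finite U hU := by
    obtain ⟨K, hK, hz⟩ := (h _).1 hU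
    -- Vanishing on `K` is tested by finitely many evaluations, so that `E ⧸ U` is a quotient of a
    -- finite-dimensional space of values.
    obtain ⟨n, w, hw, hwz⟩ := exists_finite_test K k
    let f : Z →ₗ[ℝ] (Fin k → Fin n) → ℝ := LinearMap.pi fun I => (evalForm (w I)).comp Z.subtype
    obtain ⟨m, hm⟩ := exists_factor_of_ker_le (V := Z) (X := (Fin k → Fin n) → ℝ) (Y := E ⧸ U) f
      (U.mkQ.comp q) fun z hz0 => (Submodule.Quotient.mk_eq_zero U).2
        (hz z (hwz z.1 fun I => congrFun hz0 I))
    refine Module.Finite.of_surjective m fun x => ?_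
    obtain ⟨e, rfl⟩ := U.mkQ_surjective x
    obtain ⟨z, rfl⟩ := hq e
    exact ⟨f z, hm z⟩

/-- A form that vanishes on the classes of cochains vanishing on a finite-dimensional `K` is a
combination of the finitely many evaluations testing this. Conversely, a combination of evaluations
involves only finitely many vectors of `g`. -/
theorem openForms_eq_inducedForms (q : Z →ₗ[ℝ] E) (hq : Function.Surjective q)
    {𝒰 : Set (Submodule ℝ E)}
    (h : ∀ N, N ∈ 𝒰 ↔ ∃ K : Submodule ℝ g, FiniteDimensional ℝ K ∧
      ∀ z : Z, (∀ v, (∀ p, v p ∈ K) → z.1 v = 0) → q z ∈ N) :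
    openForms (isFiniteTopology_of_iff q hq h) = inducedForms (evalSpan g k) q := by
  ext a
  constructor
  · intro ha
    obtain ⟨K, hK, hz⟩ := (h _).1 ha
    obtain ⟨n, w, hw, hwz⟩ := exists_finite_test K k
    have h1 : a.comp q ∈ Submodule.span ℝ
        (Set.range fun I => (evalForm (w I)).comp Z.subtype) :=
      mem_span_of_forall_eq_zero (V := Z) _ _ fun z hz0 => hz z (hwz z.1 hz0)
    have h2 : Submodule.span ℝ (Set.range fun I => (evalForm (w I)).comp Z.subtype) ≤
        (evalSpan g k).map (LinearMap.lcomp ℝ ℝ Z.subtype) := by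
      refine Submodule.span_le.2 ?_
      rintro _ ⟨I, rfl⟩
      exact ⟨_, evalForm_mem (w I), rfl⟩
    obtain ⟨t, ht, hta⟩ := h2 h1
    exact ⟨t, ht, fun z => (LinearMap.congr_fun hta z).symm⟩
  · rintro ⟨t, ht, hta⟩
    obtain ⟨K, hK, hKt⟩ := exists_finite_support ht
    exact (h _).2 ⟨K, hK, fun z hz => (hta z).trans (hKt z.1 hz)⟩

end Evaluation

/-! ### The second page for discrete Lie algebras -/

section DiscretePage

variable {g : Type u} [LieRing g] [LieAlgebra ℝ g] [TopologicalSpace g] [IsTopologicalLieAlgebra g]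

theorem mem_hlOpen_iff [DiscreteTopology g] {n : ℕ} (N : Submodule ℝ (HL g n)) :
    N ∈ hlOpen g n ↔ ∃ K : Submodule ℝ g, FiniteDimensional ℝ K ∧
      ∀ z : Cocycles (leibnizD (g := g)) n, (∀ v, (∀ p, v p ∈ K) → z.1 v = 0) →
        Cohomology.mk (leibnizD (g := g)) n z ∈ N :=
  exists_congr fun K => and_congr_left fun _ => isLinearlyCompact_iff_finiteDimensional K

theorem mem_hrOpen_iff [DiscreteTopology g] {s : ℕ} (N : Submodule ℝ (HR g s)) :
    N ∈ hrOpen g s ↔ ∃ K : Submodule ℝ g, FiniteDimensional ℝ K ∧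
      ∀ z : hrReps g s, (∀ v, (∀ p, v p ∈ K) → z.1 v = 0) → toHR g s z ∈ N := by
  refine exists_congr fun K => and_congr (isLinearlyCompact_iff_finiteDimensional K) ?_
  constructor
  · intro h z hz
    obtain ⟨γ, hγ, rfl⟩ := exists_incl z
    rw [toHR_incl]
    refine h ⟨_, hγ⟩ γ rfl fun v hv x hx => ?_
    have h1 := hz (Fin.cons x v) fun p => Fin.cases hx hv p
    rw [incl_cons] at h1
    exact (mul_eq_zero.1 h1).resolve_left (by simp)
  · rintro h ⟨_, hz⟩ β rfl hβ
    have h1 := h ⟨incl (s + 1) β, mk_mem_cocycles_crD.1 hz⟩ fun v hv => by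
      rw [incl_apply, hβ (Fin.tail v) (fun p => hv p.succ) (v 0) (hv 0), mul_zero]
    rwa [toHR_incl] at h1

/-- `HR` is a quotient of the weakly closed space of representatives. The zero classes are sums of
forms `d y` and alternating forms, and `IsDualPair.exists_sub_mem` shows that these are weakly
closed. -/
theorem isDualPair_inducedForms_toHR [DiscreteTopology g] (s : ℕ) :
    IsDualPair (inducedForms (evalSpan g (s + 2)) (toHR g s)) := by
  refine (isDualPair_evalSpan (s + 2)).inducedForms (isWeaklyClosed_hrReps s)
    (toHR_surjective s) fun z hz => (toHR_eq_zero z).2 ?_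
  refine (isDualPair_evalSpan (s + 1)).exists_sub_mem (leibnizD (s + 1))
    (fun t ht => comp_leibnizD_mem_evalSpan ht) (isWeaklyClosed_skewLast (s + 2) (s + 2))
    (isWeaklyClosed_skewLast s (s + 1)) z.1 fun t ht htS htY => hz t ht fun z' hz' => ?_
  obtain ⟨y, hy, h⟩ := (toHR_eq_zero z').1 hz'
  have h1 := htS _ h
  rwa [map_sub, htY y hy, sub_zero] at h1

theorem mk_leibnizD_eq_zero {n : ℕ} (α : Cochain g n) :
    Cohomology.mk (leibnizD (g := g)) (n + 1) ⟨leibnizD n α, leibnizD_leibnizD α⟩ = 0 :=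
  (Submodule.Quotient.mk_eq_zero _).2 ⟨α, trivial, rfl⟩

theorem exists_of_mk_eq_zero {n : ℕ} {z : Cocycles (leibnizD (g := g)) (n + 1)}
    (h : Cohomology.mk (leibnizD (g := g)) (n + 1) z = 0) : ∃ α, leibnizD n α = z.1 := by
  obtain ⟨α, -, hα⟩ := (Submodule.Quotient.mk_eq_zero _).1 h
  exact ⟨α, hα⟩

/-- The linear forms on `HL` induced by sums of evaluations. -/
abbrev hlForms (g : Type u) [LieRing g] [LieAlgebra ℝ g] [TopologicalSpace g]
    [IsTopologicalLieAlgebra g] (n : ℕ) : Submodule ℝ (HL g n →ₗ[ℝ] ℝ) :=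
  inducedForms (evalSpan g n) (Cohomology.mk (leibnizD (g := g)) n)

/-- The class in `HR` of the contraction of a form whose slices are cocycles. -/
def contractHR (hg : LeftContinuous g) {n s k : ℕ} (hN : n + 1 + (s + 2) = k) :
    biCocycles (g := g) hN →ₗ[ℝ] (Cochain g (n + 1) →ₗ[ℝ] ℝ) →ₗ[ℝ] HR g s :=
  LinearMap.mk₂ ℝ
    (fun f t => toHR g s ⟨contract hg hN t f.1, contract_mem_hrReps hg hN t f.2⟩)
    (fun f f' t => (congrArg (toHR g s) (Subtype.ext (ContinuousMultilinearMap.ext fun y => by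
      show contract hg hN t (f.1 + f'.1) y = contract hg hN t f.1 y + contract hg hN t f'.1 y
      rw [contract_apply, contract_apply, contract_apply, sliceL_add, map_add]))).trans
        ((toHR g s).map_add _ _))
    (fun c f t => (congrArg (toHR g s) (Subtype.ext (ContinuousMultilinearMap.ext fun y => by
      show contract hg hN t (c • f.1) y = c • contract hg hN t f.1 y
      rw [contract_apply, contract_apply, sliceL_smul, map_smul]))).trans
        ((toHR g s).map_smul c ⟨contract hg hN t f.1, contract_mem_hrReps hg hN t f.2⟩))
    (fun f t t' => (congrArg (toHR g s) (Subtype.ext ((contractL hg hN f.1).map_add t t'))).trans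
      ((toHR g s).map_add ⟨_, contract_mem_hrReps hg hN t f.2⟩
        ⟨_, contract_mem_hrReps hg hN t' f.2⟩))
    (fun c f t => (congrArg (toHR g s) (Subtype.ext ((contractL hg hN f.1).map_smul c t))).trans
      ((toHR g s).map_smul c ⟨_, contract_mem_hrReps hg hN t f.2⟩))

/-- Lifts of induced forms on `HL`, and forms on `HL` that extend the forms induced by
cycles. -/
structure HLSplitting (g : Type u) [LieRing g] [LieAlgebra ℝ g] [TopologicalSpace g]
    [IsTopologicalLieAlgebra g] (n : ℕ) where
  restrict : evalSpan g (n + 1) →ₗ[ℝ] hlForms g (n + 1)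
  lift : hlForms g (n + 1) →ₗ[ℝ] evalSpan g (n + 1)
  lift_apply : ∀ a (z : Cocycles (leibnizD (g := g)) (n + 1)), (lift a).1 z.1 =
    a.1 (Cohomology.mk (leibnizD (g := g)) (n + 1) z)
  restrict_apply : ∀ t : evalSpan g (n + 1), (∀ α, t.1 (leibnizD n α) = 0) →
    ∀ z : Cocycles (leibnizD (g := g)) (n + 1),
      (restrict t).1 (Cohomology.mk (leibnizD (g := g)) (n + 1) z) = t.1 z.1

theorem nonempty_hlSplitting (g : Type u) [LieRing g] [LieAlgebra ℝ g] [TopologicalSpace g]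
    [IsTopologicalLieAlgebra g] (n : ℕ) : Nonempty (HLSplitting g n) := by
  have hmk : Function.Surjective (Cohomology.mk (leibnizD (g := g)) (n + 1)) :=
    Cohomology.mk_surjective _ _
  obtain ⟨r, l, hl, hr⟩ := exists_lift_inducedForms (T := evalSpan g (n + 1)) hmk
  refine ⟨⟨r, l, hl, fun t ht => hr t fun z hz => ?_⟩⟩
  obtain ⟨α, hα⟩ := exists_of_mk_eq_zero hz
  rw [← hα, ht]

namespace HLSplitting

variable {n : ℕ} (R : HLSplitting g n)

theorem lift_leibnizD (a : hlForms g (n + 1)) (α : Cochain g n) :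
    (R.lift a).1 (leibnizD n α) = 0 :=
  (R.lift_apply a ⟨leibnizD n α, leibnizD_leibnizD α⟩).trans
    ((congrArg a.1 (mk_leibnizD_eq_zero α)).trans (map_zero a.1))

theorem restrict_lift (a : hlForms g (n + 1)) : R.restrict (R.lift a) = a :=
  Subtype.ext (LinearMap.ext fun x => by
    obtain ⟨z, rfl⟩ := Cohomology.mk_surjective (leibnizD (g := g)) (n + 1) x
    exact (R.restrict_apply _ (R.lift_leibnizD a) z).trans (R.lift_apply a z))

theorem lift_restrict (t : evalSpan g (n + 1)) (ht : ∀ α, t.1 (leibnizD n α) = 0)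
    (z : Cochain g (n + 1)) (hz : leibnizD (n + 1) z = 0) :
    (R.lift (R.restrict t)).1 z = t.1 z :=
  (R.lift_apply _ ⟨z, hz⟩).trans (R.restrict_apply t ht ⟨z, hz⟩)

/-- A form `t ∘ d` vanishes on cocycles, hence also on coboundaries, and induces zero on `HL`. -/
theorem restrict_eq_zero (t : evalSpan g (n + 1 + 1)) :
    R.restrict ⟨t.1.comp (leibnizD (n + 1)), comp_leibnizD_mem_evalSpan t.2⟩ = 0 :=
  Subtype.ext (LinearMap.ext fun x => by
    obtain ⟨z, rfl⟩ := Cohomology.mk_surjective (leibnizD (g := g)) (n + 1) x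
    refine (R.restrict_apply _ (fun α => ?_) z).trans ?_
    · show t.1 (leibnizD (n + 1) (leibnizD n α)) = 0
      rw [leibnizD_leibnizD, map_zero]
    · show t.1 (leibnizD (n + 1) z.1) = 0
      rw [LinearMap.mem_ker.1 z.2, map_zero])

/-- Families of forms parametrized by forms on `HL` define forms whose slices are cocycles. -/
theorem exists_sliceR_eq [DiscreteTopology g] (hg : LeftContinuous g) {b k : ℕ}
    (hk : n + 1 + b = k) (ℓ : hlForms g (n + 1) →ₗ[ℝ] Cochain g b) :
    ∃ f : Cochain g k, (∀ x, sliceR hk f x = ℓ (R.restrict (evalMulti g (n + 1) x))) ∧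
      (∀ t : evalSpan g (n + 1), contract hg hk t.1 f = ℓ (R.restrict t)) ∧
      ∀ y, leibnizD (n + 1) (sliceL hk f y) = 0 := by
  obtain ⟨f, hf⟩ := Leibniz.exists_sliceR_eq hk (ℓ.comp R.restrict)
  have hc : ∀ t : evalSpan g (n + 1), contract hg hk t.1 f = ℓ (R.restrict t) :=
    contract_of_sliceR hg hk hf
  refine ⟨f, hf, hc, fun y => ContinuousMultilinearMap.ext fun w => ?_⟩
  -- The coboundary of the slice, evaluated at `w`, is the contraction of `f` with the evaluation at
  -- `w` composed with `d`, and this functional restricts to zero.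
  have h1 := hc ⟨_, comp_leibnizD_mem_evalSpan (evalForm_mem w)⟩
  rw [R.restrict_eq_zero ⟨_, evalForm_mem w⟩, map_zero] at h1
  have h2 := contract_apply hg hk ((evalForm w).comp (leibnizD (n + 1))) f y
  rw [h1] at h2
  exact h2.symm

/-- The second page, in terms of linear maps from forms on `HL` to `HR`. -/
def toHom (hg : LeftContinuous g) {s k : ℕ} (hN : n + 1 + (s + 2) = k) :
    biCocycles (g := g) hN →ₗ[ℝ] hlForms g (n + 1) →ₗ[ℝ] HR g s :=
  (LinearMap.lcomp ℝ (HR g s) ((evalSpan g (n + 1)).subtype.comp R.lift)).comp (contractHR hg hN)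

theorem toHom_apply (hg : LeftContinuous g) {s k : ℕ} (hN : n + 1 + (s + 2) = k)
    (f : biCocycles (g := g) hN) (a : hlForms g (n + 1)) :
    R.toHom hg hN f a = toHR g s ⟨contract hg hN (R.lift a).1 f.1,
      contract_mem_hrReps hg hN (R.lift a).1 f.2⟩ := rfl

/-- Representatives in `HR` are chosen linearly by a section of `toHR`; the resulting family of
forms, parametrized by forms on `HL`, is assembled to a single form by `exists_sliceR_eq`. -/
theorem toHom_surjective [DiscreteTopology g] (hg : LeftContinuous g) {s k : ℕ}
    (hN : n + 1 + (s + 2) = k) : Function.Surjective (R.toHom (s := s) hg hN) := by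
  intro ψ
  obtain ⟨σ, hσ⟩ := exists_linear_section (V := hrReps g s) (W := HR g s) (toHR g s)
    (toHR_surjective s)
  obtain ⟨f, hf, hfc, hfz⟩ := R.exists_sliceR_eq hg hN ((hrReps g s).subtype.comp (σ.comp ψ))
  refine ⟨⟨f, hfz, fun x => by rw [hf]; exact (σ (ψ _)).2⟩, LinearMap.ext fun a => ?_⟩
  rw [toHom_apply]
  refine (congrArg (toHR g s) (Subtype.ext ?_)).trans (hσ (ψ a))
  refine (hfc (R.lift a)).trans ?_
  rw [R.restrict_lift]
  rfl

/-- A form with slices that are cocycles vanishes on the second page if its contractions with cycles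
are coboundaries. -/
theorem biClass_eq_zero_of_contract [DiscreteTopology g] (hg : LeftContinuous g) {s m : ℕ}
    (hN : n + 1 + (s + 2) = m + 2) (f f₀ : biCocycles (g := g) hN)
    (hf₀ : ∀ x, sliceR hN f₀.1 x =
      contract hg hN (R.lift (R.restrict (evalMulti g (n + 1) x))).1 f.1)
    (h : R.toHom hg hN f = 0) : biClass hN f₀ = 0 := by
  have hM : n + 1 + (s + 1) = m + 1 := by omega
  let d' : skewLast g s (s + 1) →ₗ[ℝ] Cochain g (s + 2) ⧸ skewLast g (s + 2) (s + 2) :=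
    ((skewLast g (s + 2) (s + 2)).mkQ.comp (leibnizD (s + 1))).comp (Submodule.subtype _)
  let c : hlForms g (n + 1) →ₗ[ℝ] Cochain g (s + 2) ⧸ skewLast g (s + 2) (s + 2) :=
    (skewLast g (s + 2) (s + 2)).mkQ.comp
      ((contractL hg hN f.1).comp ((evalSpan g (n + 1)).subtype.comp R.lift))
  -- Primitives of the contractions, modulo alternating forms, are chosen linearly in the form on
  -- `HL`, so that they assemble to one primitive `Y` in the second block.
  obtain ⟨y, hy⟩ := exists_lift_of_range_le (V := skewLast g s (s + 1))
    (X := Cochain g (s + 2) ⧸ skewLast g (s + 2) (s + 2)) (A := hlForms g (n + 1)) d' c fun a => by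
      obtain ⟨y, hy, hya⟩ := (toHR_eq_zero _).1
        ((R.toHom_apply hg hN f a).symm.trans (LinearMap.congr_fun h a))
      exact ⟨⟨y, hy⟩, ((Submodule.Quotient.eq _).2 hya).symm⟩
  obtain ⟨Y, hY, -, hYz⟩ := R.exists_sliceR_eq hg hM ((Submodule.subtype _).comp y)
  refine biClass_eq_zero_of_right hN hM f₀ Y
    ((mem_skewLast_iff_sliceR hM (by omega)).2 fun x => ?_) hYz fun x => ?_
  · rw [hY]; exact (y _).2
  · rw [hf₀, hY]
    exact (Submodule.Quotient.eq _).1 (hy (R.restrict (evalMulti g (n + 1) x))).symm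

end HLSplitting

/-- A form all of whose contractions with cycles vanish is a coboundary in the first block. -/
theorem biClass_eq_zero_of_contract_eq_zero [DiscreteTopology g] (hg : LeftContinuous g)
    {n s m : ℕ} (hN : n + 1 + (s + 2) = m + 2) (f : biCocycles (g := g) hN)
    (h : ∀ t : evalSpan g (n + 1), (∀ α, t.1 (leibnizD n α) = 0) → contract hg hN t.1 f.1 = 0) :
    biClass hN f = 0 := by
  have hM : n + (s + 2) = m + 1 := by omega
  -- The contractions of `f` vanish on the kernel of the transpose `δ` of `d` and so factor through
  -- `δ`. The factor `μ`, read as a form, is a primitive in the first block.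
  let δ : evalSpan g (n + 1) →ₗ[ℝ] evalSpan g n :=
    (LinearMap.lcomp ℝ ℝ (leibnizD (g := g) n)).restrict fun t ht => comp_leibnizD_mem_evalSpan ht
  let c : evalSpan g (n + 1) →ₗ[ℝ] skewLast g (s + 1) (s + 2) :=
    ((contractL hg hN f.1).comp (evalSpan g (n + 1)).subtype).codRestrict _ fun t =>
      (contract_mem_hrReps hg hN t.1 f.2).1
  obtain ⟨μ, hμ⟩ := exists_factor_of_ker_le (V := evalSpan g (n + 1)) (X := evalSpan g n)
    (Y := skewLast g (s + 1) (s + 2)) δ c fun t ht => Subtype.ext (h t fun α =>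
      LinearMap.congr_fun (congrArg Subtype.val ht) α)
  obtain ⟨y, hy⟩ := exists_sliceR_eq hM ((Submodule.subtype _).comp μ)
  refine biClass_eq_zero_of_left hN hM f y
    ((mem_skewLast_iff_sliceR hM (by omega)).2 fun x => ?_) fun z => ?_
  · rw [hy]; exact (μ _).2
  · ext w
    have h1 := contract_of_sliceR hg hM hy (δ (evalMulti g (n + 1) w))
    have h2 : contract hg hM (δ (evalMulti g (n + 1) w)).1 y =
        contract hg hN (evalForm w) f.1 :=
      h1.trans (congrArg Subtype.val (hμ (evalMulti g (n + 1) w)))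
    have h3 := congrArg (fun F : Cochain g (s + 2) => F z) h2
    simp only [contract_apply] at h3
    exact h3.symm

/-- Let `f₀` be obtained from `f` by applying `lift ∘ restrict` to evaluations in the first block.
The contractions of `f - f₀` with cycles vanish, so that it is a coboundary in the first block. If
the contractions of `f` are zero in `HR`, then `f₀` is a coboundary in the second block, modulo
alternating forms. -/
theorem HLSplitting.toHom_eq_zero_iff [DiscreteTopology g] {n s m : ℕ} (R : HLSplitting g n)
    (hg : LeftContinuous g) (hN : n + 1 + (s + 2) = m + 2) (f : biCocycles (g := g) hN) :
    biClass hN f = 0 ↔ R.toHom hg hN f = 0 := by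
  refine ⟨fun h => LinearMap.ext fun a =>
    toHR_contract_eq_zero hg hN (R.lift a).1 (R.lift_leibnizD a) f h, fun h => ?_⟩
  obtain ⟨f₀, hf₀, hf₀c, hf₀z⟩ := R.exists_sliceR_eq hg hN
    ((contractL hg hN f.1).comp ((evalSpan g (n + 1)).subtype.comp R.lift))
  have hb : f₀ ∈ biCocycles hN :=
    ⟨hf₀z, fun x => by rw [hf₀]; exact contract_mem_hrReps hg hN _ f.2⟩
  have h0 := R.biClass_eq_zero_of_contract hg hN f ⟨f₀, hb⟩ hf₀ h
  have h1 : biClass hN (f - ⟨f₀, hb⟩) = 0 :=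
    biClass_eq_zero_of_contract_eq_zero hg hN _ fun t ht => by
      ext y
      have h2 := congrArg (fun F : Cochain g (s + 2) => F y) (hf₀c t)
      have h3 := R.lift_restrict t ht (sliceL hN f.1 y) (f.2.1 y)
      rw [contract_apply]
      show t.1 (sliceL hN (f.1 - f₀) y) = 0
      rw [sliceL_sub, map_sub, sub_eq_zero, ← h3]
      rw [← contract_apply hg hN t.1 f₀ y, ← contract_apply hg hN _ f.1 y]
      exact h2.symm
  exact (sub_eq_zero.1 ((map_sub (biClass hN) f ⟨f₀, hb⟩).symm.trans h1)).trans h0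

theorem HLSplitting.toHom_cross [DiscreteTopology g] {n s k : ℕ} (R : HLSplitting g n)
    (hg : LeftContinuous g) (hN : n + 1 + (s + 2) = k)
    (α : Cocycles (leibnizD (g := g)) (n + 1)) (β : hrReps g s) (a : hlForms g (n + 1)) :
    R.toHom hg hN ⟨cross α.1 β.1 hN, cross_mem_biCocycles hN α.2 β.2⟩ a =
      a.1 (Cohomology.mk (leibnizD (g := g)) (n + 1) α) • toHR g s β := by
  have h1 := contract_cross hg hN (R.lift a).1 α.1 β.1
  rw [R.lift_apply a α] at h1
  exact (congrArg (toHR g s) (Subtype.ext h1)).trans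
    ((toHR g s).map_smul (a.1 (Cohomology.mk (leibnizD (g := g)) (n + 1) α)) β)

/-- Both `biClass` and `toHom` are surjective on the forms whose slices are cocycles, and their
kernels agree. -/
theorem exists_equiv_hom [DiscreteTopology g] {n s m : ℕ} (hN : n + 1 + (s + 2) = m + 2) :
    ∃ e : Page (rgD g) (rgFiltration g) 2 s m ≃ₗ[ℝ] hlForms g (n + 1) →ₗ[ℝ] HR g s,
      ∀ (α : Cocycles (leibnizD (g := g)) (n + 1)) (β : hrReps g s) (a : hlForms g (n + 1)),
        e (crossClass hN α β) a =
          a.1 (Cohomology.mk (leibnizD (g := g)) (n + 1) α) • toHR g s β := by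
  have hg := leftContinuous_of_discrete (g := g)
  obtain ⟨R⟩ := nonempty_hlSplitting g n
  obtain ⟨e, he⟩ := exists_equiv_of_ker_eq (V := biCocycles (g := g) hN)
    (P := Page (rgD g) (rgFiltration g) 2 s m) (Q := hlForms g (n + 1) →ₗ[ℝ] HR g s)
    (biClass hN) (R.toHom hg hN) (biClass_surjective hg hN) (R.toHom_surjective hg hN)
    (R.toHom_eq_zero_iff hg hN)
  exact ⟨e, fun α β a => (LinearMap.congr_fun (he _) a).trans (R.toHom_cross hg hN α β a)⟩

set_option maxHeartbeats 1000000 in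
theorem exists_completed_equiv_of_discrete [DiscreteTopology g] {n s m : ℕ}
    (hN : n + 1 + (s + 2) = m + 2) :
    ∃ e : CompletedTensor (hlOpen g (n + 1)) (hrOpen g s) ≃ₗ[ℝ]
        Page (rgD g) (rgFiltration g) 2 s m,
      ∀ (α : Cocycles (leibnizD (g := g)) (n + 1)) (β : hrReps g s),
        e (CompletedTensor.tmul (hlOpen g (n + 1)) (hrOpen g s)
          (Cohomology.mk (leibnizD (g := g)) (n + 1) α) (toHR g s β)) = crossClass hN α β := by
  have hmk : Function.Surjective (Cohomology.mk (leibnizD (g := g)) (n + 1)) :=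
    Cohomology.mk_surjective _ _
  obtain ⟨e', he'⟩ := exists_equiv_hom (g := g) hN
  obtain ⟨e, he⟩ := exists_completed_equiv_of_hom (E := HL g (n + 1)) (F := HR g s)
    (isFiniteTopology_of_iff _ hmk mem_hlOpen_iff)
    (isFiniteTopology_of_iff _ (toHR_surjective s) mem_hrOpen_iff)
    (openForms_eq_inducedForms _ hmk mem_hlOpen_iff)
    (openForms_eq_inducedForms _ (toHR_surjective s) mem_hrOpen_iff)
    (isDualPair_inducedForms_toHR s) e'
  exact ⟨e, fun α β => he _ _ _ (he' α β)⟩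

end DiscretePage

/-! ### The filtration of `C_RG`, and the theorem -/

section Main

variable {g : Type u} [LieRing g] [LieAlgebra ℝ g] [TopologicalSpace g] [IsTopologicalLieAlgebra g]

/-- In degree `m`, alternation in the last `m + 1` arguments already means lying in the image of
`i`. The case `m = s` makes the row `n = 0` vanish. -/
theorem rgFiltration_eq_bot {s m : ℕ} (h : m ≤ s) : rgFiltration g s m = ⊥ := by
  rw [eq_bot_iff]
  rintro _ ⟨f, hf, rfl⟩
  exact (Submodule.mem_bot ℝ).2 (mk_CRG_eq_zero.2 (skewLast_anti _ (by omega) hf))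

theorem isFirstQuadrant_rgFiltration : IsFirstQuadrant (rgD g) (rgFiltration g) where
  d_d := rgD_rgD
  zero m := by
    rw [rgFiltration, skewLast_eq_top (by omega), Submodule.map_top, LinearMap.range_eq_top]
    exact mk_CRG_surjective _
  anti s t m h := Submodule.map_mono (skewLast_anti _ (by omega))
  d_mem s m := by
    rintro _ ⟨f, hf, rfl⟩
    rw [rgD_mk]
    exact ⟨_, leibnizD_skewLast _ _ f hf, rfl⟩
  bot s m h := rgFiltration_eq_bot h.le

set_option maxHeartbeats 1000000 in
theorem exists_completed_equiv_page {n s m : ℕ} (hN : n + 1 + (s + 2) = m + 2)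
    (h : DiscreteTopology g ∨ IsProFiniteDimensional g) :
    ∃ e : CompletedTensor (hlOpen g (n + 1)) (hrOpen g s) ≃ₗ[ℝ]
        Page (rgD g) (rgFiltration g) 2 s m,
      ∀ (α : Cocycles (leibnizD (g := g)) (n + 1)) (β : hrReps g s),
        e (CompletedTensor.tmul (hlOpen g (n + 1)) (hrOpen g s)
          (Cohomology.mk (leibnizD (g := g)) (n + 1) α) (toHR g s β)) = crossClass hN α β := by
  obtain h | h := h
  · exact exists_completed_equiv_of_discrete hN
  · exact exists_completed_equiv_of_proFinite h hN

/-- The representative is the correction of the product form, from which it differs by an element of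
`F^{s+1}`; the product form itself need not lie in `Z_2^s`. -/
theorem crossClass_incl {n s m : ℕ} (hN : n + 1 + (s + 2) = m + 2)
    (α : Cocycles (leibnizD (g := g)) (n + 1)) (γ : CoadCochain g (s + 1))
    (hγ : CR.mk g s γ ∈ Cocycles (crD g) s) :
    ∃ (x : CRG g m) (hx : x ∈ pageCycles (rgD g) (rgFiltration g) 2 s m),
      x - CRG.mk g m (cross α.1 (incl (s + 1) γ) hN) ∈ rgFiltration g (s + 1) m ∧
      crossClass hN α ⟨incl (s + 1) γ, mk_mem_cocycles_crD.1 hγ⟩ =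
        Page.mk (rgD g) (rgFiltration g) 2 s m ⟨x, hx⟩ := by
  have hk : n + (s + 3) = m + 2 := by omega
  have hc := cross_mem_biCocycles hN α.2 (mk_mem_cocycles_crD.1 hγ)
  refine ⟨CRG.mk g m (corr hk (cross α.1 (incl (s + 1) γ) hN)),
    (mk_mem_pageCycles (by omega)).2 (corr_mem_pageReps hN hk hc), ?_, rfl⟩
  rw [← map_sub]
  exact ⟨_, corr_sub_mem hk (biCocycles_skew hN hc), rfl⟩

set_option maxHeartbeats 1000000 in
theorem exists_completed_equiv_entry {s n m : ℕ} (hm : s + (n + 1) = m)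
    (h : DiscreteTopology g ∨ IsProFiniteDimensional g) {P : Type u} [AddCommGroup P] [Module ℝ P]
    (φ : Page (rgD g) (rgFiltration g) 2 s m ≃ₗ[ℝ] P) :
    ∃ e : CompletedTensor (hlOpen g (n + 1)) (hrOpen g s) ≃ₗ[ℝ] P,
      ∀ (α : Cocycles (leibnizD (g := g)) (n + 1)) (γ : CoadCochain g (s + 1))
        (hγ : CR.mk g s γ ∈ Cocycles (crD g) s),
        ∃ (x : CRG g m) (hx : x ∈ pageCycles (rgD g) (rgFiltration g) 2 s m),
          x - CRG.mk g m (cross α.1 (incl (s + 1) γ) (by omega)) ∈ rgFiltration g (s + 1) m ∧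
          e (CompletedTensor.tmul (hlOpen g (n + 1)) (hrOpen g s)
              (Cohomology.mk (leibnizD (g := g)) (n + 1) α)
              (Cohomology.mk (crD g) s ⟨CR.mk g s γ, hγ⟩)) =
            φ (Page.mk (rgD g) (rgFiltration g) 2 s m ⟨x, hx⟩) := by
  have hN : n + 1 + (s + 2) = m + 2 := by omega
  obtain ⟨e, he⟩ := exists_completed_equiv_page hN h
  refine ⟨e.trans φ, fun α γ hγ => ?_⟩
  obtain ⟨x, hx, hxF, hxe⟩ := crossClass_incl hN α γ hγ
  have h1 := he α ⟨incl (s + 1) γ, mk_mem_cocycles_crD.1 hγ⟩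
  rw [toHR_incl γ hγ, hxe] at h1
  exact ⟨x, hx, hxF, congrArg φ h1⟩

end Main

end Leibniz

theorem theorem3p5 {g : Type u} [LieRing g] [LieAlgebra ℝ g] [TopologicalSpace g]
    [IsTopologicalLieAlgebra g] :
    ConvergesToCohomology (rgD g) (rgFiltration g) ∧
    ∃ (E : SpecSeq.{u})
      (φ : ∀ r s n m : ℕ, s + n = m →
        (Page (rgD g) (rgFiltration g) r s m ≃ₗ[ℝ] E.entry r s n)),
      IsSpecSeqOf (rgD g) (rgFiltration g) E φ ∧
      (∀ s : ℕ, Subsingleton (E.entry 2 s 0)) ∧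
      ((DiscreteTopology g ∨ IsProFiniteDimensional g) → ∀ s n : ℕ, 1 ≤ n →
        ∃ e : CompletedTensor (hlOpen g n) (hrOpen g s) ≃ₗ[ℝ] E.entry 2 s n,
          ∀ (α : Cocycles (leibnizD (g := g)) n) (γ : CoadCochain g (s + 1))
            (hγ : CR.mk g s γ ∈ Cocycles (crD g) s),
            ∃ (x : CRG g (s + n)) (hx : x ∈ pageCycles (rgD g) (rgFiltration g) 2 s (s + n)),
              x - CRG.mk g (s + n) (cross α.1 (incl (s + 1) γ) (by omega)) ∈
                rgFiltration g (s + 1) (s + n) ∧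
              e (CompletedTensor.tmul (hlOpen g n) (hrOpen g s)
                  (Cohomology.mk (leibnizD (g := g)) n α) (Cohomology.mk (crD g) s ⟨CR.mk g s γ, hγ⟩)) =
                φ 2 s n (s + n) rfl (Page.mk (rgD g) (rgFiltration g) 2 s (s + n) ⟨x, hx⟩)) := by
  have hF : IsFirstQuadrant (rgD g) (rgFiltration g) := isFirstQuadrant_rgFiltration
  refine ⟨hF.convergesToCohomology, specSeq hF, pageEntry hF, isSpecSeqOf_specSeq hF,
    fun s => pageEntry_subsingleton hF (rgFiltration_eq_bot le_rfl), ?_⟩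
  rintro h s (_ | n) hn
  · omega
  exact exists_completed_equiv_entry rfl h (pageEntry hF 2 s (n + 1) (s + (n + 1)) rfl)
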